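/- Let $S^2$ be the round unit sphere in $\mathbb R^3=\mathbb R\times\mathbb C$, $\mu$ its normalized area measure, $PS^2$ the projective bundle of $S^2$ (unit tangent vectors up to sign), $m$ the normalized Liouville measure on $PS^2$ (area $\mu$ in the base, uniform angular measure in each fibre), and $\pi:PS^2\to S^2$ the projection. A $C^\infty$ diffeomorphism $h$ of $S^2$ acts on $PS^2$ by $h_\sharp(x,[v])=(hx,[T_xh\,v])$, and $\|Th\,v\|$ for $v\in PS^2$ denotes the norm of the image of a unit vector spanning $v$. For $\delta>0$ let $U_\delta\subset SO(3)$ be the ball of radius $\delta$ about the identity for a bi-invariant metric, with Haar measure restricted to $U_\delta$ and normalized to a probability measure. For a $C^\infty$ diffeomorphism $h_0$ preserving $\mu$, let $\nu_\delta$ and $\nu_{\delta\sharp}$ be the images of this probability measure under $g\mapsto g\circ h_0$ and $g\mapsto (g\circ h_0)_\sharp$. A Borel measure $m'$ on $PS^2$ is stationary for $\nu_{\delta\sharp}$ if $m'(A)=\int m'(h_\sharp^{-1}A)\,d\nu_{\delta\sharp}(h_\sharp)$ for every Borel set $A$. The random exponent $R(\nu_\delta)$ is the number such that, for almost every sequence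 $(h_i)_{i\ge1}$ of independent $\nu_\delta$-distributed diffeomorphisms, the limit $L(x)=\lim_{n\to\infty}\frac1n\log\|T_x(h_n\circ\cdots\circ h_1)\|$ exists for $\mu$-almost every $x$ and $\int_{S^2}L\,d\mu=R(\nu_\delta)$. (1) Let $h_0$ be a $\mu$-preserving $C^\infty$ diffeomorphism of $S^2$ that is not an isometry, and let $\delta>0$. Then there is a measure $m_\delta$ on $PS^2$ that is stationary for $\nu_{\delta\sharp}$, is absolutely continuous with respect to $m$ with $C^\infty$ density, and satisfies $\pi_*m_\delta=\mu$; it is the unique stationary measure that is absolutely continuous with respect to $m$ and projects to $\mu$. Moreover, the random exponent $R(\nu_\delta)$ exists and $$R(\nu_\delta)=\int_{PS^2}\log\|Th_0\,v\|\,dm_\delta(v)>0 .$$ (2) For $\varepsilon\in\mathbb R$ let $f_\varepsilon:S^2\to S^2$ be the twist map $f_\varepsilon(r,z)=\bigl(r,\exp\bigl(2\pi i(\tfrac r2+\tfrac12)\varepsilon\bigr)z\bigr)$, i.e. the map $(r,z)\mapsto(r,\exp(2\pi i(r+\frac12)\varepsilon)z)$ of the sphere of radius $\frac12$, carried to the unit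 sphere by the homothety of ratio $2$. Then for all $\delta>0$, $\varepsilon\ne0$ and $g\in SO(3)$ the conclusions of (1) hold for $h_0=g f_\varepsilon$: there is a measure $m_{g,\varepsilon,\delta}$ on $PS^2$, stationary for the random process given by $U_\delta g f_\varepsilon$, absolutely continuous with respect to $m$ with $C^\infty$ density and projecting to $\mu$; it is the unique absolutely continuous stationary measure projecting to $\mu$; and the random exponent $R(g,\varepsilon,\delta)$ of this process exists and satisfies $$R(g,\varepsilon,\delta)=\int_{PS^2}\log\|Tf_\varepsilon\,v\|\,dm_{g,\varepsilon,\delta}(v)>0 .$$ -/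

import Mathlib

open MeasureTheory Filter Topology
open scoped Manifold ContDiff

noncomputable section

namespace DiffusedSphere

/-! ### The round sphere, its area measure and its diffeomorphisms -/

/-- Euclidean three-space. -/
abbrev E3 := EuclideanSpace ℝ (Fin 3)

instance : Fact (Module.finrank ℝ E3 = 2 + 1) := ⟨finrank_euclideanSpace_fin⟩

/-- The round unit two-sphere. -/
abbrev S2 := Metric.sphere (0 : E3) 1

/-- `C^∞` diffeomorphisms of the sphere. -/
abbrev Diff := S2 ≃ₘ⟮𝓡 2, 𝓡 2⟯ S2

/-- The normalized surface measure on the unit sphere of a Euclidean space. -/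
def uniformSphere (E : Type*) [NormedAddCommGroup E] [InnerProductSpace ℝ E]
    [FiniteDimensional ℝ E] [MeasurableSpace E] [BorelSpace E] :
    Measure (Metric.sphere (0 : E) 1) :=
  ((volume : Measure E).toSphere Set.univ)⁻¹ • (volume : Measure E).toSphere

/-- Lebesgue (area) measure on the sphere, normalized to be a probability measure. -/
def area : Measure S2 := uniformSphere E3

/-- The tangent plane at `x`, as a Euclidean subspace of three-space: the vectors
orthogonal to `x`. -/
abbrev tangentPlane (x : S2) : Submodule ℝ E3 := (Submodule.span ℝ {(x : E3)})ᗮ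

/-- The identification, by the differential of the inclusion of the sphere into three-space, of
the abstract tangent space at `x` with the tangent plane. The round metric on the abstract
tangent space is the one that makes it an isometry. -/
def tangentEquiv (x : S2) : TangentSpace (𝓡 2) x ≃L[ℝ] tangentPlane x :=
  haveI : FiniteDimensional ℝ (TangentSpace (𝓡 2) x) :=
    inferInstanceAs (FiniteDimensional ℝ (EuclideanSpace ℝ (Fin 2)))
  haveI : T2Space (TangentSpace (𝓡 2) x) :=
    inferInstanceAs (T2Space (EuclideanSpace ℝ (Fin 2)))
  ((LinearEquiv.ofInjective
      (mvfderiv (𝓡 2) ((↑) : S2 → E3) x : TangentSpace (𝓡 2) x →L[ℝ] E3).toLinearMap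
      (injective_mvfderiv_subtypeVal_sphere (n := 2) x)).trans
    (LinearEquiv.ofEq _ _ (range_mvfderiv_subtypeVal (n := 2) x))).toContinuousLinearEquiv

/-- The derivative `T_x h`, as a linear isomorphism between tangent planes. -/
def tangentMap (h : Diff) (x : S2) : tangentPlane x ≃L[ℝ] tangentPlane (h x) :=
  (tangentEquiv x).symm.trans
    ((h.mfderivToContinuousLinearEquiv (by simp) x).trans (tangentEquiv (h x)))

/-- The operator norm `‖T_x h‖`. -/
def tangentNorm (h : Diff) (x : S2) : ℝ :=
  ‖((tangentMap h x : tangentPlane x ≃L[ℝ] tangentPlane (h x)) :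
    tangentPlane x →L[ℝ] tangentPlane (h x))‖

/-! ### Unit tangent bundle and projective bundle -/

/-- The unit tangent bundle: pairs of a point and a unit tangent vector there. -/
abbrev T1S2 := {p : S2 × E3 // p.2 ∈ tangentPlane p.1 ∧ ‖p.2‖ = 1}

/-- The base point of a unit tangent vector. -/
def T1S2.base (u : T1S2) : S2 := u.1.1

/-- A unit tangent vector as an element of the tangent plane. -/
def T1S2.vec (u : T1S2) : tangentPlane u.base := ⟨u.1.2, u.2.1⟩

theorem T1S2.vec_ne_zero (u : T1S2) : u.vec ≠ 0 := by
  intro h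
  have h1 : u.1.2 = 0 := congrArg Subtype.val h
  have h2 := u.2.2
  rw [h1, norm_zero] at h2
  exact zero_ne_one h2

/-- A unit vector of the tangent plane at `x`, as a point of the unit tangent bundle. -/
def T1S2.ofCircle (x : S2) (w : Metric.sphere (0 : tangentPlane x) 1) : T1S2 :=
  ⟨(x, ((w : tangentPlane x) : E3)), (w : tangentPlane x).2, by
    have := mem_sphere_zero_iff_norm.1 w.2
    exact this⟩

/-- The identification of opposite unit tangent vectors. -/
instance antipodal : Setoid T1S2 where
  r u v := u.1.1 = v.1.1 ∧ (u.1.2 = v.1.2 ∨ u.1.2 = -v.1.2)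
  iseqv :=
    { refl := fun _ => ⟨rfl, Or.inl rfl⟩
      symm := by
        rintro u v ⟨h, h' | h'⟩
        · exact ⟨h.symm, Or.inl h'.symm⟩
        · exact ⟨h.symm, Or.inr (by rw [h', neg_neg])⟩
      trans := by
        rintro u v w ⟨h, h'⟩ ⟨k, k'⟩
        refine ⟨h.trans k, ?_⟩
        rcases h' with h' | h' <;> rcases k' with k' | k' <;> rw [h', k'] <;> simp }

/-- The projective bundle of the sphere, i.e. the unit tangent bundle modulo sign. It carries the
quotient of the Borel `σ`-algebra, a set being measurable when its preimage in the unit tangent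
bundle is Borel. -/
abbrev PS2 := Quotient antipodal

/-- The bundle projection. -/
def PS2.proj : PS2 → S2 := Quotient.lift T1S2.base fun _ _ h => h.1

/-- The action `h_♯ (x, v) = (h x, T_x h v / ‖T_x h v‖)` on the unit tangent bundle. -/
def sharp1 (h : Diff) (u : T1S2) : T1S2 :=
  ⟨(h u.base, ‖tangentMap h u.base u.vec‖⁻¹ • (tangentMap h u.base u.vec : E3)),
    Submodule.smul_mem _ _ (tangentMap h u.base u.vec).2, by
      have h0 : tangentMap h u.base u.vec ≠ 0 := by
        simpa using u.vec_ne_zero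
      have h1 : ‖tangentMap h u.base u.vec‖ ≠ 0 := norm_ne_zero_iff.2 h0
      simp only [norm_smul, norm_inv, norm_norm, Submodule.coe_norm]
      exact inv_mul_cancel₀ h1⟩

theorem tangentMap_of_antipodal (h : Diff) {u v : T1S2} (huv : antipodal.r u v) :
    (tangentMap h u.base u.vec : E3) = tangentMap h v.base v.vec ∨
      (tangentMap h u.base u.vec : E3) = -(tangentMap h v.base v.vec : E3) := by
  obtain ⟨⟨x, a⟩, ha⟩ := u
  obtain ⟨⟨y, b⟩, hb⟩ := v
  obtain ⟨h1, h2⟩ := huv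
  dsimp only at h1 h2
  subst h1
  rcases h2 with rfl | rfl
  · exact Or.inl rfl
  · right
    exact congrArg Subtype.val (map_neg (tangentMap h x) (⟨b, hb.1⟩ : tangentPlane x))

theorem norm_tangentMap_of_antipodal (h : Diff) {u v : T1S2} (huv : antipodal.r u v) :
    ‖tangentMap h u.base u.vec‖ = ‖tangentMap h v.base v.vec‖ := by
  simp only [Submodule.coe_norm]
  rcases tangentMap_of_antipodal h huv with e | e <;> rw [e]
  rw [norm_neg]

/-- The action `h_♯` on the projective bundle. -/
def sharp (h : Diff) : PS2 → PS2 :=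
  Quotient.map (sharp1 h) (by
    intro u v huv
    refine ⟨congrArg h huv.1, ?_⟩
    simp only [sharp1]
    rw [norm_tangentMap_of_antipodal h huv]
    rcases tangentMap_of_antipodal h huv with e | e <;> rw [e]
    · exact Or.inl rfl
    · exact Or.inr (smul_neg _ _))

/-- The number `‖Th v‖` for a line `v` in the projective bundle: the norm of the image of either
unit vector in it. -/
def stretch (h : Diff) : PS2 → ℝ :=
  Quotient.lift (fun u => ‖tangentMap h u.base u.vec‖)
    fun _ _ huv => norm_tangentMap_of_antipodal h huv

/-- Normalized Liouville measure on the projective bundle: area in the base, and uniform measure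
(by angle) in each fibre. -/
def liouville : Measure PS2 :=
  area.bind fun x =>
    (uniformSphere (tangentPlane x)).map fun w => (Quotient.mk antipodal (T1S2.ofCircle x w) : PS2)

/-- A function on the projective bundle is smooth when its lift to the unit tangent bundle, a
compact submanifold of `ℝ³ × ℝ³`, is the restriction of a smooth function. -/
def IsSmooth (φ : PS2 → ℝ) : Prop :=
  ∃ F : E3 × E3 → ℝ, ContDiff ℝ ∞ F ∧
    ∀ u : T1S2, F ((u.1.1 : E3), u.1.2) = φ (Quotient.mk antipodal u)

/-- `m` has a smooth density with respect to Liouville measure. -/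
def HasSmoothDensity (m : Measure PS2) : Prop :=
  ∃ φ : PS2 → ℝ, IsSmooth φ ∧ (∀ v, 0 ≤ φ v) ∧
    m = liouville.withDensity fun v => ENNReal.ofReal (φ v)

/-! ### Rotations -/

/-- The rotation group. -/
abbrev SO3 := Matrix.specialOrthogonalGroup (Fin 3) ℝ

theorem SO3.mul_transpose (g : SO3) : (g : Matrix (Fin 3) (Fin 3) ℝ) * (g : Matrix _ _ ℝ).transpose = 1 :=
  (Matrix.mem_orthogonalGroup_iff _ _).1 g.2.1

theorem SO3.transpose_mul (g : SO3) : (g : Matrix (Fin 3) (Fin 3) ℝ).transpose * (g : Matrix _ _ ℝ) = 1 :=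
  (Matrix.mem_orthogonalGroup_iff' _ _).1 g.2.1

theorem SO3.coe_inv (g : SO3) : ((g⁻¹ : SO3) : Matrix (Fin 3) (Fin 3) ℝ) = (g : Matrix _ _ ℝ).transpose :=
  rfl

instance : IsTopologicalGroup SO3 where
  continuous_inv := by
    refine continuous_induced_rng.2 ?_
    exact continuous_subtype_val.matrix_transpose

instance : CompactSpace SO3 := by
  refine isCompact_iff_compactSpace.1 ?_
  have hK : IsCompact {A : Matrix (Fin 3) (Fin 3) ℝ | ∀ i j, A i j ∈ Set.Icc (-1 : ℝ) 1} := by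
    have : IsCompact (Set.pi Set.univ fun _ : Fin 3 => Set.pi Set.univ fun _ : Fin 3 =>
        Set.Icc (-1 : ℝ) 1) :=
      isCompact_univ_pi fun _ => isCompact_univ_pi fun _ => isCompact_Icc
    have h2 : {A : Matrix (Fin 3) (Fin 3) ℝ | ∀ i j, A i j ∈ Set.Icc (-1 : ℝ) 1} =
        (Set.pi Set.univ fun _ : Fin 3 => Set.pi Set.univ fun _ : Fin 3 =>
        Set.Icc (-1 : ℝ) 1) := by
      refine Set.ext fun A => ?_
      exact ⟨fun h i _ j _ => h i j, fun h i j => h i trivial j trivial⟩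
    rw [h2]
    exact this
  refine hK.of_isClosed_subset ?_ ?_
  · have : ((Matrix.specialOrthogonalGroup (Fin 3) ℝ : Submonoid _) : Set (Matrix (Fin 3) (Fin 3) ℝ))
        = {A | A * A.transpose = 1} ∩ {A | A.det = 1} := by
      ext A
      exact Matrix.mem_specialOrthogonalGroup_iff.trans
        (and_congr_left fun _ => Matrix.mem_orthogonalGroup_iff _ _)
    rw [this]
    refine (isClosed_eq ?_ continuous_const).inter (isClosed_eq ?_ continuous_const)
    · exact continuous_id.matrix_mul continuous_id.matrix_transpose
    · exact continuous_id.matrix_det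
  · intro A hA i j
    have h := congrFun (congrFun (SO3.mul_transpose ⟨A, hA⟩) i) i
    simp only [Matrix.mul_apply, Matrix.transpose_apply, Matrix.one_apply_eq] at h
    have h2 : A i j * A i j ≤ 1 := by
      rw [← h]
      exact Finset.single_le_sum (f := fun k => A i k * A i k)
        (fun k _ => mul_self_nonneg _) (Finset.mem_univ j)
    exact abs_le.1 (abs_le_one_iff_mul_self_le_one.2 h2)

instance : MeasurableSpace SO3 := borel SO3

instance : BorelSpace SO3 := ⟨rfl⟩

/-- The angle in `[0, π]` of a rotation. It is the distance to the identity for a bi-invariant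
Riemannian metric on the rotation group. -/
def SO3.angle (g : SO3) : ℝ := Real.arccos (((g : Matrix (Fin 3) (Fin 3) ℝ).trace - 1) / 2)

/-- The ball of radius `δ` about the identity in the rotation group. -/
def rotBall (δ : ℝ) : Set SO3 := {g | SO3.angle g < δ}

/-- Haar measure restricted to the ball of radius `δ`, normalized to be a probability measure. -/
def uniformBall (δ : ℝ) : Measure SO3 := ProbabilityTheory.cond Measure.haar (rotBall δ)

theorem isOpen_rotBall (δ : ℝ) : IsOpen (rotBall δ) := by
  refine isOpen_lt ?_ continuous_const
  refine Real.continuous_arccos.comp ?_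
  exact ((continuous_subtype_val.matrix_trace).sub continuous_const).div_const _

theorem isProbabilityMeasure_uniformBall {δ : ℝ} (hδ : 0 < δ) :
    IsProbabilityMeasure (uniformBall δ) := by
  refine ProbabilityTheory.cond_isProbabilityMeasure ?_
  refine (isOpen_rotBall δ).measure_ne_zero _ ⟨1, ?_⟩
  have h : ((1 : Matrix (Fin 3) (Fin 3) ℝ).trace - 1) / 2 = 1 := by
    simp [Matrix.trace_one]; norm_num
  simpa only [rotBall, SO3.angle, Set.mem_ofPred_eq, Submonoid.coe_one, h, Real.arccos_one]

/-- A rotation as a map of three-space. -/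
def rotVec (A : Matrix (Fin 3) (Fin 3) ℝ) (x : E3) : E3 := WithLp.toLp 2 (A.mulVec (WithLp.ofLp x))

theorem norm_rotVec (g : SO3) (x : E3) : ‖rotVec g x‖ = ‖x‖ := by
  rw [EuclideanSpace.norm_eq, EuclideanSpace.norm_eq]
  congr 1
  have key : ∀ y : Fin 3 → ℝ, ∑ i, ‖y i‖ ^ 2 = dotProduct y y := by
    intro y
    simp [dotProduct, sq]
  rw [key, key]
  change dotProduct ((g : Matrix (Fin 3) (Fin 3) ℝ).mulVec (WithLp.ofLp x))
    ((g : Matrix (Fin 3) (Fin 3) ℝ).mulVec (WithLp.ofLp x)) = _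
  rw [Matrix.dotProduct_mulVec, Matrix.vecMul_mulVec, SO3.transpose_mul, Matrix.vecMul_one]

theorem contDiff_rotVec (A : Matrix (Fin 3) (Fin 3) ℝ) : ContDiff ℝ ∞ (rotVec A) := by
  have : rotVec A = Matrix.toEuclideanCLM (n := Fin 3) (𝕜 := ℝ) A := by
    ext x i
    simp [rotVec]
  rw [this]
  exact ContinuousLinearMap.contDiff _

theorem rotVec_inv_rotVec (g : SO3) (x : E3) : rotVec (g⁻¹ : SO3) (rotVec g x) = x := by
  simp [rotVec, SO3.coe_inv, SO3.transpose_mul]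

/-- A norm-preserving smooth self-map of three-space maps the sphere smoothly to itself. -/
theorem contMDiff_restrict {f : E3 → E3} (hf : ContDiff ℝ ∞ f) (hn : ∀ x, ‖f x‖ = ‖x‖)
    (hs : ∀ x : S2, f x ∈ Metric.sphere (0 : E3) 1 := fun x => by
      rw [mem_sphere_zero_iff_norm, hn]; exact mem_sphere_zero_iff_norm.1 x.2) :
    ContMDiff (𝓡 2) (𝓡 2) ∞ (fun x : S2 => (⟨f x, hs x⟩ : S2)) :=
  ContMDiff.codRestrict_sphere (n := 2) (hf.contMDiff.comp contMDiff_coe_sphere) hs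

/-- A diffeomorphism of the sphere from two mutually inverse norm-preserving smooth self-maps of
three-space. -/
def restrictDiff (f f' : E3 → E3) (hf : ContDiff ℝ ∞ f) (hf' : ContDiff ℝ ∞ f')
    (hn : ∀ x, ‖f x‖ = ‖x‖) (hn' : ∀ x, ‖f' x‖ = ‖x‖)
    (hl : ∀ x, f' (f x) = x) (hr : ∀ x, f (f' x) = x) : Diff where
  toFun x := ⟨f x, by rw [mem_sphere_zero_iff_norm, hn]; exact mem_sphere_zero_iff_norm.1 x.2⟩
  invFun x := ⟨f' x, by rw [mem_sphere_zero_iff_norm, hn']; exact mem_sphere_zero_iff_norm.1 x.2⟩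
  left_inv x := Subtype.ext (hl x)
  right_inv x := Subtype.ext (hr x)
  contMDiff_toFun := contMDiff_restrict hf hn
  contMDiff_invFun := contMDiff_restrict hf' hn'

/-- The rotation `x ↦ g x` as a diffeomorphism of the sphere. -/
def rot (g : SO3) : Diff :=
  restrictDiff (rotVec g) (rotVec (g⁻¹ : SO3)) (contDiff_rotVec _) (contDiff_rotVec _)
    (norm_rotVec g) (norm_rotVec g⁻¹) (rotVec_inv_rotVec g)
    (fun x => by simpa using rotVec_inv_rotVec g⁻¹ x)

/-! ### The twist maps -/

/-- The map `(r, z) ↦ (r, exp (2πi (r/2 + 1/2) ε) z)` of `ℝ × ℂ`, with coordinates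
`r = x₀`, `z = x₁ + i x₂`. -/
def twistVec (ε : ℝ) (x : E3) : E3 :=
  let w : ℂ := Complex.exp (2 * Real.pi * Complex.I * ((x 0 / 2 + 1 / 2 : ℝ) : ℂ) * ε) * ⟨x 1, x 2⟩
  !₂[x 0, w.re, w.im]

theorem twistVec_eq (ε : ℝ) (x : E3) : twistVec ε x =
    !₂[x 0,
      Real.cos (2 * Real.pi * (x 0 / 2 + 1 / 2) * ε) * x 1
        - Real.sin (2 * Real.pi * (x 0 / 2 + 1 / 2) * ε) * x 2,
      Real.cos (2 * Real.pi * (x 0 / 2 + 1 / 2) * ε) * x 2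
        + Real.sin (2 * Real.pi * (x 0 / 2 + 1 / 2) * ε) * x 1] := by
  have h : (2 * Real.pi * Complex.I * ((x 0 / 2 + 1 / 2 : ℝ) : ℂ) * ε : ℂ)
      = ((2 * Real.pi * (x 0 / 2 + 1 / 2) * ε : ℝ) : ℂ) * Complex.I := by
    push_cast; ring
  simp only [twistVec]
  rw [h, Complex.exp_mul_I, ← Complex.ofReal_cos, ← Complex.ofReal_sin]
  generalize Real.cos _ = c
  generalize Real.sin _ = s
  simp

theorem norm_twistVec (ε : ℝ) (x : E3) : ‖twistVec ε x‖ = ‖x‖ := by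
  rw [twistVec_eq, EuclideanSpace.norm_eq, EuclideanSpace.norm_eq]
  congr 1
  simp only [Fin.sum_univ_three, Real.norm_eq_abs, sq_abs]
  simp
  have := Real.sin_sq_add_cos_sq (2 * Real.pi * (x 0 / 2 + 2⁻¹) * ε)
  linear_combination (x 1 ^ 2 + x 2 ^ 2) * this

theorem contDiff_twistVec (ε : ℝ) : ContDiff ℝ ∞ (twistVec ε) := by
  rw [show twistVec ε = _ from funext (twistVec_eq ε)]
  rw [contDiff_euclidean]
  intro i
  have h : ∀ j : Fin 3, ContDiff ℝ ∞ fun x : E3 => x j := fun j => by fun_prop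
  fin_cases i <;> simp <;> fun_prop

theorem twistVec_neg_twistVec (ε : ℝ) (x : E3) : twistVec (-ε) (twistVec ε x) = x := by
  rw [twistVec_eq, twistVec_eq]
  have := Real.sin_sq_add_cos_sq (2 * Real.pi * (x 0 / 2 + 2⁻¹) * ε)
  ext i
  fin_cases i
  · simp
  · simp
    linear_combination (x 1) * this
  · simp
    linear_combination (x 2) * this

/-- The twist map `f_ε` of the sphere. On the sphere of radius `1/2` in `ℝ × ℂ` the map is
`(r, z) ↦ (r, exp (2πi (r + 1/2) ε) z)`; here it is carried to the unit sphere by the homothety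
of ratio `2`. -/
def twist (ε : ℝ) : Diff :=
  restrictDiff (twistVec ε) (twistVec (-ε)) (contDiff_twistVec _) (contDiff_twistVec _)
    (norm_twistVec ε) (norm_twistVec (-ε)) (twistVec_neg_twistVec ε)
    (fun x => by simpa using twistVec_neg_twistVec (-ε) x)

/-! ### Random processes

A probability measure on a set of maps is given as the image of a probability measure `ν` on a
parameter space under a family of maps. -/

/-- The family `g ↦ g ∘ h₀`; with `uniformBall δ` on the rotations `g`, it gives the `δ`-diffused
process about `h₀`. -/
def coset (h₀ : Diff) (g : SO3) : Diff := h₀.trans (rot g)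

/-- A measure `m` is stationary for the random process generated by the maps `F g`, with `g`
distributed by `ν`: it agrees with its convolution with the law of the maps. -/
def IsStationary {Γ X : Type*} [MeasurableSpace Γ] [MeasurableSpace X] (ν : Measure Γ)
    (F : Γ → X → X) (m : Measure X) : Prop :=
  ∀ A : Set X, MeasurableSet A → m A = ∫⁻ g, m (F g ⁻¹' A) ∂ν

/-- The composition `h_n ∘ ⋯ ∘ h_1` of the first `n` maps of a sequence. -/
def iterComp (h : ℕ → Diff) : ℕ → Diff
  | 0 => Diffeomorph.refl (𝓡 2) S2 ∞
  | n + 1 => (iterComp h n).trans (h n)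

/-- `R` is the random exponent of the law of `F g`, with `g` distributed by `ν`: for almost every
independent sequence, the limit of `(1/n) log ‖T_x h^(n)‖` (operator norm) exists for almost every
`x` in the sphere, and its integral over the sphere is `R`. -/
def HasRandomExponent {Γ : Type*} [MeasurableSpace Γ] (ν : Measure Γ) (F : Γ → Diff) (R : ℝ) :
    Prop :=
  ∀ᵐ g ∂(Measure.infinitePi fun _ : ℕ => ν), ∃ L : S2 → ℝ, Integrable L area ∧
    (∀ᵐ x ∂area, Tendsto
      (fun n : ℕ => (1 / (n : ℝ)) * Real.log
        (tangentNorm (iterComp (fun i => F (g i)) n) x))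
      atTop (𝓝 (L x))) ∧
    ∫ x, L x ∂area = R

/-- `m` is an absolutely continuous stationary measure, for the `δ`-diffused process about `h₀` on
the projective bundle, that projects to the area measure of the sphere. -/
structure IsDiffusedStationary (h₀ : Diff) (δ : ℝ) (m : Measure PS2) : Prop where
  stationary : IsStationary (uniformBall δ) (fun g => sharp (coset h₀ g)) m
  absolutelyContinuous : m ≪ liouville
  map_proj : m.map PS2.proj = area

end DiffusedSphere

end

/-! The process is lifted to the unit tangent bundle. `frame` identifies that bundle with the
rotation group, and Liouville measure then becomes Haar measure. One step applies `sharp1 h` and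
then a random rotation. Because `h` preserves area, its action on the circle of directions at a
point has Jacobian `‖Th u‖⁻²`. Densities therefore evolve by `φ ↦ conv δ (pushDensity h φ)`: a
weighted transport followed by an average over a ball of rotations.

Existence and smoothness: the Krylov–Bogoliubov argument gives a stationary probability projecting
to area (`exists_stationary`). A single random rotation already spreads any point over at most a
multiple of Liouville measure (`IsStationary.le_liouville1`), so the density is bounded. Averaging
then regularizes: bounded measurable functions become continuous and `C^n` functions become
`C^(n+1)` (`isCk_conv`), because translating a ball of rotations by an angle `t` changes it by a set
of measure `O(t)`. A fixed density is thus of class `C^n` for every `n`.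

Positivity: consider `∫ φ log φ`. Transport by `h` changes it by exactly `2 ∫ log ‖Th u‖ dm`,
averaging cannot raise it, by Jensen, and stationarity makes the two effects cancel. The mean
logarithmic stretch is therefore half a Jensen defect. If it vanished, strict convexity would make
the density constant, then `‖Th u‖ = 1` for all `u`, and `h` would be an isometry
(`integral_log_stretch1_pos`).

The exponent: Birkhoff's theorem for the skew product on unit tangent vectors gives a growth rate
along almost every vector. For linear maps of a plane, every direction independent of an exceptional
one grows at the rate of the operator norm, so this rate depends only on the base point and the
sequence. The base process is ergodic because bounded harmonic functions on the sphere are constant,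
so the rate is a constant, equal to the mean of `log ‖Th u‖` (`ae_growth`).

Uniqueness: two stationary measures both have positive exponent, so almost every direction for
either is stretched to infinity. Area preservation turns stretching into contraction of angles. The
random compositions then drag the fibre measures of both towards one moving line, and their
integrals of even test functions become asymptotically equal. Averaged over sequences these
integrals do not depend on time, so the measures coincide (`eq_of_isStationary`).

A twist rotates each point about an axis by an angle depending only on the height. Its derivative is
a shear followed by a rotation, so it preserves area, and it visibly changes distances along a
meridian; a further rotation affects neither property. -/

noncomputable section

namespace DiffusedSphere

/-! ### The differential of a diffeomorphism in ambient coordinates -/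

/-- The radial projection of three-space to the sphere (with a junk value at the origin). -/
def radial (y : E3) : S2 :=
  if hy : y = 0 then ⟨EuclideanSpace.single 0 1, by simp⟩
  else ⟨‖y‖⁻¹ • y, by simp [norm_smul, hy]⟩

theorem coe_radial {y : E3} (hy : y ≠ 0) : (radial y : E3) = ‖y‖⁻¹ • y := by
  simp [radial, hy]

theorem S2.norm_coe (x : S2) : ‖(x : E3)‖ = 1 := mem_sphere_zero_iff_norm.1 x.2

theorem S2.coe_ne_zero (x : S2) : (x : E3) ≠ 0 := by
  intro h
  have := S2.norm_coe x
  rw [h, norm_zero] at this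
  exact zero_ne_one this

@[simp] theorem radial_coe (x : S2) : radial x = x := by
  apply Subtype.ext
  rw [coe_radial (S2.coe_ne_zero x), S2.norm_coe x]
  simp

theorem norm_smul_radial (y : E3) : ‖y‖ • (radial y : E3) = y := by
  by_cases hy : y = 0
  · simp [hy]
  · rw [coe_radial hy, smul_smul, mul_inv_cancel₀ (norm_ne_zero_iff.2 hy), one_smul]

theorem radial_smul {t : ℝ} (ht : 0 < t) (y : E3) : radial (t • y) = radial y := by
  by_cases hy : y = 0
  · simp [hy]
  · apply Subtype.ext
    rw [coe_radial hy, coe_radial (smul_ne_zero ht.ne' hy), norm_smul, smul_smul]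
    congr 1
    rw [Real.norm_of_nonneg ht.le]
    field_simp

/-- `ContMDiff.codRestrict_sphere` wants a smooth sphere-valued map on a whole manifold, hence the
passage through the open submanifold of nonzero vectors. -/
theorem contMDiffAt_radial {y : E3} (hy : y ≠ 0) : ContMDiffAt 𝓘(ℝ, E3) (𝓡 2) ∞ radial y := by
  let U : TopologicalSpace.Opens E3 := ⟨{0}ᶜ, isOpen_compl_singleton⟩
  let y' : U := ⟨y, hy⟩
  have h0 : ContMDiff 𝓘(ℝ, E3) 𝓘(ℝ, E3) ∞ (fun z : U => ‖(z : E3)‖⁻¹ • (z : E3)) := by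
    intro z
    have hz : (z : E3) ≠ 0 := z.2
    refine (contMDiffAt_subtype_iff (U := U) (x := z) (f := fun w : E3 => ‖w‖⁻¹ • w)).2 ?_
    refine ContDiffAt.contMDiffAt ?_
    exact ((contDiffAt_id.norm ℝ hz).inv (norm_ne_zero_iff.2 hz)).smul contDiffAt_id
  have h1 := ContMDiff.codRestrict_sphere (n := 2) h0 (fun z => by
    have hz : (z : E3) ≠ 0 := z.2
    simp [norm_smul, hz])
  have h2 : ContMDiff 𝓘(ℝ, E3) (𝓡 2) ∞ (fun z : U => radial (z : E3)) := by
    exact h1.congr fun z => Subtype.ext (coe_radial z.2)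
  exact (contMDiffAt_subtype_iff (U := U) (x := y') (f := radial)).1 (h2 y')

/-- The extension of a diffeomorphism of the sphere to three-space, homogeneous of degree one. -/
def ext (h : Diff) (y : E3) : E3 := ‖y‖ • (h (radial y) : E3)

@[simp] theorem ext_coe (h : Diff) (x : S2) : ext h x = h x := by
  simp [ext, S2.norm_coe x]

theorem norm_ext (h : Diff) (y : E3) : ‖ext h y‖ = ‖y‖ := by
  simp [ext, norm_smul]

theorem ext_ne_zero (h : Diff) {y : E3} (hy : y ≠ 0) : ext h y ≠ 0 := by
  rw [← norm_ne_zero_iff, norm_ext]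
  exact norm_ne_zero_iff.2 hy

theorem radial_ext (h : Diff) {y : E3} (hy : y ≠ 0) : radial (ext h y) = h (radial y) := by
  rw [ext, radial_smul (norm_pos_iff.2 hy), radial_coe]

theorem ext_trans (h k : Diff) (y : E3) : ext (h.trans k) y = ext k (ext h y) := by
  by_cases hy : y = 0
  · simp [ext, hy]
  · rw [ext, ext, norm_ext, radial_ext h hy]
    rfl

theorem ext_refl (y : E3) : ext (Diffeomorph.refl (𝓡 2) S2 ∞) y = y := norm_smul_radial y

theorem ext_symm_ext (h : Diff) (y : E3) : ext h.symm (ext h y) = y := by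
  rw [← ext_trans, Diffeomorph.self_trans_symm, ext_refl]

theorem ext_ext_symm (h : Diff) (y : E3) : ext h (ext h.symm y) = y := by
  rw [← ext_trans, Diffeomorph.symm_trans_self, ext_refl]

theorem ext_smul (h : Diff) {t : ℝ} (ht : 0 ≤ t) (y : E3) : ext h (t • y) = t • ext h y := by
  rcases ht.eq_or_lt with rfl | ht
  · simp [ext]
  · rw [ext, ext, radial_smul ht, norm_smul, Real.norm_of_nonneg ht.le, smul_smul]

theorem contDiffAt_ext (h : Diff) {y : E3} (hy : y ≠ 0) : ContDiffAt ℝ ∞ (ext h) y := by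
  have h1 : ContMDiffAt 𝓘(ℝ, E3) 𝓘(ℝ, E3) ∞ (fun z => (h (radial z) : E3)) y :=
    (contMDiff_coe_sphere (n := 2) _).comp y ((h.contMDiff _).comp y (contMDiffAt_radial hy))
  exact (contDiffAt_id.norm ℝ hy).smul h1.contDiffAt

theorem contDiffOn_ext (h : Diff) : ContDiffOn ℝ ∞ (ext h) {0}ᶜ :=
  fun _ hy => (contDiffAt_ext h hy).contDiffWithinAt

theorem differentiableAt_ext (h : Diff) {y : E3} (hy : y ≠ 0) : DifferentiableAt ℝ (ext h) y :=
  (contDiffAt_ext h hy).differentiableAt (by simp)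

/-- The differential of the homogeneous extension. -/
def dext (h : Diff) (y : E3) : E3 →L[ℝ] E3 := fderiv ℝ (ext h) y

/-- Differentiating `ext h (t • z) = t • ext h z` in `z`: a map homogeneous of degree one has a
derivative homogeneous of degree zero. -/
theorem dext_smul (h : Diff) {t : ℝ} (ht : 0 < t) {y : E3} (hy : y ≠ 0) :
    dext h (t • y) = dext h y := by
  have h1 : HasFDerivAt (ext h) (dext h (t • y)) (t • y) :=
    (differentiableAt_ext h (smul_ne_zero ht.ne' hy)).hasFDerivAt
  have h2 : HasFDerivAt (fun z => ext h (t • z)) ((dext h (t • y)).comp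
      (t • ContinuousLinearMap.id ℝ E3)) y :=
    HasFDerivAt.comp y h1 ((hasFDerivAt_id y).const_smul t)
  have h3 : HasFDerivAt (fun z => ext h (t • z)) (t • dext h y) y := by
    simp only [ext_smul h ht.le]
    exact (differentiableAt_ext h hy).hasFDerivAt.const_smul t
  have h4 := h2.unique h3
  ext1 v
  have h5 := congrArg (fun A : E3 →L[ℝ] E3 => t⁻¹ • A v) h4
  simpa [ht.ne'] using h5

/-- Euler's identity for a homogeneous map of degree one. It makes the radial direction an isometric
summand, so that Jacobians in space and on the sphere agree. -/
theorem dext_self (h : Diff) {y : E3} (hy : y ≠ 0) : dext h y y = ext h y := by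
  have h1 : HasFDerivAt (ext h) (dext h y) y := (differentiableAt_ext h hy).hasFDerivAt
  have h2 : HasDerivAt (fun t : ℝ => ext h (t • y)) (dext h y y) 1 := by
    have h1' : HasFDerivAt (ext h) (dext h y) ((1 : ℝ) • y) := by rwa [one_smul]
    have := h1'.comp_hasDerivAt (1 : ℝ) ((hasDerivAt_id (1 : ℝ)).smul_const y)
    simpa [Function.comp_def] using this
  have h3 : HasDerivAt (fun t : ℝ => ext h (t • y)) (ext h y) 1 := by
    have h4 : HasDerivAt (fun t : ℝ => t • ext h y) (ext h y) 1 := by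
      simpa using (hasDerivAt_id (1 : ℝ)).smul_const (ext h y)
    refine h4.congr_of_eventuallyEq ?_
    filter_upwards [lt_mem_nhds (zero_lt_one (α := ℝ))] with t ht
    exact ext_smul h ht.le y
  exact h2.unique h3

theorem dext_trans (h k : Diff) {y : E3} (hy : y ≠ 0) :
    dext (h.trans k) y = (dext k (ext h y)).comp (dext h y) := by
  have h1 : ext (h.trans k) = ext k ∘ ext h := funext (ext_trans h k)
  rw [dext, h1, fderiv_comp y (differentiableAt_ext k (ext_ne_zero h hy))
    (differentiableAt_ext h hy)]
  rfl

theorem dext_refl {y : E3} (_hy : y ≠ 0) :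
    dext (Diffeomorph.refl (𝓡 2) S2 ∞) y = ContinuousLinearMap.id ℝ E3 := by
  have h1 : ext (Diffeomorph.refl (𝓡 2) S2 ∞) = id := funext ext_refl
  rw [dext, h1, fderiv_id]

theorem contDiffOn_dext (h : Diff) : ContDiffOn ℝ ∞ (dext h) {0}ᶜ :=
  (contDiffOn_ext h).fderiv_of_isOpen isOpen_compl_singleton (by simp)

theorem coe_tangentEquiv (x : S2) (w : TangentSpace (𝓡 2) x) :
    (tangentEquiv x w : E3) = mvfderiv (𝓡 2) ((↑) : S2 → E3) x w := rfl

/-- The chain rule applied to the two sides of `ι ∘ h = ext h ∘ ι`, with `ι` the inclusion of the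
sphere. From here on ordinary derivatives in three-space replace manifold derivatives. -/
theorem coe_tangentMap (h : Diff) (x : S2) (v : tangentPlane x) :
    (tangentMap h x v : E3) = dext h x v := by
  obtain ⟨w, rfl⟩ := (tangentEquiv x).surjective v
  have h1 : (tangentMap h x (tangentEquiv x w) : E3) =
      mvfderiv (𝓡 2) ((↑) : S2 → E3) (h x) (mfderiv (𝓡 2) (𝓡 2) h x w) := by
    simp only [tangentMap, ContinuousLinearEquiv.trans_apply,
      ContinuousLinearEquiv.symm_apply_apply]
    rfl
  rw [h1, coe_tangentEquiv]
  have hc : ∀ y : S2, MDifferentiableAt (𝓡 2) 𝓘(ℝ, E3) ((↑) : S2 → E3) y := fun y =>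
    (contMDiff_coe_sphere (m := 1) y).mdifferentiableAt one_ne_zero
  have hh : MDifferentiableAt (𝓡 2) (𝓡 2) h x := (h.contMDiff x).mdifferentiableAt (by simp)
  have he : MDifferentiableAt 𝓘(ℝ, E3) 𝓘(ℝ, E3) (ext h) (x : E3) :=
    (differentiableAt_ext h (S2.coe_ne_zero x)).mdifferentiableAt
  have h2 := mfderiv_comp x (hc (h x)) hh
  have h3 := mfderiv_comp x he (hc x)
  have h4 : ((↑) : S2 → E3) ∘ h = ext h ∘ ((↑) : S2 → E3) := funext fun y => (ext_coe h y).symm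
  rw [h4, h3, mfderiv_eq_fderiv] at h2
  have h5 := congrArg (fun A => A w) h2
  exact h5.symm

end DiffusedSphere
end

noncomputable section

namespace DiffusedSphere

/-! ### The pointwise ergodic theorem for bounded functions -/

section Birkhoff

variable {X : Type*} [MeasurableSpace X] {μ : Measure X} [IsProbabilityMeasure μ] {T : X → X}

theorem measurable_birkhoffSum {f : X → ℝ} (hT : Measurable T) (hf : Measurable f) (n : ℕ) :
    Measurable (birkhoffSum T f n) := by
  unfold birkhoffSum
  exact Finset.measurable_sum _ fun k _ => hf.comp (hT.iterate k)

theorem integrable_of_abs_le {f : X → ℝ} {C : ℝ} (hf : Measurable f) (hC : ∀ x, |f x| ≤ C) :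
    Integrable f μ :=
  Integrable.of_bound hf.aestronglyMeasurable C (Eventually.of_forall hC)

/-- The running maximum `max (0, S_1 f, …, S_N f)` of Birkhoff sums. -/
def maxSum (T : X → X) (f : X → ℝ) : ℕ → X → ℝ
  | 0, _ => 0
  | n + 1, x => max 0 (f x + maxSum T f n (T x))

theorem maxSum_nonneg (f : X → ℝ) (n : ℕ) (x : X) : 0 ≤ maxSum T f n x := by
  cases n
  · exact le_rfl
  · exact le_max_left _ _

theorem maxSum_le_succ (f : X → ℝ) (n : ℕ) (x : X) : maxSum T f n x ≤ maxSum T f (n + 1) x := by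
  induction n generalizing x with
  | zero => exact le_max_left _ _
  | succ n ih => exact max_le_max le_rfl (add_le_add le_rfl (ih _))

theorem birkhoffSum_le_maxSum (f : X → ℝ) (n : ℕ) (x : X) :
    birkhoffSum T f n x ≤ maxSum T f n x := by
  induction n generalizing x with
  | zero => simp [maxSum]
  | succ n ih =>
    rw [birkhoffSum_succ']
    exact le_max_of_le_right (add_le_add le_rfl (ih _))

theorem measurable_maxSum {f : X → ℝ} (hT : Measurable T) (hf : Measurable f) (n : ℕ) :
    Measurable (maxSum T f n) := by
  induction n with
  | zero => exact measurable_const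
  | succ n ih => exact measurable_const.max (hf.add (ih.comp hT))

theorem maxSum_le {f : X → ℝ} {C : ℝ} (hC : ∀ x, |f x| ≤ C) (n : ℕ) (x : X) :
    maxSum T f n x ≤ n * C := by
  have hC0 : 0 ≤ C := (abs_nonneg _).trans (hC x)
  induction n generalizing x with
  | zero => simp [maxSum]
  | succ n ih =>
    refine max_le (by positivity) ?_
    have h1 := (abs_le.1 (hC x)).2
    have h2 := ih (T x)
    push_cast
    linarith

/-- Garsia's proof of the maximal ergodic theorem. Where the running maximum `M` is positive, `M - M
∘ T ≤ f`; elsewhere `M - M ∘ T ≤ 0`. The left side has integral zero, and the sets where `M` is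
positive increase to the whole space. -/
theorem integral_nonneg_of_exists_birkhoffSum_pos (hT : MeasurePreserving T μ μ) {f : X → ℝ}
    {C : ℝ} (hf : Measurable f) (hC : ∀ x, |f x| ≤ C)
    (hpos : ∀ x, ∃ n, 0 < birkhoffSum T f n x) : 0 ≤ ∫ x, f x ∂μ := by
  have hmono : ∀ x, Monotone fun n => maxSum T f n x := fun x =>
    monotone_nat_of_le_succ fun n => maxSum_le_succ f n x
  have hint : ∀ n, Integrable (maxSum T f n) μ := fun n => by
    refine integrable_of_abs_le (C := n * C) (measurable_maxSum hT.measurable hf n) fun x => ?_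
    rw [abs_of_nonneg (maxSum_nonneg f n x)]
    exact maxSum_le hC n x
  let E : ℕ → Set X := fun n => {x | 0 < maxSum T f (n + 1) x}
  have hE : ∀ n, MeasurableSet (E n) := fun n =>
    measurableSet_lt measurable_const (measurable_maxSum hT.measurable hf (n + 1))
  have key : ∀ n, 0 ≤ ∫ x, (E n).indicator f x ∂μ := by
    intro n
    have h1 : ∀ x, maxSum T f (n + 1) x - maxSum T f (n + 1) (T x) ≤ (E n).indicator f x := by
      intro x
      by_cases hx : x ∈ E n
      · rw [Set.indicator_of_mem hx]
        have hx' : 0 < maxSum T f (n + 1) x := hx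
        have h2 : maxSum T f (n + 1) x = f x + maxSum T f n (T x) := by
          rw [maxSum] at hx' ⊢
          rcases lt_max_iff.1 hx' with h | h
          · exact (lt_irrefl _ h).elim
          · exact max_eq_right h.le
        have h3 := maxSum_le_succ (T := T) f n (T x)
        linarith
      · rw [Set.indicator_of_notMem hx]
        have hx' : maxSum T f (n + 1) x ≤ 0 := not_lt.1 hx
        have := maxSum_nonneg (T := T) f (n + 1) (T x)
        linarith
    have h2 : Integrable (fun x => maxSum T f (n + 1) (T x)) μ :=
      hT.integrable_comp_of_integrable (hint _)
    have h3 : ∫ x, maxSum T f (n + 1) (T x) ∂μ = ∫ x, maxSum T f (n + 1) x ∂μ := by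
      have := integral_map (μ := μ) hT.measurable.aemeasurable
        (f := maxSum T f (n + 1)) (by
          rw [hT.map_eq]; exact (hint _).aestronglyMeasurable)
      rw [← this, hT.map_eq]
    have h4 := integral_mono ((hint (n + 1)).sub h2)
      ((integrable_of_abs_le hf hC).indicator (hE n)) h1
    simp only [Pi.sub_apply] at h4
    rwa [integral_sub (hint _) h2, h3, sub_self] at h4
  have hlim : Tendsto (fun n => ∫ x, (E n).indicator f x ∂μ) atTop (𝓝 (∫ x, f x ∂μ)) := by
    refine tendsto_integral_of_dominated_convergence (fun _ => C) ?_ (integrable_const C) ?_ ?_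
    · exact fun n => (hf.indicator (hE n)).aestronglyMeasurable
    · refine fun n => Eventually.of_forall fun x => ?_
      exact (norm_indicator_le_norm_self f x).trans (hC x)
    · refine Eventually.of_forall fun x => ?_
      obtain ⟨n, hn⟩ := hpos x
      refine tendsto_const_nhds.congr' ?_
      filter_upwards [eventually_ge_atTop n] with k hk
      rw [Set.indicator_of_mem]
      exact hn.trans_le ((birkhoffSum_le_maxSum f n x).trans (hmono x (by omega)))
  exact ge_of_tendsto' hlim key

theorem abs_birkhoffAverage_le {f : X → ℝ} {C : ℝ} (hC : ∀ x, |f x| ≤ C) (n : ℕ) (x : X) :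
    |birkhoffAverage ℝ T f n x| ≤ C := by
  have hC0 : 0 ≤ C := (abs_nonneg _).trans (hC x)
  rcases n.eq_zero_or_pos with rfl | hn
  · simpa using hC0
  · rw [birkhoffAverage, birkhoffSum, smul_eq_mul, abs_mul, abs_of_nonneg (by positivity),
      inv_mul_le_iff₀ (by exact_mod_cast hn)]
    refine (Finset.abs_sum_le_sum_abs _ _).trans ?_
    refine (Finset.sum_le_card_nsmul _ _ C fun k _ => hC _).trans ?_
    simp

theorem isBoundedUnder_le_of_abs_le {u : ℕ → ℝ} {C : ℝ} (h : ∀ n, |u n| ≤ C) :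
    IsBoundedUnder (· ≤ ·) atTop u :=
  isBoundedUnder_of ⟨C, fun n => (abs_le.1 (h n)).2⟩

theorem isBoundedUnder_ge_of_abs_le {u : ℕ → ℝ} {C : ℝ} (h : ∀ n, |u n| ≤ C) :
    IsBoundedUnder (· ≥ ·) atTop u :=
  isBoundedUnder_of ⟨-C, fun n => (abs_le.1 (h n)).1⟩

theorem limsup_le_limsup_of_sub_tendsto_zero {u v : ℕ → ℝ} {C : ℝ} (hu : ∀ n, |u n| ≤ C)
    (hv : ∀ n, |v n| ≤ C) (h : Tendsto (fun n => u n - v n) atTop (𝓝 0)) :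
    limsup u atTop ≤ limsup v atTop := by
  refine le_of_forall_pos_le_add fun ε hε => ?_
  refine limsup_le_of_le (isBoundedUnder_ge_of_abs_le hu).isCoboundedUnder_le ?_
  have h1 := eventually_lt_of_limsup_lt (b := limsup v atTop + ε / 2) (by linarith)
    (isBoundedUnder_le_of_abs_le hv)
  filter_upwards [h1, h.eventually (gt_mem_nhds (half_pos hε))] with n hn hn'
  linarith

/-- The upper limit of Birkhoff averages. -/
def upperAverage (T : X → X) (f : X → ℝ) (x : X) : ℝ :=
  limsup (fun n => birkhoffAverage ℝ T f n x) atTop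

/-- The averages at `x` and at `T x` differ by two boundary terms divided by `n`, which vanish in
the limit for bounded `f`. -/
theorem upperAverage_comp {f : X → ℝ} {C : ℝ} (hC : ∀ x, |f x| ≤ C) (x : X) :
    upperAverage T f (T x) = upperAverage T f x := by
  have hb : Bornology.IsBounded (Set.range f) :=
    (Metric.isBounded_closedBall (x := (0 : ℝ)) (r := C)).subset (by
      rintro _ ⟨y, rfl⟩
      simpa using hC y)
  have h0 := tendsto_birkhoffAverage_apply_sub_birkhoffAverage' ℝ (f := T) hb x
  refine le_antisymm ?_ ?_
  · exact limsup_le_limsup_of_sub_tendsto_zero (fun n => abs_birkhoffAverage_le hC n _)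
      (fun n => abs_birkhoffAverage_le hC n _) h0
  · refine limsup_le_limsup_of_sub_tendsto_zero (fun n => abs_birkhoffAverage_le hC n _)
      (fun n => abs_birkhoffAverage_le hC n _) ?_
    simpa using h0.neg

theorem measurable_birkhoffAverage {f : X → ℝ} (hT : Measurable T) (hf : Measurable f) (n : ℕ) :
    Measurable (birkhoffAverage ℝ T f n) := by
  have h := (measurable_birkhoffSum hT hf n).const_mul ((n : ℝ)⁻¹)
  exact h

theorem measurable_upperAverage {f : X → ℝ} (hT : Measurable T) (hf : Measurable f) :
    Measurable (upperAverage T f) :=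
  Measurable.limsup fun n => measurable_birkhoffAverage hT hf n

theorem abs_upperAverage_le {f : X → ℝ} {C : ℝ} (hC : ∀ x, |f x| ≤ C) (x : X) :
    |upperAverage T f x| ≤ C := by
  have h := fun n => abs_birkhoffAverage_le (T := T) hC n x
  refine abs_le.2 ⟨?_, ?_⟩
  · exact le_limsup_of_frequently_le (Eventually.of_forall fun n => (abs_le.1 (h n)).1).frequently
      (isBoundedUnder_le_of_abs_le h)
  · exact limsup_le_of_le (isBoundedUnder_ge_of_abs_le h).isCoboundedUnder_le
      (Eventually.of_forall fun n => (abs_le.1 (h n)).2)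

theorem iterate_upperAverage {f : X → ℝ} {C : ℝ} (hC : ∀ x, |f x| ≤ C) (n : ℕ) (x : X) :
    upperAverage T f (T^[n] x) = upperAverage T f x := by
  induction n with
  | zero => rfl
  | succ n ih => rw [Function.iterate_succ_apply', upperAverage_comp hC, ih]

/-- The maximal theorem is applied to `f - upperAverage T f + ε`. The upper average is constant
along orbits, so it comes out of Birkhoff sums linearly, and by definition of the upper limit some
sum is positive at every point. -/
theorem integral_upperAverage_le (hT : MeasurePreserving T μ μ) {f : X → ℝ} {C : ℝ}
    (hf : Measurable f) (hC : ∀ x, |f x| ≤ C) :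
    ∫ x, upperAverage T f x ∂μ ≤ ∫ x, f x ∂μ := by
  refine le_of_forall_pos_le_add fun ε hε => ?_
  have hi1 := integrable_of_abs_le (μ := μ) hf hC
  have hi2 := integrable_of_abs_le (μ := μ) (measurable_upperAverage hT.measurable hf)
    (abs_upperAverage_le (T := T) hC)
  have hg := integral_nonneg_of_exists_birkhoffSum_pos (μ := μ) (T := T) hT
    (f := fun x => f x - upperAverage T f x + ε) (C := C + C + ε)
    ((hf.sub (measurable_upperAverage hT.measurable hf)).add_const ε) (fun x => by
      have h1 := abs_le.1 (hC x)
      have h2 := abs_le.1 (abs_upperAverage_le (T := T) hC x)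
      exact abs_le.2 ⟨by linarith, by linarith⟩) (fun x => by
      have h1 := frequently_lt_of_lt_limsup (b := upperAverage T f x - ε)
        (isBoundedUnder_ge_of_abs_le
          (fun n => abs_birkhoffAverage_le (T := T) hC n x)).isCoboundedUnder_le
        (show upperAverage T f x - ε < upperAverage T f x by linarith)
      obtain ⟨n, hn, hn1⟩ := (h1.and_eventually (eventually_ge_atTop 1)).exists
      refine ⟨n, ?_⟩
      have hn0 : (0 : ℝ) < n := by exact_mod_cast hn1
      rw [birkhoffAverage, smul_eq_mul, lt_inv_mul_iff₀ hn0] at hn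
      have h3 : birkhoffSum T (fun x => f x - upperAverage T f x + ε) n x =
          birkhoffSum T f n x - n * (upperAverage T f x - ε) := by
        simp only [birkhoffSum, iterate_upperAverage hC]
        rw [Finset.sum_add_distrib, Finset.sum_sub_distrib]
        simp
        ring
      rw [h3]
      linarith)
  have h1 : ∫ x, (f x - upperAverage T f x + ε) ∂μ =
      (∫ x, f x ∂μ - ∫ x, upperAverage T f x ∂μ) + ε := by
    rw [← integral_sub hi1 hi2, integral_add (f := fun x => f x - upperAverage T f x)
      (hi1.sub hi2) (integrable_const ε)]
    simp
  rw [h1] at hg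
  linarith

/-- Birkhoff's pointwise ergodic theorem, for bounded functions. -/
theorem ae_tendsto_birkhoffAverage (hT : MeasurePreserving T μ μ) {f : X → ℝ} {C : ℝ}
    (hf : Measurable f) (hC : ∀ x, |f x| ≤ C) :
    (∀ᵐ x ∂μ, Tendsto (fun n => birkhoffAverage ℝ T f n x) atTop (𝓝 (upperAverage T f x))) ∧
      ∫ x, upperAverage T f x ∂μ = ∫ x, f x ∂μ := by
  have hC' : ∀ x, |(-f) x| ≤ C := fun x => by simpa using hC x
  have hm1 := measurable_upperAverage hT.measurable hf
  have hm2 := measurable_upperAverage hT.measurable hf.neg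
  have hi1 := integrable_of_abs_le (μ := μ) hm1 (abs_upperAverage_le (T := T) hC)
  have hi2 := integrable_of_abs_le (μ := μ) hm2 (abs_upperAverage_le (T := T) hC')
  have h1 := integral_upperAverage_le hT hf hC
  have h2 := integral_upperAverage_le hT hf.neg hC'
  have hneg : ∀ n x, birkhoffAverage ℝ T (-f) n x = -birkhoffAverage ℝ T f n x := by
    intro n x
    simp [birkhoffAverage, birkhoffSum]
  have hpt : ∀ x, 0 ≤ upperAverage T f x + upperAverage T (-f) x := by
    intro x
    have hb := fun n => abs_birkhoffAverage_le (T := T) hC n x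
    have hb' := fun n => abs_birkhoffAverage_le (T := T) hC' n x
    by_contra hlt
    push Not at hlt
    obtain ⟨c, hc1, hc2⟩ := exists_between (show upperAverage T f x < -upperAverage T (-f) x by
      linarith)
    have e1 := eventually_lt_of_limsup_lt hc1 (isBoundedUnder_le_of_abs_le hb)
    have e2 := eventually_lt_of_limsup_lt (show upperAverage T (-f) x < -c by linarith)
      (isBoundedUnder_le_of_abs_le hb')
    obtain ⟨n, hn1, hn2⟩ := (e1.and e2).exists
    rw [hneg] at hn2
    linarith
  simp only [Pi.neg_apply, integral_neg] at h2
  -- The inequality for `f` and for `-f` bounds the integral of a nonnegative function by zero, so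
  -- upper and lower limits agree almost everywhere.
  have h3 : ∫ x, (upperAverage T f x + upperAverage T (-f) x) ∂μ = 0 := by
    refine le_antisymm ?_ (integral_nonneg hpt)
    rw [integral_add hi1 hi2]
    linarith
  have h4 := (integral_eq_zero_iff_of_nonneg hpt (hi1.add hi2)).1 h3
  have h5 : ∫ x, upperAverage T f x ∂μ = ∫ x, f x ∂μ := by
    rw [integral_add hi1 hi2] at h3
    linarith
  refine ⟨?_, h5⟩
  filter_upwards [h4] with x hx
  have hx' : upperAverage T f x + upperAverage T (-f) x = 0 := hx
  have hb := fun n => abs_birkhoffAverage_le (T := T) hC n x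
  have hb' := fun n => abs_birkhoffAverage_le (T := T) hC' n x
  refine tendsto_order.2 ⟨fun c hc => ?_, fun c hc => ?_⟩
  · filter_upwards [eventually_lt_of_limsup_lt (show upperAverage T (-f) x < -c by linarith)
      (isBoundedUnder_le_of_abs_le hb')] with n hn
    rw [hneg] at hn
    linarith
  · exact eventually_lt_of_limsup_lt hc (isBoundedUnder_le_of_abs_le hb)

end Birkhoff

end DiffusedSphere
end

noncomputable section

namespace DiffusedSphere

/-! ### Random compositions as a skew product over the Bernoulli shift -/

section Skew

variable {Γ : Type*} [MeasurableSpace Γ] {ν : Measure Γ} [IsProbabilityMeasure ν]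

/-- The law of an independent sequence. -/
abbrev seqLaw (ν : Measure Γ) : Measure (ℕ → Γ) := Measure.infinitePi fun _ : ℕ => ν

/-- Prepend an entry to a sequence. -/
def seqCons (p : Γ × (ℕ → Γ)) : ℕ → Γ
  | 0 => p.1
  | n + 1 => p.2 n

/-- Drop the first entry of a sequence. -/
def seqTail (w : ℕ → Γ) : ℕ → Γ := fun n => w (n + 1)

theorem measurable_seqCons : Measurable (seqCons (Γ := Γ)) := by
  refine measurable_pi_lambda _ fun n => ?_
  cases n with
  | zero => exact measurable_fst
  | succ n => exact (measurable_pi_apply n).comp measurable_snd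

theorem measurable_seqTail : Measurable (seqTail (Γ := Γ)) :=
  measurable_pi_lambda _ fun n => measurable_pi_apply (n + 1)

/-- Padding missing coordinates with the whole space reduces arbitrary finite boxes to boxes on
initial segments, which suit induction by prepending an entry. -/
theorem eq_seqLaw {P : Measure (ℕ → Γ)}
    (h : ∀ (n : ℕ) (t : ℕ → Set Γ), (∀ i, MeasurableSet (t i)) →
      P (Set.pi (Finset.range n) t) = ∏ i ∈ Finset.range n, ν (t i)) : P = seqLaw ν := by
  classical
  refine Measure.eq_infinitePi _ fun s t ht => ?_
  let t' : ℕ → Set Γ := fun i => if i ∈ s then t i else Set.univ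
  have ht' : ∀ i, MeasurableSet (t' i) := fun i => by
    by_cases hi : i ∈ s
    · simpa [t', hi] using ht i
    · simp [t', hi]
  obtain ⟨n, hn⟩ := s.exists_nat_subset_range
  have h1 : Set.pi (s : Set ℕ) t = Set.pi (Finset.range n) t' := by
    ext w
    simp only [Set.mem_pi, Finset.mem_coe]
    constructor
    · intro hw i _
      by_cases hi : i ∈ s
      · simpa [t', hi] using hw i hi
      · simp [t', hi]
    · intro hw i hi
      simpa [t', hi] using hw i (hn hi)
  rw [h1, h n t' ht', ← Finset.prod_subset hn (f := fun i => ν (t' i))]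
  · refine Finset.prod_congr rfl fun i hi => ?_
    simp [t', hi]
  · intro i _ hi
    simp [t', hi]

theorem seqCons_preimage_pi (n : ℕ) (t : ℕ → Set Γ) :
    seqCons ⁻¹' Set.pi (Finset.range (n + 1)) t =
      t 0 ×ˢ Set.pi (Finset.range n) (fun i => t (i + 1)) := by
  ext ⟨g, w⟩
  simp only [Set.mem_preimage, Set.mem_pi, Finset.coe_range, Set.mem_Iio, Set.mem_prod]
  constructor
  · exact fun h => ⟨h 0 (Nat.succ_pos n), fun i hi => h (i + 1) (by omega)⟩
  · rintro ⟨h1, h2⟩ i hi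
    cases i with
    | zero => exact h1
    | succ i => exact h2 i (by omega)

theorem measurableSet_pi_range (n : ℕ) {t : ℕ → Set Γ} (ht : ∀ i, MeasurableSet (t i)) :
    MeasurableSet (Set.pi (Finset.range n : Set ℕ) t) :=
  MeasurableSet.pi (Finset.countable_toSet _) fun i _ => ht i

theorem seqLaw_pi (n : ℕ) {t : ℕ → Set Γ} (ht : ∀ i, MeasurableSet (t i)) :
    seqLaw ν (Set.pi (Finset.range n) t) = ∏ i ∈ Finset.range n, ν (t i) :=
  Measure.infinitePi_pi _ fun i _ => ht i

theorem measurePreserving_seqCons :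
    MeasurePreserving (seqCons (Γ := Γ)) (ν.prod (seqLaw ν)) (seqLaw ν) := by
  refine ⟨measurable_seqCons, eq_seqLaw fun n t ht => ?_⟩
  rw [Measure.map_apply measurable_seqCons (measurableSet_pi_range n ht)]
  cases n with
  | zero => simp
  | succ n =>
    rw [seqCons_preimage_pi, Measure.prod_prod, seqLaw_pi n fun i => ht (i + 1),
      Finset.prod_range_succ', mul_comm]

theorem lintegral_seqLaw {F : (ℕ → Γ) → ENNReal} (hF : Measurable F) :
    ∫⁻ w, F w ∂seqLaw ν = ∫⁻ g, ∫⁻ w, F (seqCons (g, w)) ∂seqLaw ν ∂ν := by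
  rw [← measurePreserving_seqCons.lintegral_comp hF,
    lintegral_prod (fun p => F (seqCons p)) (hF.comp measurable_seqCons).aemeasurable]

variable {X : Type*} [MeasurableSpace X] {act : Γ → X → X}

/-- The skew product `(x, w) ↦ (w₀ x, σ w)`. -/
def skew (act : Γ → X → X) (p : X × (ℕ → Γ)) : X × (ℕ → Γ) := (act (p.2 0) p.1, seqTail p.2)

theorem measurable_skew (ha : Measurable (Function.uncurry act)) : Measurable (skew act) := by
  refine Measurable.prodMk ?_ (measurable_seqTail.comp measurable_snd)
  have h1 : Measurable fun p : X × (ℕ → Γ) => (p.2 0, p.1) :=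
    ((measurable_pi_apply 0).comp measurable_snd).prodMk measurable_fst
  exact ha.comp h1

/-- Stationarity says that the action carries `ν.prod m` to `m`; this is the form that passes from
sets to functions. -/
theorem IsStationary.lintegral_eq (ha : Measurable (Function.uncurry act)) {m : Measure X}
    [SFinite m] (hm : IsStationary ν act m) {f : X → ENNReal} (hf : Measurable f) :
    ∫⁻ x, ∫⁻ g, f (act g x) ∂ν ∂m = ∫⁻ x, f x ∂m := by
  have h1 : (ν.prod m).map (Function.uncurry act) = m := by
    ext A hA
    rw [Measure.map_apply ha hA, Measure.prod_apply (ha hA), hm A hA]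
    rfl
  conv_rhs => rw [← h1]
  rw [lintegral_map hf ha, lintegral_prod_symm (fun p => f (Function.uncurry act p))
    (hf.comp ha).aemeasurable]
  rfl

/-- The shift releases the first entry, which is independent of the rest and has law `ν`.
Integrating it out is one step of the process, which stationarity absorbs. -/
theorem measurePreserving_skew (ha : Measurable (Function.uncurry act)) {m : Measure X}
    [SFinite m] (hm : IsStationary ν act m) :
    MeasurePreserving (skew act) (m.prod (seqLaw ν)) (m.prod (seqLaw ν)) := by
  refine ⟨measurable_skew ha, ?_⟩
  refine Measure.ext_of_lintegral _ fun F hF => ?_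
  have hs := measurable_skew ha
  rw [lintegral_map hF hs, lintegral_prod (fun p => F (skew act p)) (hF.comp hs).aemeasurable]
  have h1 : ∀ x, ∫⁻ w, F (skew act (x, w)) ∂seqLaw ν =
      ∫⁻ g, ∫⁻ w, F (act g x, w) ∂seqLaw ν ∂ν := fun x => by
    rw [lintegral_seqLaw (F := fun w => F (skew act (x, w)))
      (hF.comp (hs.comp measurable_prodMk_left))]
    rfl
  simp only [h1]
  rw [hm.lintegral_eq ha (f := fun y => ∫⁻ w, F (y, w) ∂seqLaw ν) hF.lintegral_prod_right',
    lintegral_prod _ hF.aemeasurable]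

/-- By invariance, fixing the first entry `g` turns the section at `x` into the section at `act g
x`, which again has measure `c`. Inductively the section is independent of every cylinder. -/
theorem measure_section_inter_pi {B : Set (X × (ℕ → Γ))}
    (hB : MeasurableSet B) (hinv : skew act ⁻¹' B = B) {c : ENNReal}
    (hc : ∀ x, seqLaw ν (Prod.mk x ⁻¹' B) = c) (n : ℕ) :
    ∀ (x : X) (t : ℕ → Set Γ), (∀ i, MeasurableSet (t i)) →
      seqLaw ν (Prod.mk x ⁻¹' B ∩ Set.pi (Finset.range n) t) =
        c * ∏ i ∈ Finset.range n, ν (t i) := by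
  induction n with
  | zero => intro x t _; simp [hc x]
  | succ n ih =>
    intro x t ht
    have hm1 : ∀ x, MeasurableSet (Prod.mk x ⁻¹' B) := fun x => measurable_prodMk_left hB
    have hm2 := (hm1 x).inter (measurableSet_pi_range (n + 1) ht)
    rw [← measurePreserving_seqCons.measure_preimage hm2.nullMeasurableSet,
      Measure.prod_apply (measurable_seqCons hm2)]
    have h1 : ∀ g, seqLaw ν (Prod.mk g ⁻¹' (seqCons ⁻¹' (Prod.mk x ⁻¹' B ∩
        Set.pi (Finset.range (n + 1)) t))) =
        (t 0).indicator (fun _ => c * ∏ i ∈ Finset.range n, ν (t (i + 1))) g := by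
      intro g
      rw [Set.preimage_inter, seqCons_preimage_pi]
      by_cases hg : g ∈ t 0
      · rw [Set.indicator_of_mem hg, ← ih (act g x) (fun i => t (i + 1)) fun i => ht (i + 1)]
        congr 1
        ext w
        have h2 : (x, seqCons (g, w)) ∈ B ↔ (act g x, w) ∈ B := by
          conv_lhs => rw [← hinv]
          rfl
        simp only [Set.mem_preimage, Set.mem_inter_iff, Set.mem_prod, hg, true_and, h2]
      · rw [Set.indicator_of_notMem hg]
        convert measure_empty (μ := seqLaw ν)
        ext w
        simp [hg]
    simp only [h1]
    rw [lintegral_indicator_const (ht 0), Finset.prod_range_succ']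
    ring

/-- If bounded harmonic functions are constant, then the skew product is ergodic. -/
theorem ergodic_skew (ha : Measurable (Function.uncurry act)) {m : Measure X}
    [IsProbabilityMeasure m] [Nonempty X] (hm : IsStationary ν act m)
    (hconst : ∀ f : X → ENNReal, Measurable f → (∀ x, f x ≤ 1) →
      (∀ x, f x = ∫⁻ g, f (act g x) ∂ν) → ∀ x y, f x = f y) :
    Ergodic (skew act) (m.prod (seqLaw ν)) := by
  refine ⟨measurePreserving_skew ha hm, ⟨fun B hB hinv => ?_⟩⟩
  have hm1 : ∀ x, MeasurableSet (Prod.mk x ⁻¹' B) := fun x => measurable_prodMk_left hB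
  obtain ⟨x₀⟩ := ‹Nonempty X›
  -- The measures of the sections form a bounded harmonic function, to which `hconst` applies.
  let f : X → ENNReal := fun x => seqLaw ν (Prod.mk x ⁻¹' B)
  have hf : ∀ x, f x = f x₀ := fun x => by
    refine hconst f (measurable_measure_prodMk_left hB) (fun x => prob_le_one) (fun x => ?_) x x₀
    simp only [f]
    rw [← measurePreserving_seqCons.measure_preimage (hm1 x).nullMeasurableSet,
      Measure.prod_apply (measurable_seqCons (hm1 x))]
    refine lintegral_congr fun g => ?_
    congr 1
    ext w
    conv_lhs => rw [← hinv]
    rfl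
  set c := f x₀ with hc
  have hc1 : c ≤ 1 := prob_le_one
  have hctop : c ≠ ⊤ := (hc1.trans_lt ENNReal.one_lt_top).ne
  have hcc : c = 0 ∨ c = 1 := by
    by_cases h0 : c = 0
    · exact Or.inl h0
    right
    -- A zero-one law: the law conditioned on a section agrees with the unconditioned law on
    -- cylinders, hence everywhere, and evaluating it on the section itself gives `c = 1`.
    have h1 : c⁻¹ • (seqLaw ν).restrict (Prod.mk x₀ ⁻¹' B) = seqLaw ν := by
      refine eq_seqLaw fun n t ht => ?_
      rw [Measure.smul_apply, Measure.restrict_apply (measurableSet_pi_range n ht), Set.inter_comm,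
        measure_section_inter_pi hB hinv hf n x₀ t ht, smul_eq_mul, ← mul_assoc,
        ENNReal.inv_mul_cancel h0 hctop, one_mul]
    have h2 : (c⁻¹ • (seqLaw ν).restrict (Prod.mk x₀ ⁻¹' B)) (Prod.mk x₀ ⁻¹' B) = c := by
      rw [h1]
    rw [Measure.smul_apply, Measure.restrict_apply (hm1 x₀), Set.inter_self, smul_eq_mul] at h2
    rw [← h2]
    exact ENNReal.inv_mul_cancel h0 hctop
  have hmB : (m.prod (seqLaw ν)) B = c := by
    rw [Measure.prod_apply hB]
    change ∫⁻ x, f x ∂m = c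
    simp [hf]
  rw [eventuallyConst_set]
  rcases hcc with h | h
  · right
    rw [h] at hmB
    exact measure_eq_zero_iff_ae_notMem.1 hmB
  · left
    rw [h] at hmB
    exact (mem_ae_iff_prob_eq_one hB).2 hmB

theorem ae_eq_const_of_skew_invariant {μ : Measure (X × (ℕ → Γ))} [IsProbabilityMeasure μ]
    (hT : Ergodic (skew act) μ) {F : X × (ℕ → Γ) → ℝ} (hF : Measurable F)
    (hinv : ∀ᵐ p ∂μ, F (skew act p) = F p) : ∃ c, ∀ᵐ p ∂μ, F p = c :=
  hT.ae_eq_const_of_ae_eq_comp_ae hF.aestronglyMeasurable hinv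

end Skew

end DiffusedSphere
end

noncomputable section

namespace DiffusedSphere

/-! ### The rotation action on the sphere and on the unit tangent bundle -/

theorem rotVec_mul (g k : SO3) (x : E3) :
    rotVec ((g * k : SO3) : Matrix (Fin 3) (Fin 3) ℝ) x = rotVec g (rotVec k x) := by
  simp [rotVec, Matrix.mulVec_mulVec]

@[simp] theorem rotVec_one (x : E3) : rotVec ((1 : SO3) : Matrix (Fin 3) (Fin 3) ℝ) x = x := by
  simp [rotVec]

/-- A rotation as a linear isometry. -/
def rotLin (g : SO3) : E3 ≃ₗᵢ[ℝ] E3 where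
  toFun := rotVec g
  invFun := rotVec (g⁻¹ : SO3)
  left_inv := rotVec_inv_rotVec g
  right_inv x := by simpa using rotVec_inv_rotVec g⁻¹ x
  map_add' x y := by ext i; simp [rotVec, Matrix.mulVec_add]
  map_smul' c x := by ext i; simp [rotVec, Matrix.mulVec_smul]
  norm_map' := norm_rotVec g

@[simp] theorem rotLin_apply (g : SO3) (x : E3) : rotLin g x = rotVec g x := rfl

theorem inner_rotVec (g : SO3) (x y : E3) : inner ℝ (rotVec g x) (rotVec g y) = inner ℝ x y :=
  (rotLin g).inner_map_map x y

theorem continuous_rotVec : Continuous fun p : SO3 × E3 => rotVec p.1 p.2 := by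
  unfold rotVec
  refine (PiLp.continuous_toLp 2 _).comp ?_
  refine Continuous.matrix_mulVec (continuous_subtype_val.comp continuous_fst) ?_
  exact (PiLp.continuous_ofLp 2 _).comp continuous_snd

theorem mem_tangentPlane_iff {x : S2} {v : E3} :
    v ∈ tangentPlane x ↔ inner ℝ (x : E3) v = 0 :=
  Submodule.mem_orthogonal_singleton_iff_inner_right

instance : MulAction SO3 S2 where
  smul g x := ⟨rotVec g x, by simp [norm_rotVec]⟩
  one_smul x := Subtype.ext (rotVec_one _)
  mul_smul g k x := Subtype.ext (rotVec_mul g k _)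

@[simp] theorem S2.coe_smul (g : SO3) (x : S2) : ((g • x : S2) : E3) = rotVec g x := rfl

instance : ContinuousSMul SO3 S2 where
  continuous_smul := by
    refine Continuous.subtype_mk ?_ _
    exact continuous_rotVec.comp (continuous_fst.prodMk (continuous_subtype_val.comp continuous_snd))

instance : MulAction SO3 T1S2 where
  smul g u := ⟨(g • u.1.1, rotVec g u.1.2), by
    have h := mem_tangentPlane_iff.1 u.2.1
    refine ⟨mem_tangentPlane_iff.2 ?_, (norm_rotVec g _).trans u.2.2⟩
    rw [S2.coe_smul, inner_rotVec, h]⟩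
  one_smul u := Subtype.ext (Prod.ext (one_smul _ _) (rotVec_one _))
  mul_smul g k u := Subtype.ext (Prod.ext (mul_smul g k _) (rotVec_mul g k _))

@[simp] theorem T1S2.smul_fst (g : SO3) (u : T1S2) : (g • u).1.1 = g • u.1.1 := rfl

@[simp] theorem T1S2.smul_snd (g : SO3) (u : T1S2) : (g • u).1.2 = rotVec g u.1.2 := rfl

instance : ContinuousSMul SO3 T1S2 where
  continuous_smul := by
    refine Continuous.subtype_mk (Continuous.prodMk ?_ ?_) _
    · exact continuous_smul.comp (continuous_fst.prodMk
        (continuous_fst.comp (continuous_subtype_val.comp continuous_snd)))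
    · exact continuous_rotVec.comp (continuous_fst.prodMk
        (continuous_snd.comp (continuous_subtype_val.comp continuous_snd)))

theorem T1S2.inner_eq_zero (u : T1S2) : inner ℝ (u.1.1 : E3) u.1.2 = 0 :=
  mem_tangentPlane_iff.1 u.2.1

theorem T1S2.norm_snd (u : T1S2) : ‖u.1.2‖ = 1 := u.2.2

theorem continuous_base : Continuous T1S2.base := continuous_fst.comp continuous_subtype_val

theorem E3.norm_sq (x : E3) : ‖x‖ ^ 2 = x 0 ^ 2 + x 1 ^ 2 + x 2 ^ 2 := by
  simp [EuclideanSpace.norm_sq_eq, Fin.sum_univ_three]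

theorem E3.inner_eq (x y : E3) : inner ℝ x y = x 0 * y 0 + x 1 * y 1 + x 2 * y 2 := by
  simp [PiLp.inner_apply, Fin.sum_univ_three]
  ring

theorem E3.rotVec_apply (A : Matrix (Fin 3) (Fin 3) ℝ) (x : E3) (i : Fin 3) :
    rotVec A x i = A i 0 * x 0 + A i 1 * x 1 + A i 2 * x 2 := by
  simp [rotVec, Matrix.mulVec, dotProduct, Fin.sum_univ_three]

theorem isClosed_T1S2 : IsClosed {p : S2 × E3 | p.2 ∈ tangentPlane p.1 ∧ ‖p.2‖ = 1} := by
  simp only [mem_tangentPlane_iff]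
  refine IsClosed.inter (isClosed_eq ?_ continuous_const) (isClosed_eq ?_ continuous_const)
  · exact (continuous_subtype_val.comp continuous_fst).inner continuous_snd
  · exact continuous_snd.norm

instance : CompactSpace T1S2 := by
  refine isCompact_iff_compactSpace.1 ?_
  refine (isCompact_univ.prod (isCompact_sphere (0 : E3) 1)).of_isClosed_subset isClosed_T1S2 ?_
  rintro p ⟨_, hp⟩
  exact ⟨Set.mem_univ _, mem_sphere_zero_iff_norm.2 hp⟩

/-- The rotation with columns `x`, `v`, `x × v`. -/
def frameMat (x v : E3) : Matrix (Fin 3) (Fin 3) ℝ :=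
  !![x 0, v 0, x 1 * v 2 - x 2 * v 1;
     x 1, v 1, x 2 * v 0 - x 0 * v 2;
     x 2, v 2, x 0 * v 1 - x 1 * v 0]

theorem frameMat_mem (u : T1S2) :
    frameMat u.1.1 u.1.2 ∈ Matrix.specialOrthogonalGroup (Fin 3) ℝ := by
  have h1 : (u.1.1 : E3) 0 ^ 2 + (u.1.1 : E3) 1 ^ 2 + (u.1.1 : E3) 2 ^ 2 = 1 := by
    rw [← E3.norm_sq, S2.norm_coe, one_pow]
  have h2 : u.1.2 0 ^ 2 + u.1.2 1 ^ 2 + u.1.2 2 ^ 2 = 1 := by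
    rw [← E3.norm_sq, u.norm_snd, one_pow]
  have h3 := u.inner_eq_zero
  rw [E3.inner_eq] at h3
  generalize ((u.1.1 : E3)) = x at *
  generalize u.1.2 = v at *
  have h4 : (x 1 * v 2 - x 2 * v 1) ^ 2 + (x 2 * v 0 - x 0 * v 2) ^ 2
      + (x 0 * v 1 - x 1 * v 0) ^ 2 = 1 := by
    linear_combination (v 0 ^ 2 + v 1 ^ 2 + v 2 ^ 2) * h1 + h2
      - (x 0 * v 0 + x 1 * v 1 + x 2 * v 2) * h3
  rw [Matrix.mem_specialOrthogonalGroup_iff, Matrix.mem_orthogonalGroup_iff']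
  constructor
  · ext i j
    fin_cases i <;> fin_cases j <;>
      simp [frameMat, Matrix.mul_apply, Fin.sum_univ_three]
    · linear_combination h1
    · linear_combination h3
    · ring
    · linear_combination h3
    · linear_combination h2
    · ring
    · ring
    · ring
    · linear_combination h4
  · rw [Matrix.det_fin_three]
    simp [frameMat]
    linear_combination h4

/-- The rotation that carries the standard frame to the frame defined by a unit tangent vector. -/
def frame (u : T1S2) : SO3 := ⟨frameMat u.1.1 u.1.2, frameMat_mem u⟩

/-- The standard point of the sphere. -/
def e0 : S2 := ⟨EuclideanSpace.single 0 1, by simp⟩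

/-- The standard unit tangent vector. -/
def u0 : T1S2 := ⟨(e0, EuclideanSpace.single 1 1), by
  simp [mem_tangentPlane_iff, e0, E3.inner_eq]⟩

theorem frame_smul_u0 (u : T1S2) : frame u • u0 = u := by
  refine Subtype.ext (Prod.ext (Subtype.ext ?_) ?_)
  · ext i
    simp only [T1S2.smul_fst, S2.coe_smul, E3.rotVec_apply]
    fin_cases i <;> simp [u0, e0, frame, frameMat]
  · ext i
    simp only [T1S2.smul_snd, E3.rotVec_apply]
    fin_cases i <;> simp [u0, frame, frameMat]

/-- A rotation fixing two orthonormal vectors can act on the third axis only by a sign, and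
determinant one excludes the reflection. With `frame_smul_u0` the action on unit tangent vectors is
simply transitive. -/
theorem smul_u0_injective : Function.Injective fun g : SO3 => g • u0 := by
  have key : ∀ g : SO3, g • u0 = u0 → g = 1 := by
    intro g hg
    have h1 := fun i => congrArg (fun u : T1S2 => (u.1.1 : E3) i) hg
    have h2 := fun i => congrArg (fun u : T1S2 => u.1.2 i) hg
    simp only [T1S2.smul_fst, S2.coe_smul, T1S2.smul_snd, E3.rotVec_apply] at h1 h2
    simp [u0, e0] at h1 h2
    have a0 := h1 0
    have a1 := h1 1
    have a2 := h1 2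
    have b0 := h2 0
    have b1 := h2 1
    have b2 := h2 2
    simp at a0 a1 a2 b0 b1 b2
    have hg0 := congrFun (congrFun (SO3.mul_transpose g) 0) 0
    have hg1 := congrFun (congrFun (SO3.mul_transpose g) 1) 1
    have hd : (g : Matrix (Fin 3) (Fin 3) ℝ).det = 1 := g.2.2
    simp [Matrix.mul_apply, Fin.sum_univ_three, a0, b0, a1, b1] at hg0 hg1
    rw [Matrix.det_fin_three] at hd
    simp [a0, a1, a2, b0, b1, b2] at hd
    apply Subtype.ext
    ext i j
    fin_cases i <;> fin_cases j <;> simp [a0, a1, a2, b0, b1, b2, hg0, hg1, hd]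
  intro g k h
  have h' : g • u0 = k • u0 := h
  have h1 : (k⁻¹ * g) • u0 = u0 := by rw [mul_smul, h', inv_smul_smul]
  have h2 := key _ h1
  rwa [inv_mul_eq_one, eq_comm] at h2

theorem frame_smul (g : SO3) (u : T1S2) : frame (g • u) = g * frame u := by
  apply smul_u0_injective
  simp only [frame_smul_u0, mul_smul]

theorem continuous_frame : Continuous frame := by
  refine Continuous.subtype_mk ?_ _
  refine continuous_matrix fun i j => ?_
  have h1 : ∀ i, Continuous fun u : T1S2 => (u.1.1 : E3) i := fun i => by fun_prop
  have h2 : ∀ i, Continuous fun u : T1S2 => u.1.2 i := fun i => by fun_prop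
  fin_cases i <;> fin_cases j <;> simp [frameMat] <;> fun_prop

/-! ### A measurable trivialization of the unit tangent bundle. -/

/-- A vector orthogonal to a given unit vector. -/
def perpVec (x : S2) : E3 :=
  if (x : E3) 0 ^ 2 ≤ 1 / 2 then !₂[0, -(x : E3) 2, (x : E3) 1] else !₂[(x : E3) 2, 0, -(x : E3) 0]

theorem inner_perpVec (x : S2) : inner ℝ (x : E3) (perpVec x) = 0 := by
  unfold perpVec
  split_ifs <;> simp [E3.inner_eq] <;> ring

/-- The cutoff `1 / 2` decides which pair of coordinates is safe: below it the last two cannot both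
vanish, above it the first does not vanish. -/
theorem perpVec_ne_zero (x : S2) : perpVec x ≠ 0 := by
  have h1 : (x : E3) 0 ^ 2 + (x : E3) 1 ^ 2 + (x : E3) 2 ^ 2 = 1 := by
    rw [← E3.norm_sq, S2.norm_coe, one_pow]
  intro h
  have h2 := E3.norm_sq (perpVec x)
  rw [h, norm_zero] at h2
  have e0 : perpVec x 0 = 0 := by rw [h]; rfl
  have e1 : perpVec x 1 = 0 := by rw [h]; rfl
  have e2 : perpVec x 2 = 0 := by rw [h]; rfl
  unfold perpVec at e0 e1 e2
  split_ifs at e0 e1 e2 with hc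
  · simp at e1 e2
    rw [e1, e2] at h1
    linarith
  · simp at e0 e2
    rw [e2] at hc
    norm_num at hc

/-- A nowhere vanishing tangent field on the sphere cannot be continuous. Measurability suffices, as
the trivialization is only used for integration along fibres. -/
theorem measurable_perpVec : Measurable perpVec := by
  have h1 : ∀ i, Continuous fun x : S2 => (x : E3) i := fun i => by fun_prop
  refine Measurable.ite ?_ ?_ ?_
  · exact measurableSet_le ((h1 0).pow 2).measurable measurable_const
  · refine Continuous.measurable ?_
    refine (PiLp.continuous_toLp 2 _).comp (continuous_pi fun i => ?_)
    fin_cases i <;> simp <;> fun_prop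
  · refine Continuous.measurable ?_
    refine (PiLp.continuous_toLp 2 _).comp (continuous_pi fun i => ?_)
    fin_cases i <;> simp <;> fun_prop

/-- A measurable unit tangent vector field. -/
def unitField (x : S2) : T1S2 :=
  ⟨(x, ‖perpVec x‖⁻¹ • perpVec x), by
    rw [mem_tangentPlane_iff, inner_smul_right, inner_perpVec, mul_zero], by
    rw [norm_smul, norm_inv, norm_norm, inv_mul_cancel₀ (norm_ne_zero_iff.2 (perpVec_ne_zero x))]⟩

theorem measurable_unitField : Measurable unitField := by
  refine Measurable.subtype_mk (measurable_id.prodMk ?_)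
  exact measurable_perpVec.norm.inv.smul measurable_perpVec

theorem frame_smul_e0 (u : T1S2) : frame u • e0 = u.1.1 := by
  conv_rhs => rw [← frame_smul_u0 u]
  rfl

theorem exists_smul_e0 (x : S2) : ∃ g : SO3, g • e0 = x :=
  ⟨frame (unitField x), frame_smul_e0 _⟩

/-- The Euclidean plane. -/
abbrev E2 := EuclideanSpace ℝ (Fin 2)

/-- The unit circle. -/
abbrev S1 := Metric.sphere (0 : E2) 1

theorem E2.norm_sq (x : E2) : ‖x‖ ^ 2 = x 0 ^ 2 + x 1 ^ 2 := by
  simp [EuclideanSpace.norm_sq_eq]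

/-- The isometric parametrization of the plane orthogonal to the standard point. -/
def planeVec (c : E2) : E3 := !₂[0, c 0, c 1]

theorem norm_planeVec (c : E2) : ‖planeVec c‖ = ‖c‖ := by
  rw [← sq_eq_sq₀ (norm_nonneg _) (norm_nonneg _), E3.norm_sq, E2.norm_sq]
  simp [planeVec]

theorem continuous_planeVec : Continuous planeVec := by
  refine (PiLp.continuous_toLp 2 _).comp (continuous_pi fun i => ?_)
  fin_cases i <;> simp <;> fun_prop

/-- The unit tangent circle at the standard point. -/
def circ (c : S1) : T1S2 := ⟨(e0, planeVec c), by
  simp [mem_tangentPlane_iff, e0, E3.inner_eq, planeVec], by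
  rw [norm_planeVec]; exact mem_sphere_zero_iff_norm.1 c.2⟩

theorem continuous_circ : Continuous circ :=
  Continuous.subtype_mk (continuous_const.prodMk
    (continuous_planeVec.comp continuous_subtype_val)) _

/-- A measurable trivialization of the unit tangent bundle. -/
def triv (p : S2 × S1) : T1S2 := frame (unitField p.1) • circ p.2

@[simp] theorem triv_fst (p : S2 × S1) : (triv p).1.1 = p.1 := by
  simp only [triv, T1S2.smul_fst]
  exact frame_smul_e0 _

@[simp] theorem triv_base (p : S2 × S1) : (triv p).base = p.1 := triv_fst p

theorem measurable_triv : Measurable triv := by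
  have h1 : Measurable fun p : S2 × S1 => (frame (unitField p.1), circ p.2) :=
    ((continuous_frame.measurable.comp measurable_unitField).comp measurable_fst).prodMk
      (continuous_circ.measurable.comp measurable_snd)
  exact (continuous_smul (M := SO3) (X := T1S2)).measurable.comp h1

end DiffusedSphere
end

open scoped Manifold ContDiff Pointwise

noncomputable section

namespace DiffusedSphere

/-! ### Liouville measure on the unit tangent bundle -/

section UniformSphere

variable {E F : Type*} [NormedAddCommGroup E] [InnerProductSpace ℝ E]
    [FiniteDimensional ℝ E] [MeasurableSpace E] [BorelSpace E]
    [NormedAddCommGroup F] [InnerProductSpace ℝ F]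
    [FiniteDimensional ℝ F] [MeasurableSpace F] [BorelSpace F]

theorem isProbabilityMeasure_uniformSphere [Nontrivial E] :
    IsProbabilityMeasure (uniformSphere E) := by
  constructor
  rw [uniformSphere, Measure.smul_apply, smul_eq_mul]
  refine ENNReal.inv_mul_cancel ?_ (measure_ne_top _ _)
  rw [Ne, Measure.measure_univ_eq_zero]
  exact Measure.toSphere_ne_zero _

/-- The map between unit spheres induced by a linear isometry. -/
def sphereMap (e : E →ₗᵢ[ℝ] F) (w : Metric.sphere (0 : E) 1) : Metric.sphere (0 : F) 1 :=
  ⟨e w, by rw [mem_sphere_zero_iff_norm, e.norm_map]; exact mem_sphere_zero_iff_norm.1 w.2⟩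

theorem continuous_sphereMap (e : E →ₗᵢ[ℝ] F) : Continuous (sphereMap e) :=
  Continuous.subtype_mk (e.continuous.comp continuous_subtype_val) _

/-- The measure of a set on the sphere is, up to the dimension, the volume of the cone over it; a
linear isometry takes cones to cones and preserves volume. -/
theorem map_toSphere (e : E ≃ₗᵢ[ℝ] F) :
    ((volume : Measure E).toSphere).map (sphereMap e.toLinearIsometry) =
      (volume : Measure F).toSphere := by
  ext s hs
  rw [Measure.map_apply (continuous_sphereMap _).measurable hs, Measure.toSphere_apply' _ hs,
    Measure.toSphere_apply' _ ((continuous_sphereMap _).measurable hs),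
    e.toLinearEquiv.finrank_eq]
  congr 1
  have h1 : (Set.Ioo (0 : ℝ) 1 • ((↑) '' (sphereMap e.toLinearIsometry ⁻¹' s)) : Set E) =
      e ⁻¹' (Set.Ioo (0 : ℝ) 1 • ((↑) '' s)) := by
    ext y
    simp only [Set.mem_preimage, Set.mem_smul, Set.mem_image]
    constructor
    · rintro ⟨t, ht, _, ⟨w, hw, rfl⟩, rfl⟩
      exact ⟨t, ht, _, ⟨_, hw, rfl⟩, by simp [sphereMap]⟩
    · rintro ⟨t, ht, _, ⟨w, hw, rfl⟩, hy⟩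
      refine ⟨t, ht, e.symm w, ⟨⟨e.symm w, ?_⟩, ?_, rfl⟩, ?_⟩
      · rw [mem_sphere_zero_iff_norm, e.symm.norm_map]
        exact mem_sphere_zero_iff_norm.1 w.2
      · have : sphereMap e.toLinearIsometry ⟨e.symm w, by
            rw [mem_sphere_zero_iff_norm, e.symm.norm_map]
            exact mem_sphere_zero_iff_norm.1 w.2⟩ = w := Subtype.ext (by simp [sphereMap])
        rwa [this]
      · apply e.injective
        rw [← hy]
        simp
  rw [h1]
  exact e.measurePreserving.measure_preimage_equiv (f := e.toMeasurableEquiv) _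

theorem map_uniformSphere (e : E ≃ₗᵢ[ℝ] F) :
    (uniformSphere E).map (sphereMap e.toLinearIsometry) = uniformSphere F := by
  have h := map_toSphere e
  have h2 := congrArg (fun m : Measure (Metric.sphere (0 : F) 1) => m Set.univ) h
  rw [Measure.map_apply (continuous_sphereMap _).measurable MeasurableSet.univ,
    Set.preimage_univ] at h2
  rw [uniformSphere, uniformSphere, Measure.map_smul, h, h2]

/-- The cone over a point lies in a line, a proper subspace in dimension above one. For the circle
this is what makes single directions negligible. -/
theorem nullSingletonClass_uniformSphere (hE : 1 < Module.finrank ℝ E) : NullSingletonClass (uniformSphere E) := by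
  refine ⟨fun w => ?_⟩
  rw [uniformSphere, Measure.smul_apply, Measure.toSphere_apply' _ (measurableSet_singleton w)]
  have h1 : (volume : Measure E) (Set.Ioo (0 : ℝ) 1 • ((↑) '' ({w} : Set _))) = 0 := by
    refine measure_mono_null (t := (Submodule.span ℝ {(w : E)} : Set E)) ?_ ?_
    · rintro _ ⟨t, _, _, ⟨_, rfl, rfl⟩, rfl⟩
      exact Submodule.smul_mem _ _ (Submodule.mem_span_singleton_self _)
    · refine Measure.addHaar_submodule _ _ fun htop => ?_
      have h2 := finrank_span_le_card (R := ℝ) ({(w : E)} : Set E)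
      rw [htop, finrank_top] at h2
      simp at h2
      omega
  rw [h1, mul_zero, smul_zero]

theorem isOpenPosMeasure_uniformSphere : (uniformSphere E).IsOpenPosMeasure :=
  Measure.isOpenPosMeasure_smul _ (ENNReal.inv_ne_zero.2 (measure_ne_top _ _))

end UniformSphere

instance : IsProbabilityMeasure area :=
  isProbabilityMeasure_uniformSphere

instance : area.IsOpenPosMeasure := isOpenPosMeasure_uniformSphere

/-- The uniform law on the circle. -/
def circleLaw : Measure S1 := uniformSphere E2

instance : IsProbabilityMeasure circleLaw := isProbabilityMeasure_uniformSphere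

instance : NullSingletonClass circleLaw := nullSingletonClass_uniformSphere (by simp)

theorem measurePreserving_smul_area (g : SO3) : MeasurePreserving (fun x : S2 => g • x) area area :=
  ⟨(continuous_const_smul g).measurable, map_uniformSphere (rotLin g)⟩

/-- The uniform law on the circle of unit tangent vectors at a point. -/
def fiber (x : S2) : Measure T1S2 := (uniformSphere (tangentPlane x)).map (T1S2.ofCircle x)

theorem continuous_ofCircle (x : S2) : Continuous (T1S2.ofCircle x) :=
  Continuous.subtype_mk (continuous_const.prodMk
    (continuous_subtype_val.comp continuous_subtype_val)) _

/-- The parametrization of the tangent plane by a rotation that carries the standard point to its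
base point. -/
def planeIso (g : SO3) : E2 →ₗᵢ[ℝ] tangentPlane (g • e0) where
  toFun c := ⟨rotVec g (planeVec c), by
    rw [mem_tangentPlane_iff, S2.coe_smul, inner_rotVec]
    simp [E3.inner_eq, e0, planeVec]⟩
  map_add' x y := by
    apply Subtype.ext
    have : planeVec (x + y) = planeVec x + planeVec y := by
      ext i; fin_cases i <;> simp [planeVec]
    simpa [this] using map_add (rotLin g) (planeVec x) (planeVec y)
  map_smul' c x := by
    apply Subtype.ext
    have : planeVec (c • x) = c • planeVec x := by
      ext i; fin_cases i <;> simp [planeVec]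
    change rotLin g (planeVec (c • x)) = c • rotLin g (planeVec x)
    rw [this, map_smul]
  norm_map' x := (norm_rotVec g _).trans (norm_planeVec x)

theorem finrank_tangentPlane (x : S2) : Module.finrank ℝ (tangentPlane x) = 2 :=
  Submodule.finrank_orthogonal_span_singleton (n := 2) (S2.coe_ne_zero x)

/-- All tangent planes are isometric images of one plane, so every fibre law is the image of a
single circle law. Measurability in the base point and equivariance both come from this. -/
theorem fiber_smul_e0 (g : SO3) : fiber (g • e0) = circleLaw.map fun c => g • circ c := by
  have h1 : Module.finrank ℝ E2 = Module.finrank ℝ (tangentPlane (g • e0)) := by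
    rw [finrank_tangentPlane]; simp
  have h2 := map_uniformSphere ((planeIso g).toLinearIsometryEquiv h1)
  rw [fiber, ← h2, Measure.map_map (continuous_ofCircle _).measurable
    (continuous_sphereMap _).measurable]
  rfl

theorem fiber_eq (x : S2) : fiber x = circleLaw.map fun c => triv (x, c) := by
  have h := fiber_smul_e0 (frame (unitField x))
  rw [frame_smul_e0] at h
  exact h

theorem map_smul_fiber (g : SO3) (x : S2) : (fiber x).map (fun u => g • u) = fiber (g • x) := by
  obtain ⟨k, rfl⟩ := exists_smul_e0 x
  have hm : ∀ k : SO3, Measurable fun c => k • circ c := fun k =>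
    ((continuous_const_smul k).comp continuous_circ).measurable
  rw [← mul_smul, fiber_smul_e0, fiber_smul_e0, Measure.map_map
    (continuous_const_smul g).measurable (hm k)]
  congr 1
  funext c
  exact (mul_smul g k (circ c)).symm

theorem measurable_triv_left (x : S2) : Measurable fun c => triv (x, c) :=
  measurable_triv.comp measurable_prodMk_left

theorem measurable_fiber : Measurable fiber := by
  refine Measure.measurable_of_measurable_coe _ fun A hA => ?_
  have h1 : ∀ x, fiber x A = circleLaw (Prod.mk x ⁻¹' (triv ⁻¹' A)) := fun x => by
    rw [fiber_eq, Measure.map_apply (measurable_triv_left x) hA]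
    rfl
  simp only [h1]
  exact measurable_measure_prodMk_left (measurable_triv hA)

/-- Normalized Liouville measure on the unit tangent bundle. -/
def liouville1 : Measure T1S2 := area.bind fiber

theorem liouville1_apply {A : Set T1S2} (hA : MeasurableSet A) :
    liouville1 A = ∫⁻ x, fiber x A ∂area :=
  Measure.bind_apply hA measurable_fiber.aemeasurable

/-- Presenting Liouville measure as the image of a product measure makes Fubini available for
fibrewise arguments. -/
theorem liouville1_eq_map : liouville1 = (area.prod circleLaw).map triv := by
  ext A hA
  rw [liouville1_apply hA, Measure.map_apply measurable_triv hA,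
    Measure.prod_apply (measurable_triv hA)]
  refine lintegral_congr fun x => ?_
  rw [fiber_eq, Measure.map_apply (measurable_triv_left x) hA]
  rfl

theorem measurePreserving_triv : MeasurePreserving triv (area.prod circleLaw) liouville1 :=
  ⟨measurable_triv, liouville1_eq_map.symm⟩

instance : IsProbabilityMeasure liouville1 := by
  rw [liouville1_eq_map]
  exact Measure.isProbabilityMeasure_map measurable_triv.aemeasurable

theorem measurable_mk : Measurable (fun u : T1S2 => (Quotient.mk antipodal u : PS2)) :=
  measurable_quotient_mk''

theorem map_mk_liouville1 :
    liouville1.map (fun u : T1S2 => (Quotient.mk antipodal u : PS2)) = liouville := by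
  have h1 : ∀ x, (uniformSphere (tangentPlane x)).map
      (fun w => (Quotient.mk antipodal (T1S2.ofCircle x w) : PS2)) =
      (fiber x).map (fun u : T1S2 => (Quotient.mk antipodal u : PS2)) := fun x => by
    rw [fiber, Measure.map_map measurable_mk (continuous_ofCircle x).measurable]
    rfl
  have h2 : Measurable fun x => (fiber x).map
      (fun u : T1S2 => (Quotient.mk antipodal u : PS2)) :=
    (Measure.measurable_map _ measurable_mk).comp measurable_fiber
  ext A hA
  rw [liouville, Measure.map_apply measurable_mk hA, liouville1_apply (measurable_mk hA)]
  simp only [h1]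
  rw [Measure.bind_apply hA h2.aemeasurable]
  refine lintegral_congr fun x => ?_
  rw [Measure.map_apply measurable_mk hA]

theorem measurePreserving_mk : MeasurePreserving
    (fun u : T1S2 => (Quotient.mk antipodal u : PS2)) liouville1 liouville :=
  ⟨measurable_mk, map_mk_liouville1⟩

theorem measurePreserving_base : MeasurePreserving T1S2.base liouville1 area := by
  refine ⟨continuous_base.measurable, ?_⟩
  rw [liouville1_eq_map, Measure.map_map continuous_base.measurable measurable_triv]
  have : T1S2.base ∘ triv = Prod.fst := funext triv_base
  rw [this]
  simp

theorem measurePreserving_smul_liouville1 (g : SO3) :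
    MeasurePreserving (fun u : T1S2 => g • u) liouville1 liouville1 := by
  have hg : Measurable fun u : T1S2 => g • u := (continuous_const_smul g).measurable
  refine ⟨hg, ?_⟩
  ext A hA
  rw [Measure.map_apply hg hA, liouville1_apply (hg hA), liouville1_apply hA,
    ← (measurePreserving_smul_area g).lintegral_comp (f := fun x => fiber x A)
      ((Measure.measurable_coe hA).comp measurable_fiber)]
  refine lintegral_congr fun x => ?_
  rw [← map_smul_fiber, Measure.map_apply hg hA]

/-! ### Haar measure on the rotation group -/

instance : SecondCountableTopology SO3 :=
  have : SecondCountableTopology (Matrix (Fin 3) (Fin 3) ℝ) :=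
    inferInstanceAs (SecondCountableTopology (Fin 3 → Fin 3 → ℝ))
  TopologicalSpace.Subtype.secondCountableTopology _

/-- The Haar probability measure on the rotation group. -/
def haarProb : Measure SO3 := (Measure.haar (Set.univ : Set SO3))⁻¹ • Measure.haar

instance : IsFiniteMeasure (Measure.haar : Measure SO3) := inferInstance

theorem haar_univ_ne_zero : Measure.haar (Set.univ : Set SO3) ≠ 0 := by
  rw [Ne, Measure.measure_univ_eq_zero]
  exact NeZero.ne _

instance : IsProbabilityMeasure haarProb := by
  constructor
  rw [haarProb, Measure.smul_apply, smul_eq_mul]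
  exact ENNReal.inv_mul_cancel haar_univ_ne_zero (measure_ne_top _ _)

instance : haarProb.IsHaarMeasure :=
  Measure.IsHaarMeasure.smul _ (by simp) (ENNReal.inv_ne_top.2 haar_univ_ne_zero)

theorem eq_haarProb {m : Measure SO3} [IsProbabilityMeasure m] [m.IsMulLeftInvariant] :
    m = haarProb := by
  rw [Measure.isMulInvariant_eq_smul_of_compactSpace m haarProb]
  have h := congrArg (fun m : Measure SO3 => m Set.univ)
    (Measure.isMulInvariant_eq_smul_of_compactSpace m haarProb)
  simp only [Measure.smul_apply, measure_univ] at h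
  have h2 : m.haarScalarFactor haarProb = 1 := by
    rw [ENNReal.smul_def, smul_eq_mul, mul_one] at h
    exact_mod_cast h.symm
  rw [h2, one_smul]

theorem measurePreserving_mul_left_haarProb (g : SO3) :
    MeasurePreserving (fun k => g * k) haarProb haarProb := measurePreserving_mul_left _ g

/-- A right translate of a left invariant measure is still left invariant, and the invariant
probability on a compact group is unique. -/
theorem measurePreserving_mul_right_haarProb (g : SO3) :
    MeasurePreserving (fun k => k * g) haarProb haarProb := by
  have hg : Measurable fun k : SO3 => k * g := (continuous_mul_const g).measurable
  refine ⟨hg, ?_⟩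
  have : IsProbabilityMeasure (haarProb.map fun k => k * g) :=
    Measure.isProbabilityMeasure_map hg.aemeasurable
  exact eq_haarProb

theorem measurePreserving_inv_haarProb :
    MeasurePreserving (fun k => k⁻¹) haarProb haarProb := by
  have hi : Measurable fun k : SO3 => k⁻¹ := continuous_inv.measurable
  have : IsProbabilityMeasure (haarProb.map fun k => k⁻¹) :=
    Measure.isProbabilityMeasure_map hi.aemeasurable
  have h2 : (haarProb.map fun k => k⁻¹).IsMulLeftInvariant := by
    refine ⟨fun g => ?_⟩
    rw [Measure.map_map (continuous_const_mul g).measurable hi]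
    have h3 : ((fun x => g * x) ∘ fun k : SO3 => k⁻¹) = (fun k => k⁻¹) ∘ fun k => k * g⁻¹ := by
      funext k
      simp
    rw [h3, ← Measure.map_map hi (continuous_mul_const g⁻¹).measurable,
      (measurePreserving_mul_right_haarProb g⁻¹).map_eq]
  exact ⟨hi, eq_haarProb⟩

/-- By `frame_smul` the map is equivariant, so it carries the rotation invariant Liouville measure
to a left invariant probability. -/
theorem measurePreserving_frame : MeasurePreserving frame liouville1 haarProb := by
  have hm := continuous_frame.measurable
  have : IsProbabilityMeasure (liouville1.map frame) :=
    Measure.isProbabilityMeasure_map hm.aemeasurable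
  have h2 : (liouville1.map frame).IsMulLeftInvariant := by
    refine ⟨fun g => ?_⟩
    rw [Measure.map_map (continuous_const_mul g).measurable hm]
    have h3 : ((fun x => g * x) ∘ frame) = frame ∘ fun u => g • u := by
      funext u
      exact (frame_smul g u).symm
    rw [h3, ← Measure.map_map hm (continuous_const_smul g).measurable,
      (measurePreserving_smul_liouville1 g).map_eq]
  exact ⟨hm, eq_haarProb⟩

theorem continuous_smul_u0 : Continuous fun g : SO3 => g • u0 :=
  continuous_smul.comp (continuous_id.prodMk continuous_const)

theorem measurePreserving_smul_u0 :
    MeasurePreserving (fun g : SO3 => g • u0) haarProb liouville1 := by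
  have hm : Measurable fun g : SO3 => g • u0 := continuous_smul_u0.measurable
  refine ⟨hm, ?_⟩
  rw [← measurePreserving_frame.map_eq, Measure.map_map hm continuous_frame.measurable]
  have : (fun g : SO3 => g • u0) ∘ frame = id := funext frame_smul_u0
  rw [this, Measure.map_id]

instance : liouville1.IsOpenPosMeasure := by
  rw [← measurePreserving_smul_u0.map_eq]
  refine continuous_smul_u0.isOpenPosMeasure_map fun u => ⟨frame u, frame_smul_u0 u⟩

theorem uniformBall_eq (δ : ℝ) : uniformBall δ = ProbabilityTheory.cond haarProb (rotBall δ) := by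
  rw [uniformBall, ProbabilityTheory.cond, ProbabilityTheory.cond, haarProb, Measure.restrict_smul,
    Measure.smul_apply, smul_smul, smul_eq_mul]
  congr 1
  have h1 := haar_univ_ne_zero
  have h2 : Measure.haar (Set.univ : Set SO3) ≠ ⊤ := measure_ne_top _ _
  rw [ENNReal.mul_inv (Or.inl (ENNReal.inv_ne_zero.2 h2)) (Or.inl (ENNReal.inv_ne_top.2 h1)),
    inv_inv, mul_comm, ← mul_assoc, ENNReal.inv_mul_cancel h1 h2, one_mul]

end DiffusedSphere
end

noncomputable section

namespace DiffusedSphere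

/-! ### The action on unit tangent vectors in ambient coordinates -/

/-- The number `‖Th u‖` for a unit tangent vector `u`. -/
def stretch1 (h : Diff) (u : T1S2) : ℝ := ‖tangentMap h u.base u.vec‖

theorem stretch1_eq (h : Diff) (u : T1S2) : stretch1 h u = ‖dext h u.1.1 u.1.2‖ := by
  rw [stretch1, Submodule.coe_norm, coe_tangentMap]
  rfl

theorem stretch1_pos (h : Diff) (u : T1S2) : 0 < stretch1 h u := by
  rw [stretch1, norm_pos_iff]
  simpa using u.vec_ne_zero

@[simp] theorem sharp1_fst (h : Diff) (u : T1S2) : (sharp1 h u).1.1 = h u.1.1 := rfl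

@[simp] theorem sharp1_base (h : Diff) (u : T1S2) : (sharp1 h u).base = h u.base := rfl

theorem sharp1_snd (h : Diff) (u : T1S2) :
    (sharp1 h u).1.2 = (stretch1 h u)⁻¹ • dext h u.1.1 u.1.2 := by
  change ‖tangentMap h u.base u.vec‖⁻¹ • (tangentMap h u.base u.vec : E3) = _
  rw [coe_tangentMap]
  rfl

theorem T1S2.ext' {u v : T1S2} (h1 : u.1.1 = v.1.1) (h2 : u.1.2 = v.1.2) : u = v :=
  Subtype.ext (Prod.ext h1 h2)

theorem continuous_dext_apply (h : Diff) :
    Continuous fun u : T1S2 => dext h u.1.1 u.1.2 := by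
  have h1 : Continuous fun x : S2 => dext h x := by
    have := (contDiffOn_dext h).continuousOn.comp_continuous continuous_subtype_val
      (fun x : S2 => S2.coe_ne_zero x)
    exact this
  have h2 : Continuous fun u : T1S2 => u.1.1 := continuous_base
  have h3 : Continuous fun u : T1S2 => u.1.2 := continuous_snd.comp continuous_subtype_val
  exact (h1.comp h2).clm_apply h3

theorem continuous_stretch1 (h : Diff) : Continuous (stretch1 h) := by
  rw [show stretch1 h = _ from funext (stretch1_eq h)]
  exact (continuous_dext_apply h).norm

theorem continuous_sharp1 (h : Diff) : Continuous (sharp1 h) := by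
  refine continuous_induced_rng.2 (Continuous.prodMk (h.continuous.comp continuous_base) ?_)
  have : (fun u => (sharp1 h u).1.2) = fun u => (stretch1 h u)⁻¹ • dext h u.1.1 u.1.2 :=
    funext (sharp1_snd h)
  exact this ▸ ((continuous_stretch1 h).inv₀ fun u => (stretch1_pos h u).ne').smul
    (continuous_dext_apply h)

theorem dext_snd (h : Diff) (u : T1S2) :
    dext h u.1.1 u.1.2 = stretch1 h u • (sharp1 h u).1.2 := by
  rw [sharp1_snd, smul_smul, mul_inv_cancel₀ (stretch1_pos h u).ne', one_smul]

theorem dext_trans_coe (h k : Diff) (x : S2) :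
    dext (h.trans k) x = (dext k (h x)).comp (dext h x) := by
  rw [dext_trans h k (S2.coe_ne_zero x), ext_coe]

theorem stretch1_trans (h k : Diff) (u : T1S2) :
    stretch1 (h.trans k) u = stretch1 h u * stretch1 k (sharp1 h u) := by
  rw [stretch1_eq, dext_trans_coe, ContinuousLinearMap.comp_apply, dext_snd, map_smul, norm_smul,
    Real.norm_of_nonneg (stretch1_pos h u).le, stretch1_eq k, sharp1_fst]

theorem sharp1_trans (h k : Diff) (u : T1S2) : sharp1 (h.trans k) u = sharp1 k (sharp1 h u) := by
  refine T1S2.ext' (by simp only [sharp1_fst, Diffeomorph.coe_trans, Function.comp_apply]) ?_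
  rw [sharp1_snd, sharp1_snd, stretch1_trans, dext_trans_coe, ContinuousLinearMap.comp_apply,
    dext_snd, map_smul, smul_smul, mul_inv, mul_assoc, mul_comm, mul_assoc,
    mul_inv_cancel₀ (stretch1_pos h u).ne', mul_one, sharp1_fst]

theorem stretch1_refl (u : T1S2) : stretch1 (Diffeomorph.refl (𝓡 2) S2 ∞) u = 1 := by
  rw [stretch1_eq, dext_refl (S2.coe_ne_zero _)]
  exact u.norm_snd

theorem sharp1_refl (u : T1S2) : sharp1 (Diffeomorph.refl (𝓡 2) S2 ∞) u = u := by
  refine T1S2.ext' rfl ?_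
  rw [sharp1_snd, stretch1_refl, dext_refl (S2.coe_ne_zero _)]
  simp

theorem sharp1_symm_sharp1 (h : Diff) (u : T1S2) : sharp1 h.symm (sharp1 h u) = u := by
  rw [← sharp1_trans, Diffeomorph.self_trans_symm, sharp1_refl]

theorem sharp1_sharp1_symm (h : Diff) (u : T1S2) : sharp1 h (sharp1 h.symm u) = u := by
  rw [← sharp1_trans, Diffeomorph.symm_trans_self, sharp1_refl]

theorem stretch1_symm (h : Diff) (u : T1S2) :
    stretch1 h.symm (sharp1 h u) = (stretch1 h u)⁻¹ := by
  have h1 := stretch1_trans h h.symm u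
  rw [Diffeomorph.self_trans_symm, stretch1_refl] at h1
  exact eq_inv_of_mul_eq_one_right h1.symm

theorem ext_rot (g : SO3) (y : E3) : ext (rot g) y = rotVec g y := by
  have h1 : ext (rot g) y = ‖y‖ • rotLin g (radial y) := rfl
  rw [h1, ← map_smul, norm_smul_radial, rotLin_apply]

theorem dext_rot (g : SO3) (y v : E3) : dext (rot g) y v = rotVec g v := by
  have h1 : ext (rot g) = (rotLin g : E3 →L[ℝ] E3) := funext (ext_rot g)
  rw [dext, h1, ContinuousLinearMap.fderiv]
  rfl

theorem stretch1_rot (g : SO3) (u : T1S2) : stretch1 (rot g) u = 1 := by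
  rw [stretch1_eq, dext_rot, norm_rotVec, u.norm_snd]

theorem sharp1_rot (g : SO3) (u : T1S2) : sharp1 (rot g) u = g • u := by
  refine T1S2.ext' rfl ?_
  rw [sharp1_snd, stretch1_rot, dext_rot]
  simp

theorem coset_apply (h : Diff) (g : SO3) (x : S2) : coset h g x = g • h x := rfl

theorem sharp1_coset (h : Diff) (g : SO3) (u : T1S2) :
    sharp1 (coset h g) u = g • sharp1 h u := by
  rw [coset, sharp1_trans, sharp1_rot]

/-- Rotations are isometries, so the randomness does not enter the stretch of a single step; the
Birkhoff observable depends only on the tangent vector. -/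
theorem stretch1_coset (h : Diff) (g : SO3) (u : T1S2) :
    stretch1 (coset h g) u = stretch1 h u := by
  rw [coset, stretch1_trans, stretch1_rot, mul_one]

theorem stretch_coset (h : Diff) (g : SO3) (v : PS2) : stretch (coset h g) v = stretch h v := by
  induction v using Quotient.inductionOn with
  | h u => exact stretch1_coset h g u

/-- The opposite unit tangent vector. -/
def antip (u : T1S2) : T1S2 := ⟨(u.1.1, -u.1.2), neg_mem u.2.1, by rw [norm_neg]; exact u.2.2⟩

theorem continuous_antip : Continuous antip :=
  Continuous.subtype_mk ((continuous_fst.comp continuous_subtype_val).prodMk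
    (continuous_snd.comp continuous_subtype_val).neg) _

theorem mk_antip (u : T1S2) : (Quotient.mk antipodal (antip u) : PS2) = Quotient.mk antipodal u :=
  Quotient.sound ⟨rfl, Or.inr rfl⟩

theorem mk_eq_mk_iff {u v : T1S2} :
    (Quotient.mk antipodal u : PS2) = Quotient.mk antipodal v ↔ u = v ∨ u = antip v := by
  rw [Quotient.eq]
  constructor
  · rintro ⟨h1, h2 | h2⟩
    · exact Or.inl (T1S2.ext' h1 h2)
    · exact Or.inr (T1S2.ext' h1 h2)
  · rintro (rfl | rfl)
    · exact ⟨rfl, Or.inl rfl⟩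
    · exact ⟨rfl, Or.inr rfl⟩

theorem antip_antip (u : T1S2) : antip (antip u) = u := T1S2.ext' rfl (neg_neg _)

theorem stretch1_antip (h : Diff) (u : T1S2) : stretch1 h (antip u) = stretch1 h u := by
  rw [stretch1_eq, stretch1_eq]
  change ‖dext h u.1.1 (-u.1.2)‖ = _
  rw [map_neg, norm_neg]

theorem sharp1_antip (h : Diff) (u : T1S2) : sharp1 h (antip u) = antip (sharp1 h u) := by
  have h1 : (antip u).1.1 = u.1.1 := rfl
  have h2 : (antip u).1.2 = -u.1.2 := rfl
  have h3 : (antip (sharp1 h u)).1.1 = (sharp1 h u).1.1 := rfl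
  have h4 : (antip (sharp1 h u)).1.2 = -(sharp1 h u).1.2 := rfl
  refine T1S2.ext' (by rw [h3, sharp1_fst, sharp1_fst, h1]) ?_
  rw [sharp1_snd, stretch1_antip, h1, h2, h4, map_neg, smul_neg, sharp1_snd]

theorem smul_antip (g : SO3) (u : T1S2) : g • antip u = antip (g • u) :=
  T1S2.ext' rfl (map_neg (rotLin g) _)

end DiffusedSphere
end

noncomputable section

namespace DiffusedSphere

/-! ### Change of variables -/

section Cone

variable {E : Type*} [NormedAddCommGroup E] [InnerProductSpace ℝ E]
    [FiniteDimensional ℝ E] [MeasurableSpace E] [BorelSpace E]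

theorem abs_det_linearIsometryEquiv (e : E ≃ₗᵢ[ℝ] E) :
    |LinearMap.det (e.toLinearEquiv : E →ₗ[ℝ] E)| = 1 := by
  have h1 := Measure.addHaar_image_linearMap (volume : Measure E)
    (e.toLinearEquiv : E →ₗ[ℝ] E) (Metric.ball 0 1)
  have h2 : ((e.toLinearEquiv : E →ₗ[ℝ] E) '' Metric.ball 0 1) = Metric.ball 0 1 := by
    have := e.image_ball 0 1
    rw [map_zero] at this
    exact this
  have h0 : (volume : Measure E) (Metric.ball 0 1) ≠ 0 :=
    (Metric.measure_ball_pos _ _ one_pos).ne'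
  have ht : (volume : Measure E) (Metric.ball 0 1) ≠ ⊤ := measure_ball_lt_top.ne
  rw [h2] at h1
  have h3 : ENNReal.ofReal |LinearMap.det (e.toLinearEquiv : E →ₗ[ℝ] E)| = 1 := by
    have := congrArg (fun t => t * ((volume : Measure E) (Metric.ball 0 1))⁻¹) h1
    simp only [mul_assoc, ENNReal.mul_inv_cancel h0 ht, mul_one] at this
    exact this.symm
  rwa [ENNReal.ofReal_eq_one] at h3

end Cone

/-! ### Area as a radial image of Lebesgue measure. -/

/-- The punctured unit ball of three-space. -/
def puncturedBall : Set E3 := Metric.ball 0 1 \ {0}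

theorem measurableSet_puncturedBall : MeasurableSet puncturedBall :=
  measurableSet_ball.diff (measurableSet_singleton 0)

theorem measurable_radial : Measurable radial := by
  have h1 : Measurable fun y : E3 => (radial y : E3) := by
    have : (fun y : E3 => (radial y : E3)) =
        fun y => if y = 0 then EuclideanSpace.single 0 1 else ‖y‖⁻¹ • y := by
      funext y
      unfold radial
      split_ifs <;> rfl
    rw [this]
    exact Measurable.ite (measurableSet_singleton 0) measurable_const
      (measurable_norm.inv.smul measurable_id)
  exact h1.subtype_mk (h := fun y => (radial y).2)

/-- The cone over a set of directions is its radial preimage in the punctured ball. This transfers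
changes of variables on the sphere to three-space. -/
theorem area_eq : area =
    (volume puncturedBall)⁻¹ • ((volume : Measure E3).restrict puncturedBall).map radial := by
  ext s hs
  have hd : ((Module.finrank ℝ E3 : ℕ) : ENNReal) ≠ 0 := by simp
  have hset : (Set.image2 (fun (t : ℝ) (y : E3) => t • y) (Set.Ioo (0 : ℝ) 1) ((↑) '' s)) =
      radial ⁻¹' s ∩ puncturedBall := by
    ext y
    constructor
    · rintro ⟨t, ht, _, ⟨x, hx, rfl⟩, rfl⟩
      refine ⟨?_, ?_, ?_⟩
      · simpa [radial_smul ht.1] using hx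
      · simpa [norm_smul, S2.norm_coe, abs_of_pos ht.1] using ht.2
      · simpa using smul_ne_zero ht.1.ne' (S2.coe_ne_zero x)
    · rintro ⟨h1, h2, h3⟩
      refine ⟨‖y‖, ⟨norm_pos_iff.2 h3, by simpa using h2⟩, radial y, ⟨_, h1, rfl⟩, ?_⟩
      exact norm_smul_radial y
  rw [area, uniformSphere, Measure.smul_apply, Measure.smul_apply, Measure.toSphere_apply' _ hs,
    Measure.toSphere_apply_univ', Measure.map_apply measurable_radial hs,
    Measure.restrict_apply (measurable_radial hs), ← hset, smul_eq_mul, smul_eq_mul,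
    ENNReal.mul_inv (Or.inl hd) (Or.inl (ENNReal.natCast_ne_top _)), mul_assoc,
    mul_left_comm (volume _)⁻¹, ← mul_assoc, ENNReal.inv_mul_cancel hd (ENNReal.natCast_ne_top _),
    one_mul]
  rfl

theorem lintegral_area {f : S2 → ENNReal} (hf : Measurable f) :
    ∫⁻ x, f x ∂area = (volume puncturedBall)⁻¹ * ∫⁻ y in puncturedBall, f (radial y) := by
  rw [area_eq, lintegral_smul_measure, lintegral_map hf measurable_radial]
  rfl

theorem ext_image_puncturedBall (h : Diff) : ext h '' puncturedBall = puncturedBall := by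
  have key : ∀ (h : Diff) (y : E3), y ∈ puncturedBall → ext h y ∈ puncturedBall := by
    rintro h y ⟨h1, h2⟩
    refine ⟨?_, ext_ne_zero h h2⟩
    rw [mem_ball_zero_iff, norm_ext]
    exact mem_ball_zero_iff.1 h1
  refine Set.Subset.antisymm (Set.image_subset_iff.2 (key h)) fun y hy => ?_
  exact ⟨ext h.symm y, key _ y hy, ext_ext_symm h y⟩

/-- The absolute value of the Jacobian determinant. -/
def absDet (h : Diff) (x : S2) : ℝ := |(dext h x).det|

theorem continuous_absDet (h : Diff) : Continuous (absDet h) := by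
  have h1 : Continuous fun x : S2 => dext h x :=
    (contDiffOn_dext h).continuousOn.comp_continuous continuous_subtype_val
      (fun x : S2 => S2.coe_ne_zero x)
  exact (ContinuousLinearMap.continuous_det.comp h1).abs

theorem dext_radial (h : Diff) {y : E3} (hy : y ≠ 0) : dext h (radial y) = dext h y := by
  conv_rhs => rw [← norm_smul_radial y]
  exact (dext_smul h (norm_pos_iff.2 hy) (S2.coe_ne_zero _)).symm

/-- The extension `ext h` is a bijection of the punctured ball that covers `h` under radial
projection, so the Euclidean formula applies, and its Jacobian is constant on rays. -/
theorem lintegral_absDet_mul (h : Diff) {f : S2 → ENNReal} (hf : Measurable f) :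
    ∫⁻ x, ENNReal.ofReal (absDet h x) * f (h x) ∂area = ∫⁻ x, f x ∂area := by
  have hm : Measurable fun x => ENNReal.ofReal (absDet h x) * f (h x) :=
    (continuous_absDet h).measurable.ennreal_ofReal.mul (hf.comp h.continuous.measurable)
  have h1 := lintegral_image_eq_lintegral_abs_det_fderiv_mul (volume : Measure E3)
    measurableSet_puncturedBall (f := ext h) (f' := dext h)
    (fun y hy => (differentiableAt_ext h hy.2).hasFDerivAt.hasFDerivWithinAt)
    (fun y _ z _ hyz => by rw [← ext_symm_ext h y, hyz, ext_symm_ext]) (fun y => f (radial y))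
  rw [ext_image_puncturedBall] at h1
  rw [lintegral_area hm, lintegral_area hf, h1]
  congr 1
  refine setLIntegral_congr_fun measurableSet_puncturedBall fun y hy => ?_
  have hy0 : y ≠ 0 := hy.2
  simp only [absDet, dext_radial h hy0, radial_ext h hy0]

/-- Comparing densities gives the equality almost everywhere; continuity and the full support of
`area` upgrade it to every point. -/
theorem absDet_eq_one (h : Diff) (hp : MeasurePreserving h area area) (x : S2) :
    absDet h x = 1 := by
  have hm : Measurable fun x => ENNReal.ofReal (absDet h x) :=
    (continuous_absDet h).measurable.ennreal_ofReal
  have h1 : area.withDensity (fun x => ENNReal.ofReal (absDet h x)) =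
      area.withDensity fun _ => 1 := by
    refine Measure.ext_of_lintegral _ fun f hf => ?_
    rw [lintegral_withDensity_eq_lintegral_mul _ hm hf,
      lintegral_withDensity_eq_lintegral_mul _ measurable_const hf]
    have h2 := lintegral_absDet_mul h (f := fun x => f (h.symm x))
      (hf.comp h.symm.continuous.measurable)
    have h3 := hp.lintegral_comp (f := fun x => f (h.symm x))
      (hf.comp h.symm.continuous.measurable)
    simp only [Diffeomorph.symm_apply_apply] at h2 h3
    simp only [Pi.mul_apply, one_mul]
    rw [h2, ← h3]
  have h2 := (withDensity_eq_iff_of_sigmaFinite hm.aemeasurable aemeasurable_const).1 h1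
  have h3 : (fun x => absDet h x) =ᵐ[area] fun _ => 1 := by
    filter_upwards [h2] with x hx
    rwa [ENNReal.ofReal_eq_one] at hx
  exact congrFun (((continuous_absDet h).ae_eq_iff_eq area continuous_const).1 h3) x

theorem measurePreserving_of_absDet (h : Diff) (hd : ∀ x, absDet h x = 1) :
    MeasurePreserving h area area := by
  refine ⟨h.continuous.measurable, Measure.ext_of_lintegral _ fun f hf => ?_⟩
  rw [lintegral_map hf h.continuous.measurable, ← lintegral_absDet_mul h hf]
  simp [hd]

/-! #### Circles -/

/-- The direction of a vector of the plane (with a junk value at the origin). -/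
def dir (y : E2) : S1 :=
  if hy : y = 0 then ⟨EuclideanSpace.single 0 1, by simp⟩
  else ⟨‖y‖⁻¹ • y, by simp [norm_smul, hy]⟩

theorem coe_dir {y : E2} (hy : y ≠ 0) : (dir y : E2) = ‖y‖⁻¹ • y := by
  simp [dir, hy]

theorem dir_smul {t : ℝ} (ht : 0 < t) (y : E2) : dir (t • y) = dir y := by
  by_cases hy : y = 0
  · simp [hy]
  · apply Subtype.ext
    rw [coe_dir hy, coe_dir (smul_ne_zero ht.ne' hy), norm_smul, smul_smul]
    congr 1
    rw [Real.norm_of_nonneg ht.le]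
    field_simp

theorem measurable_dir : Measurable dir := by
  have h1 : Measurable fun y : E2 => (dir y : E2) := by
    have : (fun y : E2 => (dir y : E2)) =
        fun y => if y = 0 then EuclideanSpace.single 0 1 else ‖y‖⁻¹ • y := by
      funext y
      unfold dir
      split_ifs <;> rfl
    rw [this]
    exact Measurable.ite (measurableSet_singleton 0) measurable_const
      (measurable_norm.inv.smul measurable_id)
  exact h1.subtype_mk (h := fun y => (dir y).2)

theorem S1.coe_ne_zero (c : S1) : (c : E2) ≠ 0 := by
  intro h
  have := mem_sphere_zero_iff_norm.1 c.2
  rw [h, norm_zero] at this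
  exact zero_ne_one this

@[simp] theorem dir_coe (c : S1) : dir c = c := by
  apply Subtype.ext
  rw [coe_dir (S1.coe_ne_zero c), mem_sphere_zero_iff_norm.1 c.2]
  simp

/-- Polar coordinates: in the direction `c` the region is `0 < r < ‖A c‖⁻¹`, and integrating `r dr`
gives half the square of this bound. -/
theorem volume_sector (A : E2 ≃L[ℝ] E2) {s : Set S1} (hs : MeasurableSet s) :
    (volume : Measure E2) {y | y ≠ 0 ∧ ‖A y‖ < 1 ∧ dir (A y) ∈ s} =
      ∫⁻ c, s.indicator 1 (dir (A c)) * ENNReal.ofReal ((‖A c‖⁻¹) ^ 2 / 2)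
        ∂(volume : Measure E2).toSphere := by
  let S : Set E2 := {y | y ≠ 0 ∧ ‖A y‖ < 1 ∧ dir (A y) ∈ s}
  let S' : Set (S1 × Set.Ioi (0 : ℝ)) := {p | (p.2 : ℝ) * ‖A p.1‖ < 1 ∧ dir (A p.1) ∈ s}
  have hdA : Measurable fun c : S1 => dir (A c) :=
    measurable_dir.comp (A.continuous.comp continuous_subtype_val).measurable
  have hS' : MeasurableSet S' := by
    refine MeasurableSet.inter ?_ ?_
    · have h1 : Continuous fun p : S1 × Set.Ioi (0 : ℝ) => (p.2 : ℝ) * ‖A p.1‖ :=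
        (continuous_subtype_val.comp continuous_snd).mul
          (A.continuous.comp (continuous_subtype_val.comp continuous_fst)).norm
      exact measurableSet_lt h1.measurable measurable_const
    · exact (hdA.comp measurable_fst) hs
  have h1 := (Measure.measurePreserving_homeomorphUnitSphereProd
    (volume : Measure E2)).measure_preimage hS'.nullMeasurableSet
  have h2 : (volume.comap ((↑) : ({0}ᶜ : Set E2) → E2)) (homeomorphUnitSphereProd E2 ⁻¹' S') =
      volume S := by
    rw [comap_subtype_coe_apply (measurableSet_singleton _).compl]
    congr 1
    ext y
    simp only [Set.mem_image, Subtype.exists, exists_and_right, exists_eq_right]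
    constructor
    · rintro ⟨hy, h3, h4⟩
      have hy0 : y ≠ 0 := hy
      have e1 : ((homeomorphUnitSphereProd E2 ⟨y, hy⟩).1 : E2) = ‖y‖⁻¹ • y := by simp
      have e2 : ((homeomorphUnitSphereProd E2 ⟨y, hy⟩).2 : ℝ) = ‖y‖ := by simp
      rw [e1, e2, map_smul, norm_smul, norm_inv, norm_norm, ← mul_assoc,
        mul_inv_cancel₀ (norm_ne_zero_iff.2 hy0), one_mul] at h3
      rw [e1, map_smul, dir_smul (inv_pos.2 (norm_pos_iff.2 hy0))] at h4
      exact ⟨hy0, h3, h4⟩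
    · rintro ⟨hy0, h3, h4⟩
      refine ⟨hy0, ?_, ?_⟩
      · have e1 : ((homeomorphUnitSphereProd E2 ⟨y, hy0⟩).1 : E2) = ‖y‖⁻¹ • y := by simp
        have e2 : ((homeomorphUnitSphereProd E2 ⟨y, hy0⟩).2 : ℝ) = ‖y‖ := by simp
        rw [e1, e2, map_smul, norm_smul, norm_inv, norm_norm, ← mul_assoc,
          mul_inv_cancel₀ (norm_ne_zero_iff.2 hy0), one_mul]
        exact h3
      · have e1 : ((homeomorphUnitSphereProd E2 ⟨y, hy0⟩).1 : E2) = ‖y‖⁻¹ • y := by simp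
        rw [e1, map_smul, dir_smul (inv_pos.2 (norm_pos_iff.2 hy0))]
        exact h4
  rw [h2, Measure.prod_apply hS'] at h1
  change volume S = _
  rw [h1]
  refine lintegral_congr fun c => ?_
  have hA : 0 < ‖A c‖ := norm_pos_iff.2 (by simpa using S1.coe_ne_zero c)
  by_cases hc : dir (A c) ∈ s
  · have e3 : Prod.mk c ⁻¹' S' = Set.Iio ⟨‖A c‖⁻¹, inv_pos.2 hA⟩ := by
      ext r
      simp only [S', Set.mem_preimage, Set.mem_ofPred_eq, hc, and_true, Set.mem_Iio]
      rw [← Subtype.coe_lt_coe, lt_inv_comm₀ r.2 hA, ← one_div, lt_div_iff₀ r.2, mul_comm]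
    rw [e3, Measure.volumeIoiPow_apply_Iio]
    simp [hc]
    norm_num
  · have e3 : Prod.mk c ⁻¹' S' = ∅ := by
      ext r
      simp [S', hc]
    rw [e3]
    simp [hc]

/-- The action of `A` on directions has Jacobian `‖A c‖⁻²` when `A` preserves area: the set treated
in `volume_sector` is the preimage under `A` of a plain sector, so the two have the same area. -/
theorem lintegral_dir_mul (A : E2 ≃L[ℝ] E2)
    (hA : |LinearMap.det (A : E2 →ₗ[ℝ] E2)| = 1) {F : S1 → ENNReal} (hF : Measurable F) :
    ∫⁻ c, F (dir (A c)) * ENNReal.ofReal ((‖A c‖⁻¹) ^ 2) ∂circleLaw = ∫⁻ c, F c ∂circleLaw := by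
  have hdA : ∀ A : E2 ≃L[ℝ] E2, Measurable fun c : S1 => dir (A c) := fun A =>
    measurable_dir.comp (A.continuous.comp continuous_subtype_val).measurable
  have hw : ∀ A : E2 ≃L[ℝ] E2, Measurable fun c : S1 => ENNReal.ofReal ((‖A c‖⁻¹) ^ 2 / 2) :=
    fun A => ((((A.continuous.comp continuous_subtype_val).norm.measurable.inv).pow_const
      2).div_const 2).ennreal_ofReal
  let μ : (E2 ≃L[ℝ] E2) → Measure S1 := fun A =>
    ((volume : Measure E2).toSphere.withDensity
      fun c => ENNReal.ofReal ((‖A c‖⁻¹) ^ 2 / 2)).map fun c : S1 => dir (A c)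
  have hμ : ∀ (A : E2 ≃L[ℝ] E2) (F : S1 → ENNReal), Measurable F → ∫⁻ c, F c ∂(μ A) =
      ∫⁻ c, F (dir (A c)) * ENNReal.ofReal ((‖A c‖⁻¹) ^ 2 / 2) ∂(volume : Measure E2).toSphere := by
    intro A F hF
    rw [lintegral_map hF (hdA A), lintegral_withDensity_eq_lintegral_mul _ (hw A)
      (g := fun c : S1 => F (dir (A c))) (hF.comp (hdA A))]
    exact lintegral_congr fun c => mul_comm _ _
  have hμs : ∀ (A : E2 ≃L[ℝ] E2) (s : Set S1), MeasurableSet s → μ A s =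
      (volume : Measure E2) {y | y ≠ 0 ∧ ‖A y‖ < 1 ∧ dir (A y) ∈ s} := by
    intro A s hs
    rw [volume_sector A hs, ← hμ A _ (measurable_one.indicator hs), lintegral_indicator_one hs]
  have hμ1 : μ A = μ (ContinuousLinearEquiv.refl ℝ E2) := by
    ext s hs
    rw [hμs A s hs, hμs _ s hs]
    have h1 := Measure.addHaar_preimage_linearMap (volume : Measure E2)
      (f := (A : E2 →ₗ[ℝ] E2)) (by intro h; rw [h, abs_zero] at hA; exact zero_ne_one hA)
      {y | y ≠ 0 ∧ ‖y‖ < 1 ∧ dir y ∈ s}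
    rw [abs_inv, hA, inv_one, ENNReal.ofReal_one, one_mul] at h1
    refine Eq.trans ?_ h1
    congr 1
    ext y
    simp
  have h1 := hμ A F hF
  rw [hμ1, hμ _ F hF] at h1
  have hn : ∀ c : S1, ‖(c : E2)‖ = 1 := fun c => mem_sphere_zero_iff_norm.1 c.2
  simp only [ContinuousLinearEquiv.refl_apply, dir_coe, hn] at h1
  have h2 : ∀ t : ℝ, ENNReal.ofReal (t ^ 2) = ENNReal.ofReal (t ^ 2 / 2) * 2 := fun t => by
    rw [show (2 : ENNReal) = ENNReal.ofReal 2 by simp, ← ENNReal.ofReal_mul (by positivity)]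
    congr 1
    ring
  rw [circleLaw, uniformSphere, lintegral_smul_measure, lintegral_smul_measure]
  congr 1
  have h3 : ∫⁻ c, F c ∂(volume : Measure E2).toSphere =
      ∫⁻ c : S1, F c * ENNReal.ofReal ((1 : ℝ)⁻¹ ^ 2 / 2) * 2 ∂(volume : Measure E2).toSphere := by
    refine lintegral_congr fun c => ?_
    rw [mul_assoc, ← h2]
    simp
  rw [h3, lintegral_mul_const _ (by fun_prop), h1, ← lintegral_mul_const]
  · refine lintegral_congr fun c => ?_
    rw [h2, mul_assoc]
  · exact (hF.comp (hdA A)).mul (hw A)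

/-! #### The fibrewise differential -/

/-- `planeVec` as a linear map. -/
def planeLin : E2 →ₗ[ℝ] E3 where
  toFun := planeVec
  map_add' x y := by ext i; fin_cases i <;> simp [planeVec]
  map_smul' c x := by ext i; fin_cases i <;> simp [planeVec]

/-- The projection to the plane orthogonal to the standard point. -/
def planeProj : E3 →ₗ[ℝ] E2 where
  toFun y := !₂[y 1, y 2]
  map_add' x y := by ext i; fin_cases i <;> simp
  map_smul' c x := by ext i; fin_cases i <;> simp

theorem planeVec_planeProj {y : E3} (hy : y 0 = 0) : planeVec (planeProj y) = y := by
  ext i; fin_cases i <;> simp [planeProj, planeVec, hy]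

/-- The frame used to trivialize the tangent bundle. -/
def fr (x : S2) : SO3 := frame (unitField x)

theorem fr_smul_e0 (x : S2) : fr x • e0 = x := frame_smul_e0 _

/-- The differential of the homogeneous extension, in the chosen frames. -/
def frameDeriv (h : Diff) (x : S2) : E3 →ₗ[ℝ] E3 :=
  ((rotLin (fr (h x))).symm.toLinearEquiv : E3 →ₗ[ℝ] E3) ∘ₗ
    (dext h x : E3 →ₗ[ℝ] E3) ∘ₗ ((rotLin (fr x)).toLinearEquiv : E3 →ₗ[ℝ] E3)

theorem frameDeriv_apply (h : Diff) (x : S2) (y : E3) :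
    frameDeriv h x y = (rotLin (fr (h x))).symm (dext h x (rotVec (fr x) y)) := rfl

theorem abs_det_frameDeriv (h : Diff) (x : S2) :
    |LinearMap.det (frameDeriv h x)| = absDet h x := by
  rw [frameDeriv, LinearMap.det_comp, LinearMap.det_comp, abs_mul, abs_mul,
    abs_det_linearIsometryEquiv, abs_det_linearIsometryEquiv, one_mul, mul_one]
  rfl

theorem frameDeriv_e0 (h : Diff) (x : S2) : frameDeriv h x e0 = e0 := by
  have h1 : rotVec (fr x) e0 = x := congrArg Subtype.val (fr_smul_e0 x)
  have h2 : rotLin (fr (h x)) e0 = h x := congrArg Subtype.val (fr_smul_e0 (h x))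
  rw [frameDeriv_apply, h1, dext_self h (S2.coe_ne_zero x), ext_coe, ← h2,
    LinearIsometryEquiv.symm_apply_apply]

theorem inner_dext (h : Diff) (x : S2) {v : E3} (hv : inner ℝ (x : E3) v = 0) :
    inner ℝ (h x : E3) (dext h x v) = 0 := by
  have h1 := coe_tangentMap h x ⟨v, mem_tangentPlane_iff.2 hv⟩
  rw [← h1]
  exact mem_tangentPlane_iff.1 (Subtype.property _)

theorem frameDeriv_planeVec (h : Diff) (x : S2) (c : E2) :
    frameDeriv h x (planeVec c) 0 = 0 := by
  have h2 : rotLin (fr (h x)) e0 = h x := congrArg Subtype.val (fr_smul_e0 (h x))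
  have h1 : rotVec (fr x) e0 = x := congrArg Subtype.val (fr_smul_e0 x)
  have h3 : inner ℝ (e0 : E3) (frameDeriv h x (planeVec c)) = 0 := by
    rw [frameDeriv_apply, ← (rotLin (fr (h x))).inner_map_map,
      LinearIsometryEquiv.apply_symm_apply, h2]
    apply inner_dext
    rw [← h1, inner_rotVec]
    simp [E3.inner_eq, e0, planeVec]
  simpa [E3.inner_eq, e0] using h3

/-- The differential as an endomorphism of the plane, in the chosen frames. -/
def planeDeriv (h : Diff) (x : S2) : E2 →ₗ[ℝ] E2 := planeProj ∘ₗ frameDeriv h x ∘ₗ planeLin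

theorem planeVec_planeDeriv (h : Diff) (x : S2) (c : E2) :
    planeVec (planeDeriv h x c) = frameDeriv h x (planeVec c) :=
  planeVec_planeProj (frameDeriv_planeVec h x c)

/-- In adapted frames the spatial derivative fixes the radial vector and maps the orthogonal plane
to itself, so its matrix is block diagonal with a one in the corner. -/
theorem abs_det_planeDeriv (h : Diff) (x : S2) :
    |LinearMap.det (planeDeriv h x)| = absDet h x := by
  rw [← abs_det_frameDeriv]
  congr 1
  let b3 := (EuclideanSpace.basisFun (Fin 3) ℝ).toBasis
  let b2 := (EuclideanSpace.basisFun (Fin 2) ℝ).toBasis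
  rw [← LinearMap.det_toMatrix b2, ← LinearMap.det_toMatrix b3, Matrix.det_fin_two,
    Matrix.det_fin_three]
  have e3 : ∀ i j, LinearMap.toMatrix b3 b3 (frameDeriv h x) i j =
      frameDeriv h x (EuclideanSpace.single j 1) i := fun i j => by
    simp [LinearMap.toMatrix_apply, b3]
  have e2 : ∀ i j, LinearMap.toMatrix b2 b2 (planeDeriv h x) i j =
      planeDeriv h x (EuclideanSpace.single j 1) i := fun i j => by
    simp [LinearMap.toMatrix_apply, b2]
  simp only [e3, e2]
  have p0 : planeVec (EuclideanSpace.single 0 1) = EuclideanSpace.single 1 1 := by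
    ext i; fin_cases i <;> simp [planeVec]
  have p1 : planeVec (EuclideanSpace.single 1 1) = EuclideanSpace.single 2 1 := by
    ext i; fin_cases i <;> simp [planeVec]
  have q0 : frameDeriv h x (EuclideanSpace.single 0 1) = EuclideanSpace.single 0 1 :=
    frameDeriv_e0 h x
  have q1 := frameDeriv_planeVec h x (EuclideanSpace.single 0 1)
  have q2 := frameDeriv_planeVec h x (EuclideanSpace.single 1 1)
  rw [p0] at q1
  rw [p1] at q2
  have r : ∀ c, planeDeriv h x c = planeProj (frameDeriv h x (planeVec c)) := fun _ => rfl
  rw [r, r, p0, p1, q0, q1, q2]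
  simp [planeProj]

theorem triv_snd (x : S2) (c : S1) : (triv (x, c)).1.2 = rotVec (fr x) (planeVec c) := rfl

theorem dext_triv (h : Diff) (x : S2) (c : S1) :
    dext h x (triv (x, c)).1.2 = rotVec (fr (h x)) (planeVec (planeDeriv h x c)) := by
  rw [planeVec_planeDeriv, frameDeriv_apply, ← rotLin_apply (fr (h x)),
    LinearIsometryEquiv.apply_symm_apply]
  rfl

theorem stretch1_triv (h : Diff) (x : S2) (c : S1) :
    stretch1 h (triv (x, c)) = ‖planeDeriv h x c‖ := by
  rw [stretch1_eq, triv_fst, dext_triv, norm_rotVec, norm_planeVec]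

theorem planeDeriv_ne_zero (h : Diff) (x : S2) (c : S1) : planeDeriv h x c ≠ 0 := by
  rw [← norm_pos_iff, ← stretch1_triv]
  exact stretch1_pos h _

theorem sharp1_triv (h : Diff) (x : S2) (c : S1) :
    sharp1 h (triv (x, c)) = triv (h x, dir (planeDeriv h x c)) := by
  refine T1S2.ext' (by rw [sharp1_fst, triv_fst, triv_fst]) ?_
  rw [sharp1_snd, stretch1_triv, triv_fst, dext_triv, triv_snd, coe_dir (planeDeriv_ne_zero h x c)]
  have h1 : ∀ (t : ℝ) (c : E2), planeVec (t • c) = t • planeVec c := fun t c =>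
    map_smul planeLin t c
  rw [h1, ← rotLin_apply, ← rotLin_apply, map_smul]

/-- The change of variables formula for the action on unit tangent vectors. -/
theorem lintegral_sharp1 (h : Diff) (hp : MeasurePreserving h area area) {F : T1S2 → ENNReal}
    (hF : Measurable F) :
    ∫⁻ u, F (sharp1 h u) * ENNReal.ofReal ((stretch1 h u)⁻¹ ^ 2) ∂liouville1 =
      ∫⁻ u, F u ∂liouville1 := by
  have hG : Measurable fun u => F (sharp1 h u) * ENNReal.ofReal ((stretch1 h u)⁻¹ ^ 2) :=
    (hF.comp (continuous_sharp1 h).measurable).mul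
      (((continuous_stretch1 h).measurable.inv).pow_const 2).ennreal_ofReal
  have hI : Measurable fun x => ∫⁻ c, F (triv (x, c)) ∂circleLaw :=
    (hF.comp measurable_triv).lintegral_prod_right'
  rw [← measurePreserving_triv.lintegral_comp hG, ← measurePreserving_triv.lintegral_comp hF,
    lintegral_prod (fun p => F (sharp1 h (triv p)) * ENNReal.ofReal ((stretch1 h (triv p))⁻¹ ^ 2))
      (hG.comp measurable_triv).aemeasurable,
    lintegral_prod (fun p => F (triv p)) (hF.comp measurable_triv).aemeasurable,
    ← hp.lintegral_comp hI]
  refine lintegral_congr fun x => ?_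
  have hdet : |LinearMap.det (planeDeriv h x)| = 1 := by
    rw [abs_det_planeDeriv, absDet_eq_one h hp]
  have hdet0 : LinearMap.det (planeDeriv h x) ≠ 0 := by
    intro h0
    rw [h0, abs_zero] at hdet
    exact zero_ne_one hdet
  let A : E2 ≃L[ℝ] E2 := ((planeDeriv h x).equivOfDetNeZero hdet0).toContinuousLinearEquiv
  have hA : ∀ c, A c = planeDeriv h x c := fun _ => rfl
  -- The base was handled by the invariance of area; on each fibre only an area-preserving linear
  -- map acting on directions remains.
  refine Eq.trans ?_ (lintegral_dir_mul A hdet (hF.comp (measurable_triv_left (h x))))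
  simp only [sharp1_triv, stretch1_triv, hA]

end DiffusedSphere
end

noncomputable section

namespace DiffusedSphere

/-! ### Averaging over a ball of rotations -/

theorem SO3.angle_inv (g : SO3) : SO3.angle g⁻¹ = SO3.angle g := by
  rw [SO3.angle, SO3.angle, SO3.coe_inv, Matrix.trace_transpose]

theorem SO3.angle_conj (g k : SO3) : SO3.angle (k * g * k⁻¹) = SO3.angle g := by
  have h : ((k * g * k⁻¹ : SO3) : Matrix (Fin 3) (Fin 3) ℝ).trace =
      (g : Matrix (Fin 3) (Fin 3) ℝ).trace := by
    change ((k : Matrix (Fin 3) (Fin 3) ℝ) * (g : Matrix (Fin 3) (Fin 3) ℝ) *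
      ((k⁻¹ : SO3) : Matrix (Fin 3) (Fin 3) ℝ)).trace = _
    rw [Matrix.trace_mul_comm, ← Matrix.mul_assoc, SO3.coe_inv, SO3.transpose_mul, Matrix.one_mul]
  rw [SO3.angle, SO3.angle, h]

theorem one_mem_rotBall {δ : ℝ} (hδ : 0 < δ) : (1 : SO3) ∈ rotBall δ := by
  have h : ((1 : Matrix (Fin 3) (Fin 3) ℝ).trace - 1) / 2 = 1 := by
    simp [Matrix.trace_one]; norm_num
  simpa only [rotBall, SO3.angle, Set.mem_ofPred_eq, Submonoid.coe_one, h, Real.arccos_one]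

theorem inv_mem_rotBall {δ : ℝ} {g : SO3} : g⁻¹ ∈ rotBall δ ↔ g ∈ rotBall δ := by
  simp only [rotBall, Set.mem_ofPred_eq, SO3.angle_inv]

theorem conj_mem_rotBall {δ : ℝ} {g : SO3} (k : SO3) :
    k * g * k⁻¹ ∈ rotBall δ ↔ g ∈ rotBall δ := by
  simp only [rotBall, Set.mem_ofPred_eq, SO3.angle_conj]

theorem measurableSet_rotBall (δ : ℝ) : MeasurableSet (rotBall δ) :=
  (isOpen_rotBall δ).measurableSet

theorem haarProb_rotBall_ne_zero {δ : ℝ} (hδ : 0 < δ) : haarProb (rotBall δ) ≠ 0 :=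
  (isOpen_rotBall δ).measure_ne_zero _ ⟨1, one_mem_rotBall hδ⟩

theorem measurePreserving_uniformBall {δ : ℝ} {f : SO3 → SO3}
    (hf : MeasurePreserving f haarProb haarProb) (hU : f ⁻¹' rotBall δ = rotBall δ) :
    MeasurePreserving f (uniformBall δ) (uniformBall δ) := by
  rw [uniformBall_eq]
  refine ⟨hf.measurable, ?_⟩
  rw [ProbabilityTheory.cond, Measure.map_smul]
  congr 1
  have := (hf.restrict_preimage (measurableSet_rotBall δ)).map_eq
  rwa [hU] at this

theorem measurePreserving_inv_uniformBall (δ : ℝ) :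
    MeasurePreserving (fun g : SO3 => g⁻¹) (uniformBall δ) (uniformBall δ) :=
  measurePreserving_uniformBall measurePreserving_inv_haarProb
    (Set.ext fun _ => inv_mem_rotBall)

theorem measurePreserving_conj_uniformBall (δ : ℝ) (k : SO3) :
    MeasurePreserving (fun g : SO3 => k * g * k⁻¹) (uniformBall δ) (uniformBall δ) :=
  measurePreserving_uniformBall ((measurePreserving_mul_right_haarProb k⁻¹).comp
    (measurePreserving_mul_left_haarProb k)) (Set.ext fun _ => conj_mem_rotBall k)

theorem integral_uniformBall {δ : ℝ} (F : SO3 → ℝ) :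
    ∫ g, F g ∂uniformBall δ = (haarProb.real (rotBall δ))⁻¹ *
      ∫ g, (rotBall δ).indicator F g ∂haarProb := by
  rw [uniformBall_eq, ProbabilityTheory.cond, integral_smul_measure,
    integral_indicator (measurableSet_rotBall δ), ENNReal.toReal_inv]
  rfl

/-- Convolution with the uniform law on a ball of rotations, on the rotation group. -/
def groupConv (δ : ℝ) (F : SO3 → ℝ) (k : SO3) : ℝ := ∫ g, F (g⁻¹ * k) ∂uniformBall δ

/-- Left invariance moves `k` from the argument of `F` into the ball. The dependence on `k` is now
through translates of a fixed set, so no regularity of `F` is needed. -/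
theorem groupConv_eq (δ : ℝ) (F : SO3 → ℝ) (k : SO3) :
    groupConv δ F k = (haarProb.real (rotBall δ))⁻¹ *
      ∫ g, ((fun g => k * g) ⁻¹' rotBall δ).indicator (fun g => F g⁻¹) g ∂haarProb := by
  rw [groupConv, integral_uniformBall]
  congr 1
  rw [← integral_mul_left_eq_self _ k]
  congr 1
  funext g
  simp only [Set.indicator, Set.mem_preimage]
  congr 1
  simp

theorem abs_groupConv_sub_le {δ : ℝ} {F : SO3 → ℝ} {C : ℝ} (hF : Measurable F)
    (hC : ∀ k, |F k| ≤ C) (k k' : SO3) :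
    |groupConv δ F k - groupConv δ F k'| ≤ (haarProb.real (rotBall δ))⁻¹ * (C *
      haarProb.real (symmDiff ((fun g => k * g) ⁻¹' rotBall δ) ((fun g => k' * g) ⁻¹' rotBall δ)))
      := by
  have hm : ∀ k : SO3, MeasurableSet ((fun g => k * g) ⁻¹' rotBall δ) := fun k =>
    (continuous_const_mul k).measurable (measurableSet_rotBall δ)
  have hF' : Measurable fun g : SO3 => F g⁻¹ := hF.comp continuous_inv.measurable
  have hi : Integrable (fun g : SO3 => F g⁻¹) haarProb :=
    integrable_of_abs_le hF' fun g => hC _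
  rw [groupConv_eq, groupConv_eq, ← mul_sub, abs_mul, abs_of_nonneg (by positivity)]
  refine mul_le_mul_of_nonneg_left ?_ (by positivity)
  rw [← integral_sub (hi.indicator (hm k)) (hi.indicator (hm k'))]
  refine (abs_integral_le_integral_abs).trans ?_
  have hs : MeasurableSet (symmDiff ((fun g => k * g) ⁻¹' rotBall δ)
      ((fun g => k' * g) ⁻¹' rotBall δ)) := (hm k).symmDiff (hm k')
  have h2 : C * haarProb.real (symmDiff ((fun g => k * g) ⁻¹' rotBall δ)
      ((fun g => k' * g) ⁻¹' rotBall δ)) = ∫ g, (symmDiff ((fun g => k * g) ⁻¹' rotBall δ)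
      ((fun g => k' * g) ⁻¹' rotBall δ)).indicator (fun _ => C) g ∂haarProb := by
    rw [integral_indicator_const C hs, smul_eq_mul, mul_comm]
  rw [h2]
  refine integral_mono ((hi.indicator (hm k)).sub (hi.indicator (hm k'))).abs
    ((integrable_const C).indicator hs) fun g => ?_
  have hC0 : 0 ≤ C := (abs_nonneg _).trans (hC 1)
  by_cases h3 : g ∈ (fun g => k * g) ⁻¹' rotBall δ <;>
    by_cases h4 : g ∈ (fun g => k' * g) ⁻¹' rotBall δ <;>
      simp [Set.indicator, Set.mem_symmDiff, h3, h4, hC]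

theorem tendsto_symmDiff_rotBall (δ : ℝ) (k : SO3) :
    Tendsto (fun k' : SO3 => haarProb.real
      (symmDiff ((fun g => k' * g) ⁻¹' rotBall δ) ((fun g => k * g) ⁻¹' rotBall δ)))
      (𝓝 k) (𝓝 0) := by
  let f : C(SO3, C(SO3, SO3)) := ContinuousMap.curry ⟨fun p : SO3 × SO3 => p.1 * p.2,
    continuous_mul⟩
  have h := tendsto_measure_symmDiff_preimage_nhds_zero (μ := haarProb) (ν := haarProb)
    (s := rotBall δ) (f.continuous.tendsto k)
    (Eventually.of_forall fun k' => measurePreserving_mul_left_haarProb k')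
    (measurePreserving_mul_left_haarProb k) (measurableSet_rotBall δ).nullMeasurableSet
    (measure_ne_top _ _)
  have h2 := (ENNReal.tendsto_toReal ENNReal.zero_ne_top).comp h
  exact h2

/-- Nearby translates of the ball differ by a set of small Haar measure, by continuity of
translation in measure. -/
theorem continuous_groupConv {δ : ℝ} {F : SO3 → ℝ} {C : ℝ} (hF : Measurable F)
    (hC : ∀ k, |F k| ≤ C) : Continuous (groupConv δ F) := by
  rw [continuous_iff_continuousAt]
  intro k
  rw [ContinuousAt, tendsto_iff_dist_tendsto_zero]
  have h1 := (((tendsto_symmDiff_rotBall δ k).const_mul C).const_mul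
    ((haarProb.real (rotBall δ))⁻¹))
  rw [mul_zero, mul_zero] at h1
  refine squeeze_zero (fun _ => dist_nonneg) (fun k' => ?_) h1
  rw [Real.dist_eq]
  exact abs_groupConv_sub_le hF hC k' k

/-- Convolution with the uniform law on a ball of rotations, on the unit tangent bundle. -/
def conv (δ : ℝ) (ψ : T1S2 → ℝ) (u : T1S2) : ℝ := ∫ g : SO3, ψ (g⁻¹ • u) ∂uniformBall δ

theorem conv_eq_groupConv (δ : ℝ) (ψ : T1S2 → ℝ) (u : T1S2) :
    conv δ ψ u = groupConv δ (fun k => ψ (k • u0)) (frame u) := by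
  simp only [conv, groupConv, mul_smul, frame_smul_u0]

theorem continuous_conv {δ : ℝ} {ψ : T1S2 → ℝ} {C : ℝ} (hψ : Measurable ψ)
    (hC : ∀ u, |ψ u| ≤ C) : Continuous (conv δ ψ) := by
  rw [show conv δ ψ = _ from funext (conv_eq_groupConv δ ψ)]
  exact (continuous_groupConv (hψ.comp continuous_smul_u0.measurable)
    (fun k => hC (k • u0))).comp continuous_frame

/-- The orbit map `k ↦ k • e0` is a quotient map because the group is compact, so continuity may be
checked on the group. Symmetry of the ball under inversion matches the convention of `groupConv`. -/
theorem continuous_integral_smul_S2 {δ : ℝ} {f : S2 → ℝ} {C : ℝ} (hf : Measurable f)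
    (hC : ∀ x, |f x| ≤ C) : Continuous fun x : S2 => ∫ g : SO3, f (g • x) ∂uniformBall δ := by
  have hq : Continuous fun k : SO3 => k • e0 :=
    continuous_smul.comp (continuous_id.prodMk continuous_const)
  have hquot : IsQuotientMap fun k : SO3 => k • e0 :=
    hq.isClosedMap.isQuotientMap hq exists_smul_e0
  rw [hquot.continuous_iff]
  have h1 := continuous_groupConv (δ := δ) (F := fun k => f (k • e0)) (C := C)
    (hf.comp hq.measurable) (fun k => hC _)
  convert h1 using 1
  funext k
  have h2 := (measurePreserving_inv_uniformBall δ).integral_comp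
    (MeasurableEquiv.inv SO3).measurableEmbedding (fun g => f (g • k • e0))
  simp only [Function.comp_apply, groupConv, mul_smul]
  exact h2.symm

/-! ### The transfer operator on densities. -/

/-- The density of the image of a measure with density `φ` under the action on unit tangent
vectors. -/
def pushDensity (h : Diff) (φ : T1S2 → ℝ) (u : T1S2) : ℝ :=
  φ (sharp1 h.symm u) * (stretch1 h.symm u)⁻¹ ^ 2

theorem pushDensity_sharp1 (h : Diff) (φ : T1S2 → ℝ) (u : T1S2) :
    pushDensity h φ (sharp1 h u) = φ u * stretch1 h u ^ 2 := by
  rw [pushDensity, sharp1_symm_sharp1, stretch1_symm, inv_inv]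

theorem pushDensity_nonneg (h : Diff) {φ : T1S2 → ℝ} (hφ : ∀ u, 0 ≤ φ u) (u : T1S2) :
    0 ≤ pushDensity h φ u := mul_nonneg (hφ _) (sq_nonneg _)

theorem measurable_pushDensity (h : Diff) {φ : T1S2 → ℝ} (hφ : Measurable φ) :
    Measurable (pushDensity h φ) :=
  (hφ.comp (continuous_sharp1 _).measurable).mul
    (((continuous_stretch1 _).measurable.inv).pow_const 2)

theorem continuous_pushDensity (h : Diff) {φ : T1S2 → ℝ} (hφ : Continuous φ) :
    Continuous (pushDensity h φ) :=
  (hφ.comp (continuous_sharp1 _)).mul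
    (((continuous_stretch1 _).inv₀ fun u => (stretch1_pos _ u).ne').pow 2)

theorem exists_abs_le_of_continuous {f : T1S2 → ℝ} (hf : Continuous f) : ∃ C, ∀ u, |f u| ≤ C := by
  obtain ⟨C, hC⟩ := (isCompact_range hf).isBounded.exists_norm_le
  exact ⟨C, fun u => hC _ ⟨u, rfl⟩⟩

theorem exists_abs_pushDensity_le (h : Diff) {φ : T1S2 → ℝ} {C : ℝ} (hC : ∀ u, |φ u| ≤ C) :
    ∃ C', ∀ u, |pushDensity h φ u| ≤ C' := by
  obtain ⟨D, hD⟩ := exists_abs_le_of_continuous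
    (((continuous_stretch1 h.symm).inv₀ fun u => (stretch1_pos _ u).ne').pow 2)
  refine ⟨C * D, fun u => ?_⟩
  rw [pushDensity, abs_mul]
  exact mul_le_mul (hC _) (hD u) (abs_nonneg _) ((abs_nonneg _).trans (hC u))

theorem lintegral_pushDensity (h : Diff) (hp : MeasurePreserving h area area) {φ : T1S2 → ℝ}
    (hφ : Measurable φ) {F : T1S2 → ENNReal} (hF : Measurable F) :
    ∫⁻ u, F (sharp1 h u) * ENNReal.ofReal (φ u) ∂liouville1 =
      ∫⁻ u, F u * ENNReal.ofReal (pushDensity h φ u) ∂liouville1 := by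
  rw [← lintegral_sharp1 h hp (F := fun u => F u * ENNReal.ofReal (pushDensity h φ u))
    (hF.mul (measurable_pushDensity h hφ).ennreal_ofReal)]
  refine lintegral_congr fun u => ?_
  rw [pushDensity_sharp1, mul_assoc, ← ENNReal.ofReal_mul' (by positivity), mul_assoc, ← mul_pow,
    mul_inv_cancel₀ (stretch1_pos h u).ne', one_pow, mul_one]

theorem ofReal_conv {δ : ℝ} (hδ : 0 < δ) {ψ : T1S2 → ℝ} {C : ℝ} (hψ : Measurable ψ)
    (h0 : ∀ u, 0 ≤ ψ u) (hC : ∀ u, |ψ u| ≤ C) (u : T1S2) :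
    ENNReal.ofReal (conv δ ψ u) = ∫⁻ g : SO3, ENNReal.ofReal (ψ (g⁻¹ • u)) ∂uniformBall δ := by
  have := isProbabilityMeasure_uniformBall hδ
  have hm : Measurable fun g : SO3 => ψ (g⁻¹ • u) := by
    have h1 : Continuous fun g : SO3 => g⁻¹ • u :=
      continuous_smul.comp (continuous_inv.prodMk continuous_const)
    exact hψ.comp h1.measurable
  exact ofReal_integral_eq_lintegral_ofReal (integrable_of_abs_le hm fun g => hC _)
    (Eventually.of_forall fun g => h0 _)

theorem measurable_inv_smul : Measurable fun p : SO3 × T1S2 => p.1⁻¹ • p.2 :=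
  (continuous_smul.comp ((continuous_inv.comp continuous_fst).prodMk continuous_snd)).measurable

theorem measurable_smul' : Measurable fun p : SO3 × T1S2 => p.1 • p.2 :=
  continuous_smul.measurable

/-- The random process transforms densities by `φ ↦ conv δ (pushDensity h φ)`. -/
theorem lintegral_smul_sharp1 {δ : ℝ} (hδ : 0 < δ) (h : Diff)
    (hp : MeasurePreserving h area area) {φ : T1S2 → ℝ} {C : ℝ} (hφ : Measurable φ)
    (h0 : ∀ u, 0 ≤ φ u) (hC : ∀ u, |φ u| ≤ C) {F : T1S2 → ENNReal} (hF : Measurable F) :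
    ∫⁻ u, (∫⁻ g : SO3, F (g • sharp1 h u) ∂uniformBall δ) * ENNReal.ofReal (φ u) ∂liouville1 =
      ∫⁻ u, F u * ENNReal.ofReal (conv δ (pushDensity h φ) u) ∂liouville1 := by
  have := isProbabilityMeasure_uniformBall hδ
  obtain ⟨C', hC'⟩ := exists_abs_pushDensity_le h hC
  set ψ := pushDensity h φ with hψ
  have hψm : Measurable ψ := measurable_pushDensity h hφ
  have hFm : Measurable fun p : SO3 × T1S2 => F (p.1 • p.2) := hF.comp measurable_smul'
  have hψ2 : Measurable fun p : SO3 × T1S2 => ENNReal.ofReal (ψ (p.1⁻¹ • p.2)) :=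
    (hψm.comp measurable_inv_smul).ennreal_ofReal
  have hswap : ∀ G : SO3 × T1S2 → ENNReal, Measurable G →
      ∫⁻ g : SO3, ∫⁻ u, F u * G (g, u) ∂liouville1 ∂uniformBall δ =
      ∫⁻ u, ∫⁻ g : SO3, F u * G (g, u) ∂uniformBall δ ∂liouville1 := by
    intro G hG
    have h3 : Measurable fun p : SO3 × T1S2 => F p.2 * G p := (hF.comp measurable_snd).mul hG
    exact lintegral_lintegral_swap h3.aemeasurable
  rw [lintegral_pushDensity h hp hφ (F := fun u => ∫⁻ g : SO3, F (g • u) ∂uniformBall δ)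
    hFm.lintegral_prod_left']
  calc ∫⁻ u, (∫⁻ g : SO3, F (g • u) ∂uniformBall δ) * ENNReal.ofReal (ψ u) ∂liouville1
      = ∫⁻ u, ∫⁻ g : SO3, F (g • u) * ENNReal.ofReal (ψ u) ∂uniformBall δ ∂liouville1 := by
        refine lintegral_congr fun u => (lintegral_mul_const _ ?_).symm
        exact hFm.comp measurable_prodMk_right
    _ = ∫⁻ g : SO3, ∫⁻ u, F (g • u) * ENNReal.ofReal (ψ u) ∂liouville1 ∂uniformBall δ := by
        have hs : Measurable fun p : T1S2 × SO3 => p.2 • p.1 := measurable_smul'.comp measurable_swap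
        have h3 : Measurable fun p : T1S2 × SO3 => F (p.2 • p.1) * ENNReal.ofReal (ψ p.1) :=
          Measurable.mul (hF.comp hs) (hψm.comp measurable_fst).ennreal_ofReal
        exact lintegral_lintegral_swap h3.aemeasurable
    _ = ∫⁻ g : SO3, ∫⁻ u, F u * ENNReal.ofReal (ψ (g⁻¹ • u)) ∂liouville1 ∂uniformBall δ := by
        refine lintegral_congr fun g => ?_
        have hg : Measurable fun u : T1S2 => ψ (g⁻¹ • u) :=
          hψm.comp (continuous_const_smul g⁻¹).measurable
        have h3 := (measurePreserving_smul_liouville1 g).lintegral_comp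
          (f := fun u => F u * ENNReal.ofReal (ψ (g⁻¹ • u))) (hF.mul hg.ennreal_ofReal)
        simp only [inv_smul_smul] at h3
        exact h3
    _ = ∫⁻ u, ∫⁻ g : SO3, F u * ENNReal.ofReal (ψ (g⁻¹ • u)) ∂uniformBall δ ∂liouville1 := by
        exact hswap _ hψ2
    _ = _ := by
        refine lintegral_congr fun u => ?_
        have hu : Continuous fun g : SO3 => g⁻¹ • u :=
          continuous_smul.comp (continuous_inv.prodMk continuous_const)
        have hu2 : Measurable fun g : SO3 => ψ (g⁻¹ • u) := hψm.comp hu.measurable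
        rw [lintegral_const_mul _ hu2.ennreal_ofReal, ofReal_conv hδ hψm
          (pushDensity_nonneg h h0) hC' u]

theorem measurable_act (h : Diff) :
    Measurable (Function.uncurry fun (g : SO3) (u : T1S2) => sharp1 (coset h g) u) := by
  have h1 : (Function.uncurry fun (g : SO3) (u : T1S2) => sharp1 (coset h g) u) =
      (fun p : SO3 × T1S2 => p.1 • p.2) ∘ Prod.map id (sharp1 h) := by
    funext p
    exact sharp1_coset h p.1 p.2
  rw [h1]
  exact measurable_smul'.comp (measurable_id.prodMap (continuous_sharp1 h).measurable)

/-- A stationary probability measure is bounded by a multiple of Liouville measure. -/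
theorem IsStationary.le_liouville1 {δ : ℝ} {h : Diff} {m : Measure T1S2} [IsProbabilityMeasure m]
    (hδ : 0 < δ) (hm : IsStationary (uniformBall δ) (fun g => sharp1 (coset h g)) m) :
    m ≤ (haarProb (rotBall δ))⁻¹ • liouville1 := by
  have := isProbabilityMeasure_uniformBall hδ
  refine Measure.le_iff.2 fun A hA => ?_
  have h1 := hm.lintegral_eq (measurable_act h) (f := A.indicator 1) (measurable_one.indicator hA)
  rw [lintegral_indicator_one hA] at h1
  rw [← h1, Measure.smul_apply, smul_eq_mul]
  -- If `g` ran over the whole group with Haar law, `g • sharp1 h u` would have Liouville law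
  -- whatever `u` is; restricting to the ball costs only the normalizing factor.
  have h2 : ∀ u, ∫⁻ g : SO3, A.indicator 1 (sharp1 (coset h g) u) ∂uniformBall δ ≤
      (haarProb (rotBall δ))⁻¹ * liouville1 A := by
    intro u
    rw [uniformBall_eq, ProbabilityTheory.cond, lintegral_smul_measure, smul_eq_mul]
    refine mul_le_mul_right ?_ _
    refine (lintegral_mono' Measure.restrict_le_self le_rfl).trans ?_
    simp only [sharp1_coset]
    have h3 : ∀ g : SO3, g • sharp1 h u = (g * frame (sharp1 h u)) • u0 := fun g => by
      rw [mul_smul, frame_smul_u0]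
    have hm1 : Measurable fun u => A.indicator (1 : T1S2 → ENNReal) u :=
      measurable_one.indicator hA
    simp only [h3]
    rw [(measurePreserving_mul_right_haarProb (frame (sharp1 h u))).lintegral_comp
      (f := fun g : SO3 => A.indicator (1 : T1S2 → ENNReal) (g • u0))
      (hm1.comp continuous_smul_u0.measurable),
      measurePreserving_smul_u0.lintegral_comp hm1, lintegral_indicator_one hA]
  refine (lintegral_mono h2).trans ?_
  rw [lintegral_const, measure_univ, mul_one]

end DiffusedSphere
end

noncomputable section

namespace DiffusedSphere

/-! ### Rotations about the coordinate axes -/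

/-- The matrix of the rotation about a coordinate axis. -/
def axisMat (i : Fin 3) (t : ℝ) : Matrix (Fin 3) (Fin 3) ℝ :=
  ![!![1, 0, 0; 0, Real.cos t, -Real.sin t; 0, Real.sin t, Real.cos t],
    !![Real.cos t, 0, Real.sin t; 0, 1, 0; -Real.sin t, 0, Real.cos t],
    !![Real.cos t, -Real.sin t, 0; Real.sin t, Real.cos t, 0; 0, 0, 1]] i

theorem axisMat_mem (i : Fin 3) (t : ℝ) :
    axisMat i t ∈ Matrix.specialOrthogonalGroup (Fin 3) ℝ := by
  have h := Real.sin_sq_add_cos_sq t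
  rw [Matrix.mem_specialOrthogonalGroup_iff, Matrix.mem_orthogonalGroup_iff]
  constructor
  · ext j k
    fin_cases i <;> fin_cases j <;> fin_cases k <;>
      simp [axisMat, Matrix.mul_apply, Fin.sum_univ_three] <;>
      first | linear_combination h | ring
  · rw [Matrix.det_fin_three]
    fin_cases i <;> simp [axisMat] <;> linear_combination h

/-- The rotation about a coordinate axis. -/
def axisRot (i : Fin 3) (t : ℝ) : SO3 := ⟨axisMat i t, axisMat_mem i t⟩

theorem axisRot_zero (i : Fin 3) : axisRot i 0 = 1 := by
  apply Subtype.ext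
  ext j k
  fin_cases i <;> fin_cases j <;> fin_cases k <;> simp [axisRot, axisMat]

theorem axisRot_add (i : Fin 3) (s t : ℝ) : axisRot i (s + t) = axisRot i s * axisRot i t := by
  apply Subtype.ext
  change axisMat i (s + t) = axisMat i s * axisMat i t
  ext j k
  fin_cases i <;> fin_cases j <;> fin_cases k <;>
    simp [axisMat, Matrix.mul_apply, Fin.sum_univ_three, Real.sin_add, Real.cos_add] <;> ring

theorem continuous_axisRot (i : Fin 3) : Continuous (axisRot i) := by
  refine Continuous.subtype_mk (continuous_matrix fun j k => ?_) _
  fin_cases i <;> fin_cases j <;> fin_cases k <;> simp [axisMat] <;> fun_prop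

/-- The trace is affine in `cos s` and `sin s`. The amplitude `r` and phase `s₀` are the modulus and
argument of the complex number built from the two coefficients. -/
theorem exists_trace_axisRot_mul (i : Fin 3) (g : SO3) : ∃ a r s₀ : ℝ, 0 ≤ r ∧
    s₀ ∈ Set.Icc (-Real.pi) Real.pi ∧ ∀ s,
      ((axisRot i s * g : SO3) : Matrix (Fin 3) (Fin 3) ℝ).trace = a + r * Real.cos (s - s₀) := by
  have h1 : ∃ a b d : ℝ, ∀ s, ((axisRot i s * g : SO3) : Matrix (Fin 3) (Fin 3) ℝ).trace =
      a + b * Real.cos s + d * Real.sin s := by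
    have hm : ∀ s, ((axisRot i s * g : SO3) : Matrix (Fin 3) (Fin 3) ℝ).trace =
        (axisMat i s * (g : Matrix (Fin 3) (Fin 3) ℝ)).trace := fun _ => rfl
    simp only [hm]
    generalize (g : Matrix (Fin 3) (Fin 3) ℝ) = A
    fin_cases i
    · refine ⟨A 0 0, A 1 1 + A 2 2, A 1 2 - A 2 1, fun s => ?_⟩
      simp [axisMat, Matrix.trace, Matrix.vecMul, dotProduct, Fin.sum_univ_three]
      ring
    · refine ⟨A 1 1, A 0 0 + A 2 2, A 2 0 - A 0 2, fun s => ?_⟩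
      simp [axisMat, Matrix.trace, Matrix.vecMul, dotProduct, Fin.sum_univ_three]
      ring
    · refine ⟨A 2 2, A 0 0 + A 1 1, A 0 1 - A 1 0, fun s => ?_⟩
      simp [axisMat, Matrix.trace, Matrix.vecMul, dotProduct, Fin.sum_univ_three]
      ring
  obtain ⟨a, b, d, h⟩ := h1
  let z : ℂ := ⟨b, d⟩
  refine ⟨a, ‖z‖, z.arg, norm_nonneg _, ⟨(Complex.neg_pi_lt_arg z).le, Complex.arg_le_pi z⟩,
    fun s => ?_⟩
  rw [h, Real.cos_sub]
  have h2 : ‖z‖ * Real.cos z.arg = b := Complex.norm_mul_cos_arg z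
  have h3 : ‖z‖ * Real.sin z.arg = d := Complex.norm_mul_sin_arg z
  linear_combination -Real.cos s * h2 - Real.sin s * h3

/-- Along a monotone function, membership in an upper set changes at most once; the threshold is the
supremum of the points on the lower-parameter side of the change. -/
theorem exists_threshold_of_antitoneOn {f : ℝ → ℝ} {a b : ℝ} (hf : AntitoneOn f (Set.Icc a b))
    {V : Set ℝ} (hV : IsUpperSet V) : ∃ θ, ∀ r ∈ Set.Icc a b, ∀ r' ∈ Set.Icc a b, r ≤ r' →
      ¬ (f r ∈ V ↔ f r' ∈ V) → r ≤ θ ∧ θ ≤ r' := by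
  refine ⟨sSup {r | r ∈ Set.Icc a b ∧ f r ∈ V}, fun r hr r' hr' hrr' hx => ?_⟩
  have h1 : f r' ∈ V → f r ∈ V := fun h => hV (hf hr hr' hrr') h
  have h2 : f r ∈ V ∧ f r' ∉ V := by tauto
  refine ⟨le_csSup ⟨b, fun y hy => hy.1.2⟩ ⟨hr, h2.1⟩, csSup_le ⟨r, hr, h2.1⟩ fun y hy => ?_⟩
  by_contra hlt
  exact h2.2 (hV (hf hr' hy.1 (not_le.1 hlt).le) hy.2)

theorem exists_threshold_of_monotoneOn {f : ℝ → ℝ} {a b : ℝ} (hf : MonotoneOn f (Set.Icc a b))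
    {V : Set ℝ} (hV : IsUpperSet V) : ∃ θ, ∀ r ∈ Set.Icc a b, ∀ r' ∈ Set.Icc a b, r ≤ r' →
      ¬ (f r ∈ V ↔ f r' ∈ V) → r ≤ θ ∧ θ ≤ r' := by
  refine ⟨sSup {r | r ∈ Set.Icc a b ∧ f r ∉ V}, fun r hr r' hr' hrr' hx => ?_⟩
  have h1 : f r ∈ V → f r' ∈ V := fun h => hV (hf hr hr' hrr') h
  have h2 : f r ∉ V ∧ f r' ∈ V := by tauto
  refine ⟨le_csSup ⟨b, fun y hy => hy.1.2⟩ ⟨hr, h2.1⟩, csSup_le ⟨r, hr, h2.1⟩ fun y hy => ?_⟩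
  by_contra hlt
  exact hy.2 (hV (hf hr' hy.1 (not_le.1 hlt).le) h2.2)

theorem cos_monotoneOn_or_antitoneOn (k : ℤ) :
    MonotoneOn Real.cos (Set.Icc (k * Real.pi) ((k + 1) * Real.pi)) ∨
      AntitoneOn Real.cos (Set.Icc (k * Real.pi) ((k + 1) * Real.pi)) := by
  have h1 : ∀ x, Real.cos x = (-1) ^ k * Real.cos (x - k * Real.pi) := fun x => by
    rw [Real.cos_sub_int_mul_pi, ← mul_assoc, ← zpow_add₀ (by norm_num), ← two_mul,
      zpow_mul]
    simp
  have h2 : ∀ x ∈ Set.Icc (k * Real.pi) ((k + 1) * Real.pi), x - k * Real.pi ∈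
      Set.Icc 0 Real.pi := fun x hx => ⟨by linarith [hx.1], by linarith [hx.2]⟩
  have h3 : ∀ x ∈ Set.Icc (k * Real.pi) ((k + 1) * Real.pi),
      ∀ y ∈ Set.Icc (k * Real.pi) ((k + 1) * Real.pi), x ≤ y →
      Real.cos (y - k * Real.pi) ≤ Real.cos (x - k * Real.pi) := fun x hx y hy hxy =>
    Real.strictAntiOn_cos.antitoneOn (h2 x hx) (h2 y hy) (by linarith)
  rcases Int.even_or_odd k with hk | hk
  · right
    intro x hx y hy hxy
    rw [h1 x, h1 y, hk.neg_one_zpow, one_mul, one_mul]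
    exact h3 x hx y hy hxy
  · left
    intro x hx y hy hxy
    rw [h1 x, h1 y, hk.neg_one_zpow]
    linarith [h3 x hx y hy hxy]

/-- On each half-period the cosine is monotone, so membership changes at most once there. If it
differs between `s` and `s + t`, then either that change or the end of the half-period lies between
them. Five half-periods with two intervals of length `t` each give the constant 10. -/
theorem volume_cos_crossing_le {V : Set ℝ} (hV : IsUpperSet V) (a : ℝ) {r : ℝ} (hr : 0 ≤ r)
    {s₀ : ℝ} (hs₀ : s₀ ∈ Set.Icc (-Real.pi) Real.pi) {t : ℝ} (ht : 0 ≤ t) :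
    volume {s ∈ Set.Icc (-Real.pi) Real.pi |
      ¬ (a + r * Real.cos (s + t - s₀) ∈ V ↔ a + r * Real.cos (s - s₀) ∈ V)} ≤
      10 * ENNReal.ofReal t := by
  have hthr : ∀ k : ℤ, ∃ θ, ∀ x ∈ Set.Icc (k * Real.pi) ((k + 1) * Real.pi),
      ∀ y ∈ Set.Icc (k * Real.pi) ((k + 1) * Real.pi), x ≤ y →
      ¬ (a + r * Real.cos x ∈ V ↔ a + r * Real.cos y ∈ V) → x ≤ θ ∧ θ ≤ y := by
    intro k
    rcases cos_monotoneOn_or_antitoneOn k with h | h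
    · exact exists_threshold_of_monotoneOn (fun x hx y hy hxy =>
        add_le_add le_rfl (mul_le_mul_of_nonneg_left (h hx hy hxy) hr)) hV
    · exact exists_threshold_of_antitoneOn (fun x hx y hy hxy =>
        add_le_add le_rfl (mul_le_mul_of_nonneg_left (h hx hy hxy) hr)) hV
  choose θ hθ using hthr
  -- Here `s - s₀` lies in `[-2π, 2π]`; the index 2 serves only the right endpoint.
  let S : Finset ℤ := Finset.Icc (-2) 2
  have hsub : {s ∈ Set.Icc (-Real.pi) Real.pi |
      ¬ (a + r * Real.cos (s + t - s₀) ∈ V ↔ a + r * Real.cos (s - s₀) ∈ V)} ⊆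
      ⋃ k ∈ S, (Set.Icc (θ k + s₀ - t) (θ k + s₀) ∪
        Set.Icc ((k + 1) * Real.pi + s₀ - t) ((k + 1) * Real.pi + s₀)) := by
    rintro s ⟨⟨hs1, hs2⟩, hx⟩
    have hpi := Real.pi_pos
    have hpi3 := Real.pi_gt_three
    obtain ⟨h01, h02⟩ := hs₀
    let k : ℤ := ⌊(s - s₀) / Real.pi⌋
    have hk1 : k * Real.pi ≤ s - s₀ := by
      rw [← le_div_iff₀ hpi]
      exact Int.floor_le _
    have hk2 : s - s₀ < (k + 1) * Real.pi := by
      rw [← div_lt_iff₀ hpi]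
      exact Int.lt_floor_add_one _
    have hk3 : (-2 : ℤ) ≤ k := by
      rw [Int.le_floor, le_div_iff₀ hpi]
      push_cast
      linarith
    have hk4 : k ≤ 2 := by
      have h5 : (k : ℝ) ≤ 2 := by
        by_contra hlt
        push Not at hlt
        have : 2 * Real.pi < k * Real.pi := mul_lt_mul_of_pos_right hlt hpi
        linarith
      exact_mod_cast h5
    refine Set.mem_biUnion (x := k) (Finset.mem_Icc.2 ⟨hk3, hk4⟩) ?_
    by_cases hle : s + t - s₀ ≤ (k + 1) * Real.pi
    · left
      have h6 := hθ k (s - s₀) ⟨hk1, hk2.le⟩ (s + t - s₀) ⟨by linarith, hle⟩ (by linarith)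
        (fun h => hx h.symm)
      exact ⟨by linarith [h6.2], by linarith [h6.1]⟩
    · right
      push Not at hle
      exact ⟨by linarith, by linarith⟩
  refine (measure_mono hsub).trans ((measure_biUnion_finset_le _ _).trans ?_)
  have h7 : ∀ k ∈ S, volume (Set.Icc (θ k + s₀ - t) (θ k + s₀) ∪
        Set.Icc ((k + 1) * Real.pi + s₀ - t) ((k + 1) * Real.pi + s₀)) ≤
        2 * ENNReal.ofReal t := by
    intro k _
    refine (measure_union_le _ _).trans ?_
    rw [Real.volume_Icc, Real.volume_Icc, sub_sub_cancel, sub_sub_cancel, two_mul]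
  refine (Finset.sum_le_card_nsmul S _ _ h7).trans ?_
  have h8 : S.card = 5 := rfl
  rw [h8, nsmul_eq_mul, ← mul_assoc]
  norm_num

theorem mem_rotBall_iff_trace (δ : ℝ) (g : SO3) : g ∈ rotBall δ ↔
    (g : Matrix (Fin 3) (Fin 3) ℝ).trace ∈ {x : ℝ | Real.arccos ((x - 1) / 2) < δ} := Iff.rfl

theorem isUpperSet_trace (δ : ℝ) : IsUpperSet {x : ℝ | Real.arccos ((x - 1) / 2) < δ} := by
  intro x y hxy hx
  exact (Real.antitone_arccos (by linarith)).trans_lt hx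

/-- The boundary of a ball of rotations has finite perimeter. -/
theorem haarProb_symmDiff_rotBall_le (δ : ℝ) (i : Fin 3) {t : ℝ} (ht : 0 ≤ t) :
    haarProb (symmDiff ((fun g => axisRot i t * g) ⁻¹' rotBall δ) (rotBall δ)) ≤
      10 * ENNReal.ofReal t := by
  set S := symmDiff ((fun g => axisRot i t * g) ⁻¹' rotBall δ) (rotBall δ) with hS
  have hSm : MeasurableSet S :=
    ((continuous_const_mul _).measurable (measurableSet_rotBall δ)).symmDiff (measurableSet_rotBall δ)
  have hIm : Measurable (S.indicator (1 : SO3 → ENNReal)) := measurable_one.indicator hSm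
  have hc : Continuous fun p : ℝ × SO3 => axisRot i p.1 * p.2 :=
    ((continuous_axisRot i).comp continuous_fst).mul continuous_snd
  have hpi := Real.pi_pos
  have h1 : ∀ s, haarProb S = ∫⁻ g, S.indicator 1 (axisRot i s * g) ∂haarProb := fun s => by
    rw [(measurePreserving_mul_left_haarProb (axisRot i s)).lintegral_comp hIm,
      lintegral_indicator_one hSm]
  -- By left invariance the measure may be averaged over one turn about the axis; Fubini then
  -- reduces the bound to single orbits of the one-parameter group, where the trace is a cosine.
  have h2 : ENNReal.ofReal (2 * Real.pi) * haarProb S =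
      ∫⁻ s in Set.Icc (-Real.pi) Real.pi, ∫⁻ g, S.indicator 1 (axisRot i s * g) ∂haarProb := by
    rw [← setLIntegral_congr_fun measurableSet_Icc (fun s _ => h1 s), setLIntegral_const,
      Real.volume_Icc, mul_comm, sub_neg_eq_add, two_mul]
  have hsw : Measurable fun p : ℝ × SO3 => S.indicator (1 : SO3 → ENNReal) (axisRot i p.1 * p.2) :=
    hIm.comp hc.measurable
  rw [lintegral_lintegral_swap (f := fun s g => S.indicator (1 : SO3 → ENNReal) (axisRot i s * g))
    hsw.aemeasurable] at h2
  have h3 : ∀ g : SO3, ∫⁻ s in Set.Icc (-Real.pi) Real.pi, S.indicator 1 (axisRot i s * g) ≤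
      10 * ENNReal.ofReal t := by
    intro g
    obtain ⟨a, r, s₀, hr, hs₀, htr⟩ := exists_trace_axisRot_mul i g
    refine le_trans (le_of_eq ?_) (volume_cos_crossing_le (isUpperSet_trace δ) a hr hs₀ ht)
    have hm : MeasurableSet ((fun s => axisRot i s * g) ⁻¹' S) :=
      (hc.comp (continuous_id.prodMk continuous_const)).measurable hSm
    have h4 : (fun s => S.indicator (1 : SO3 → ENNReal) (axisRot i s * g)) =
        ((fun s => axisRot i s * g) ⁻¹' S).indicator 1 := by
      funext s
      rfl
    rw [h4, lintegral_indicator_one hm, Measure.restrict_apply hm]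
    congr 1
    ext s
    have h5 : axisRot i t * (axisRot i s * g) = axisRot i (s + t) * g := by
      rw [← mul_assoc, ← axisRot_add, add_comm]
    simp only [Set.mem_inter_iff, Set.mem_preimage, hS, Set.mem_symmDiff, h5,
      mem_rotBall_iff_trace, htr]
    simp only [Set.mem_ofPred_eq]
    tauto
  have h6 : ENNReal.ofReal (2 * Real.pi) * haarProb S ≤ 10 * ENNReal.ofReal t := by
    rw [h2]
    refine (lintegral_mono h3).trans ?_
    simp
  have h7 : (1 : ENNReal) ≤ ENNReal.ofReal (2 * Real.pi) := by
    rw [ENNReal.one_le_ofReal]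
    linarith [Real.pi_gt_three]
  calc haarProb S = 1 * haarProb S := (one_mul _).symm
    _ ≤ ENNReal.ofReal (2 * Real.pi) * haarProb S := mul_le_mul_left h7 _
    _ ≤ _ := h6

/-- The Lipschitz constant in the smoothing estimate. -/
def smoothConst (δ : ℝ) : ℝ := (haarProb.real (rotBall δ))⁻¹ * 10

/-- After a left translation by `k` the symmetric difference is that of the ball and its rotate, so
the perimeter bound is uniform in `k`. -/
theorem abs_groupConv_axisRot_sub_le {δ : ℝ} {F : SO3 → ℝ} {C : ℝ} (hF : Measurable F)
    (hC : ∀ k, |F k| ≤ C) (i : Fin 3) {t : ℝ} (ht : 0 ≤ t) (k : SO3) :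
    |groupConv δ F (axisRot i t * k) - groupConv δ F k| ≤ smoothConst δ * C * t := by
  have hC0 : 0 ≤ C := (abs_nonneg _).trans (hC 1)
  refine (abs_groupConv_sub_le hF hC _ _).trans ?_
  have h1 : symmDiff ((fun g => axisRot i t * k * g) ⁻¹' rotBall δ)
      ((fun g => k * g) ⁻¹' rotBall δ) = (fun g => k * g) ⁻¹'
      symmDiff ((fun g => axisRot i t * g) ⁻¹' rotBall δ) (rotBall δ) := by
    ext g
    simp [Set.mem_symmDiff, mul_assoc]
  have hSm : MeasurableSet (symmDiff ((fun g => axisRot i t * g) ⁻¹' rotBall δ) (rotBall δ)) :=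
    ((continuous_const_mul _).measurable (measurableSet_rotBall δ)).symmDiff (measurableSet_rotBall δ)
  have h2 : haarProb.real (symmDiff ((fun g => axisRot i t * k * g) ⁻¹' rotBall δ)
      ((fun g => k * g) ⁻¹' rotBall δ)) ≤ 10 * t := by
    rw [h1, measureReal_def, (measurePreserving_mul_left_haarProb k).measure_preimage
      hSm.nullMeasurableSet]
    refine ENNReal.toReal_le_of_le_ofReal (by positivity) ?_
    refine (haarProb_symmDiff_rotBall_le δ i ht).trans (le_of_eq ?_)
    rw [ENNReal.ofReal_mul (by norm_num)]
    simp
  have h3 : smoothConst δ * C * t = (haarProb.real (rotBall δ))⁻¹ * (C * (10 * t)) := by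
    rw [smoothConst]; ring
  rw [h3]
  gcongr

theorem abs_conv_axisRot_sub_le {δ : ℝ} {ψ : T1S2 → ℝ} {C : ℝ} (hψ : Measurable ψ)
    (hC : ∀ u, |ψ u| ≤ C) (i : Fin 3) {t : ℝ} (ht : 0 ≤ t) (u : T1S2) :
    |conv δ ψ (axisRot i t • u) - conv δ ψ u| ≤ smoothConst δ * C * t := by
  rw [conv_eq_groupConv, conv_eq_groupConv, frame_smul]
  exact abs_groupConv_axisRot_sub_le (hψ.comp continuous_smul_u0.measurable)
    (fun k => hC (k • u0)) i ht _

end DiffusedSphere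
end

noncomputable section

namespace DiffusedSphere

/-! ### The retraction onto the unit tangent bundle -/

/-- The unit tangent bundle as a subset of `ℝ³ × ℝ³`. -/
def T1S2.coe (u : T1S2) : E3 × E3 := ((u.1.1 : E3), u.1.2)

theorem T1S2.continuous_coe : Continuous T1S2.coe :=
  (continuous_subtype_val.comp (continuous_fst.comp continuous_subtype_val)).prodMk
    (continuous_snd.comp continuous_subtype_val)

theorem T1S2.coe_injective : Function.Injective T1S2.coe := fun _ _ h =>
  T1S2.ext' (Subtype.ext (congrArg (fun p : E3 × E3 => p.1) h))
    (congrArg (fun p : E3 × E3 => p.2) h)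

/-- The component of the second vector orthogonal to the first, up to scaling. -/
def orthPart (p : E3 × E3) : E3 := ‖p.1‖ ^ 2 • p.2 - (inner ℝ p.1 p.2 : ℝ) • p.1

theorem contDiff_orthPart : ContDiff ℝ ∞ orthPart := by
  unfold orthPart
  exact ((contDiff_fst.norm_sq ℝ).smul contDiff_snd).sub
    ((contDiff_fst.inner ℝ contDiff_snd).smul contDiff_fst)

theorem inner_orthPart (p : E3 × E3) : inner ℝ p.1 (orthPart p) = 0 := by
  rw [orthPart, inner_sub_right, inner_smul_right, inner_smul_right, real_inner_self_eq_norm_sq]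
  ring

/-- Pairs of linearly independent vectors. -/
def indepPairs : Set (E3 × E3) := {p | p.1 ≠ 0 ∧ orthPart p ≠ 0}

theorem isOpen_indepPairs : IsOpen indepPairs :=
  (isOpen_compl_singleton.preimage continuous_fst).inter
    (isOpen_compl_singleton.preimage contDiff_orthPart.continuous)

/-- Orthonormalization of a pair of vectors. -/
def orthonormalize (p : E3 × E3) : E3 × E3 := (‖p.1‖⁻¹ • p.1, ‖orthPart p‖⁻¹ • orthPart p)

theorem contDiffOn_orthonormalize : ContDiffOn ℝ ∞ orthonormalize indepPairs := by
  intro p hp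
  have h1 : ContDiffAt ℝ ∞ orthonormalize p :=
    (((contDiffAt_fst.norm ℝ hp.1).inv (norm_ne_zero_iff.2 hp.1)).smul contDiffAt_fst).prodMk
      (((contDiff_orthPart.contDiffAt.norm ℝ hp.2).inv (norm_ne_zero_iff.2 hp.2)).smul
        contDiff_orthPart.contDiffAt)
  exact h1.contDiffWithinAt

open scoped Classical in
/-- The retraction of a neighbourhood onto the unit tangent bundle. -/
def retr (p : E3 × E3) : T1S2 :=
  if hp : p ∈ indepPairs then
    ⟨(⟨‖p.1‖⁻¹ • p.1, by simp [norm_smul, hp.1]⟩, ‖orthPart p‖⁻¹ • orthPart p), by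
      rw [mem_tangentPlane_iff, inner_smul_left, inner_smul_right, inner_orthPart]; simp, by
      simp [norm_smul, hp.2]⟩
  else u0

theorem coe_retr {p : E3 × E3} (hp : p ∈ indepPairs) : (retr p).coe = orthonormalize p := by
  rw [retr, dif_pos hp]
  rfl

theorem orthPart_coe (u : T1S2) : orthPart u.coe = u.1.2 := by
  simp [orthPart, T1S2.coe, u.inner_eq_zero]

theorem coe_mem_indepPairs (u : T1S2) : u.coe ∈ indepPairs := by
  refine ⟨S2.coe_ne_zero _, ?_⟩
  rw [orthPart_coe, ← norm_ne_zero_iff, u.norm_snd]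
  exact one_ne_zero

@[simp] theorem retr_coe (u : T1S2) : retr u.coe = u := by
  apply T1S2.coe_injective
  rw [coe_retr (coe_mem_indepPairs u), orthonormalize, orthPart_coe, u.norm_snd]
  simp [T1S2.coe]

theorem continuousOn_retr : ContinuousOn retr indepPairs := by
  have h1 : ContinuousOn (fun p => (retr p).coe) indepPairs :=
    contDiffOn_orthonormalize.continuousOn.congr fun p hp => coe_retr hp
  have h2 : IsInducing T1S2.coe := by
    have : IsClosedEmbedding T1S2.coe :=
      T1S2.continuous_coe.isClosedEmbedding T1S2.coe_injective
    exact this.isInducing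
  exact h2.continuousOn_iff.2 h1

/-- The action of a rotation on pairs of vectors. -/
def rotPair (g : SO3) : (E3 × E3) →L[ℝ] (E3 × E3) :=
  ((rotLin g).toContinuousLinearEquiv : E3 →L[ℝ] E3).prodMap
    ((rotLin g).toContinuousLinearEquiv : E3 →L[ℝ] E3)

theorem rotPair_apply (g : SO3) (p : E3 × E3) : rotPair g p = (rotVec g p.1, rotVec g p.2) := rfl

theorem coe_smul (g : SO3) (u : T1S2) : (g • u).coe = rotPair g u.coe := rfl

theorem orthPart_rotPair (g : SO3) (p : E3 × E3) : orthPart (rotPair g p) = rotLin g (orthPart p) := by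
  rw [orthPart, orthPart, map_sub, map_smul, map_smul, rotPair_apply, norm_rotVec, inner_rotVec]
  rfl

theorem rotPair_mem {g : SO3} {p : E3 × E3} (hp : p ∈ indepPairs) : rotPair g p ∈ indepPairs := by
  refine ⟨?_, ?_⟩
  · rw [rotPair_apply, ← norm_ne_zero_iff, norm_rotVec, norm_ne_zero_iff]
    exact hp.1
  · rw [orthPart_rotPair, ← norm_ne_zero_iff, LinearIsometryEquiv.norm_map, norm_ne_zero_iff]
    exact hp.2

/-- Orthonormalization commutes with rotations. Averages over rotations can therefore be
differentiated on an open set of a vector space. -/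
theorem retr_rotPair {g : SO3} {p : E3 × E3} (hp : p ∈ indepPairs) :
    retr (rotPair g p) = g • retr p := by
  apply T1S2.coe_injective
  rw [coe_smul, coe_retr hp, coe_retr (rotPair_mem hp), orthonormalize, orthonormalize,
    orthPart_rotPair, LinearIsometryEquiv.norm_map]
  rw [rotPair_apply, rotPair_apply, norm_rotVec]
  change (_ • rotLin g _, _) = (rotLin g _, rotLin g _)
  rw [map_smul, map_smul]

/-! ### Infinitesimal rotations -/

/-- The generator of the rotations about a coordinate axis. -/
def gen (i : Fin 3) (x : E3) : E3 :=
  ![!₂[0, -x 2, x 1], !₂[x 2, 0, -x 0], !₂[-x 1, x 0, 0]] i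

theorem hasDerivAt_rotVec_axisRot (i : Fin 3) (x : E3) :
    HasDerivAt (fun t => rotVec (axisRot i t) x) (gen i x) 0 := by
  suffices h : ∀ j, HasDerivAt (fun t => rotVec (axisRot i t) x j) (gen i x j) 0 by
    rw [hasDerivAt_iff_hasFDerivAt, ← hasFDerivWithinAt_univ, hasFDerivWithinAt_euclidean]
    intro j
    rw [hasFDerivWithinAt_univ]
    exact (h j).hasFDerivAt.congr_fderiv (ContinuousLinearMap.ext_ring (by simp))
  intro j
  have hs : HasDerivAt Real.sin 1 0 := by simpa using Real.hasDerivAt_sin 0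
  have hc : HasDerivAt Real.cos 0 0 := by simpa using Real.hasDerivAt_cos 0
  simp only [E3.rotVec_apply]
  have key : ∀ a b c : ℝ, HasDerivAt (fun t : ℝ => a + b * Real.cos t + c * Real.sin t) c 0 := by
    intro a b c
    have h := ((hc.const_mul b).const_add a).add (hs.const_mul c)
    simp only [mul_zero, zero_add, mul_one] at h
    exact h
  fin_cases i <;> fin_cases j <;> simp [axisRot, axisMat, gen]
  · exact hasDerivAt_const _ _
  · convert key 0 (x 1) (-x 2) using 2; ring
  · convert key 0 (x 2) (x 1) using 2; ring
  · convert key 0 (x 0) (x 2) using 2; ring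
  · exact hasDerivAt_const _ _
  · convert key 0 (x 2) (-x 0) using 2; ring
  · convert key 0 (x 0) (-x 1) using 2; ring
  · convert key 0 (x 1) (x 0) using 2; ring
  · exact hasDerivAt_const _ _

/-- The derivative of a function on the unit tangent bundle along an infinitesimal rotation. -/
def axisDeriv (i : Fin 3) (θ : T1S2 → ℝ) (u : T1S2) : ℝ :=
  fderiv ℝ (θ ∘ retr) u.coe (gen i u.1.1, gen i u.1.2)

theorem hasDerivAt_axisRot_smul_zero {θ : T1S2 → ℝ} (hθ : DifferentiableOn ℝ (θ ∘ retr) indepPairs)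
    (i : Fin 3) (u : T1S2) : HasDerivAt (fun t => θ (axisRot i t • u)) (axisDeriv i θ u) 0 := by
  have h1 : HasDerivAt (fun t => (axisRot i t • u).coe) (gen i u.1.1, gen i u.1.2) 0 :=
    (hasDerivAt_rotVec_axisRot i u.1.1).prodMk (hasDerivAt_rotVec_axisRot i u.1.2)
  have h2 : HasFDerivAt (θ ∘ retr) (fderiv ℝ (θ ∘ retr) u.coe) (axisRot i 0 • u).coe := by
    rw [axisRot_zero, one_smul]
    exact (hθ.differentiableAt (isOpen_indepPairs.mem_nhds (coe_mem_indepPairs u))).hasFDerivAt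
  have h3 := h2.comp_hasDerivAt (0 : ℝ) h1
  rw [show (fun t => θ (axisRot i t • u)) = (θ ∘ retr) ∘ fun t => (axisRot i t • u).coe from
    funext fun t => by simp]
  exact h3

/-- The one-parameter group law reduces time `t` at `u` to time zero at `axisRot i t • u`. -/
theorem hasDerivAt_axisRot_smul {θ : T1S2 → ℝ} (hθ : DifferentiableOn ℝ (θ ∘ retr) indepPairs)
    (i : Fin 3) (u : T1S2) (t : ℝ) :
    HasDerivAt (fun t => θ (axisRot i t • u)) (axisDeriv i θ (axisRot i t • u)) t := by
  have h1 := hasDerivAt_axisRot_smul_zero hθ i (axisRot i t • u)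
  rw [← sub_self t] at h1
  have h2 := h1.comp_sub_const t t
  refine h2.congr_of_eventuallyEq (Eventually.of_forall fun s => ?_)
  change θ _ = θ _
  rw [← mul_smul, ← axisRot_add, sub_add_cancel]

/-- The coordinates of the angular velocity of a tangent vector of the unit tangent bundle. -/
def angVel (i : Fin 3) (q : E3 × E3) : (E3 × E3) →L[ℝ] ℝ :=
  let A : Fin 3 → (E3 × E3) →L[ℝ] ℝ := fun j =>
    (EuclideanSpace.proj j).comp (ContinuousLinearMap.fst ℝ E3 E3)
  let B : Fin 3 → (E3 × E3) →L[ℝ] ℝ := fun j =>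
    (EuclideanSpace.proj j).comp (ContinuousLinearMap.snd ℝ E3 E3)
  (![q.1 1 • A 2 - q.1 2 • A 1, q.1 2 • A 0 - q.1 0 • A 2, q.1 0 • A 1 - q.1 1 • A 0] i) +
    q.1 i • ((q.1 1 * q.2 2 - q.1 2 * q.2 1) • B 0 + (q.1 2 * q.2 0 - q.1 0 * q.2 2) • B 1 +
      (q.1 0 * q.2 1 - q.1 1 * q.2 0) • B 2)

theorem contDiff_angVel (i : Fin 3) : ContDiff ℝ ∞ (angVel i) := by
  have h1 : ∀ j : Fin 3, ContDiff ℝ ∞ fun q : E3 × E3 => q.1 j := fun j =>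
    ((EuclideanSpace.proj j : E3 →L[ℝ] ℝ).comp (ContinuousLinearMap.fst ℝ E3 E3)).contDiff
  have h2 : ∀ j : Fin 3, ContDiff ℝ ∞ fun q : E3 × E3 => q.2 j := fun j =>
    ((EuclideanSpace.proj j : E3 →L[ℝ] ℝ).comp (ContinuousLinearMap.snd ℝ E3 E3)).contDiff
  unfold angVel
  refine ContDiff.add ?_ ((h1 i).smul ((ContDiff.add ?_ ?_).add ?_))
  · fin_cases i
    · exact ((h1 1).smul contDiff_const).sub ((h1 2).smul contDiff_const)
    · exact ((h1 2).smul contDiff_const).sub ((h1 0).smul contDiff_const)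
    · exact ((h1 0).smul contDiff_const).sub ((h1 1).smul contDiff_const)
  · exact (((h1 1).mul (h2 2)).sub ((h1 2).mul (h2 1))).smul contDiff_const
  · exact (((h1 2).mul (h2 0)).sub ((h1 0).mul (h2 2))).smul contDiff_const
  · exact (((h1 0).mul (h2 1)).sub ((h1 1).mul (h2 0))).smul contDiff_const

/-- The three hypotheses linearize `‖x‖ = 1`, `‖v‖ = 1` and `⟨x, v⟩ = 0`, so `ξ = (a, b)` is an
infinitesimal rotation `(ω × x, ω × v)`. Its angular velocity is `ω = x × a + ⟨x × v, b⟩ x`: the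
first term is the part orthogonal to `x`, and the coefficient of the second is `⟨ω, x⟩`. -/
theorem sum_angVel_smul_gen (u : T1S2) {ξ : E3 × E3} (h1 : inner ℝ (u.1.1 : E3) ξ.1 = 0)
    (h2 : inner ℝ u.1.2 ξ.2 = 0) (h3 : inner ℝ (u.1.1 : E3) ξ.2 + inner ℝ u.1.2 ξ.1 = 0) :
    ∑ i, angVel i u.coe ξ • ((gen i u.1.1, gen i u.1.2) : E3 × E3) = ξ := by
  have hx : (u.1.1 : E3) 0 ^ 2 + (u.1.1 : E3) 1 ^ 2 + (u.1.1 : E3) 2 ^ 2 = 1 := by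
    rw [← E3.norm_sq, S2.norm_coe, one_pow]
  have hv : u.1.2 0 ^ 2 + u.1.2 1 ^ 2 + u.1.2 2 ^ 2 = 1 := by
    rw [← E3.norm_sq, u.norm_snd, one_pow]
  have hxv := u.inner_eq_zero
  obtain ⟨a, b⟩ := ξ
  simp only [E3.inner_eq] at h1 h2 h3 hxv
  simp only [angVel, T1S2.coe]
  generalize (u.1.1 : E3) = x at *
  generalize u.1.2 = v at *
  have e1 : ∀ j, (x 1 * a 2 - x 2 * a 1 + x 0 * ((x 1 * v 2 - x 2 * v 1) * b 0 + (x 2 * v 0 - x 0 * v 2) * b 1 + (x 0 * v 1 - x 1 * v 0) * b 2)) * gen 0 x j +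
     (x 2 * a 0 - x 0 * a 2 + x 1 * ((x 1 * v 2 - x 2 * v 1) * b 0 + (x 2 * v 0 - x 0 * v 2) * b 1 + (x 0 * v 1 - x 1 * v 0) * b 2)) * gen 1 x j +
     (x 0 * a 1 - x 1 * a 0 + x 2 * ((x 1 * v 2 - x 2 * v 1) * b 0 + (x 2 * v 0 - x 0 * v 2) * b 1 + (x 0 * v 1 - x 1 * v 0) * b 2)) * gen 2 x j = a j := by
    intro j
    fin_cases j <;> simp [gen]
    · linear_combination a 0 * hx - x 0 * h1
    · linear_combination a 1 * hx - x 1 * h1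
    · linear_combination a 2 * hx - x 2 * h1
  have e2 : ∀ j, (x 1 * a 2 - x 2 * a 1 + x 0 * ((x 1 * v 2 - x 2 * v 1) * b 0 + (x 2 * v 0 - x 0 * v 2) * b 1 + (x 0 * v 1 - x 1 * v 0) * b 2)) * gen 0 v j +
     (x 2 * a 0 - x 0 * a 2 + x 1 * ((x 1 * v 2 - x 2 * v 1) * b 0 + (x 2 * v 0 - x 0 * v 2) * b 1 + (x 0 * v 1 - x 1 * v 0) * b 2)) * gen 1 v j +
     (x 0 * a 1 - x 1 * a 0 + x 2 * ((x 1 * v 2 - x 2 * v 1) * b 0 + (x 2 * v 0 - x 0 * v 2) * b 1 + (x 0 * v 1 - x 1 * v 0) * b 2)) * gen 2 v j = b j := by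
    have hg : (x 0 ^ 2 + x 1 ^ 2 + x 2 ^ 2) * (v 0 ^ 2 + v 1 ^ 2 + v 2 ^ 2) = 1 := by
      rw [hx, hv, one_mul]
    intro j
    fin_cases j <;> simp [gen]
    · linear_combination (a 0 - b 0 * (x 0 * v 0 + x 1 * v 1 + x 2 * v 2) + x 0 * (v 0 * b 0 + v 1 * b 1 + v 2 * b 2) + v 0 * (x 0 * b 0 + x 1 * b 1 + x 2 * b 2)) * hxv - x 0 * h3 + b 0 * hg - x 0 * (x 0 * b 0 + x 1 * b 1 + x 2 * b 2) * hv - v 0 * (x 0 ^ 2 + x 1 ^ 2 + x 2 ^ 2) * h2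
    · linear_combination (a 1 - b 1 * (x 0 * v 0 + x 1 * v 1 + x 2 * v 2) + x 1 * (v 0 * b 0 + v 1 * b 1 + v 2 * b 2) + v 1 * (x 0 * b 0 + x 1 * b 1 + x 2 * b 2)) * hxv - x 1 * h3 + b 1 * hg - x 1 * (x 0 * b 0 + x 1 * b 1 + x 2 * b 2) * hv - v 1 * (x 0 ^ 2 + x 1 ^ 2 + x 2 ^ 2) * h2
    · linear_combination (a 2 - b 2 * (x 0 * v 0 + x 1 * v 1 + x 2 * v 2) + x 2 * (v 0 * b 0 + v 1 * b 1 + v 2 * b 2) + v 2 * (x 0 * b 0 + x 1 * b 1 + x 2 * b 2)) * hxv - x 2 * h3 + b 2 * hg - x 2 * (x 0 * b 0 + x 1 * b 1 + x 2 * b 2) * hv - v 2 * (x 0 ^ 2 + x 1 ^ 2 + x 2 ^ 2) * h2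
  rw [Fin.sum_univ_three]
  refine Prod.ext ?_ ?_
  · ext j
    simpa [mul_add] using e1 j
  · ext j
    simpa [mul_add] using e2 j

end DiffusedSphere
end

noncomputable section

namespace DiffusedSphere

/-! ### Functions of class `C^n` on the unit tangent bundle -/

theorem contDiff_gen (i : Fin 3) : ContDiff ℝ ∞ (gen i) := by
  rw [contDiff_euclidean]
  intro j
  have h : ∀ k : Fin 3, ContDiff ℝ ∞ fun x : E3 => x k := fun k => by fun_prop
  fin_cases i <;> fin_cases j <;> simp [gen] <;> fun_prop

theorem orthonormalize_mem {p : E3 × E3} (hp : p ∈ indepPairs) : orthonormalize p ∈ indepPairs := by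
  rw [← coe_retr hp]
  exact coe_mem_indepPairs _

theorem retr_orthonormalize {p : E3 × E3} (hp : p ∈ indepPairs) :
    retr (orthonormalize p) = retr p := by
  rw [← coe_retr hp, retr_coe]

theorem differentiableAt_orthonormalize {p : E3 × E3} (hp : p ∈ indepPairs) :
    DifferentiableAt ℝ orthonormalize p :=
  (contDiffOn_orthonormalize.contDiffAt (isOpen_indepPairs.mem_nhds hp)).differentiableAt (by simp)

/-- Near `p` the values of `orthonormalize` satisfy the equations of the bundle identically; their
derivatives along a line through `p` vanish. -/
theorem inner_fderiv_orthonormalize {p : E3 × E3} (hp : p ∈ indepPairs) (e : E3 × E3) :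
    inner ℝ ((retr p).1.1 : E3) (fderiv ℝ orthonormalize p e).1 = 0 ∧
    inner ℝ (retr p).1.2 (fderiv ℝ orthonormalize p e).2 = 0 ∧
    inner ℝ ((retr p).1.1 : E3) (fderiv ℝ orthonormalize p e).2 +
      inner ℝ (retr p).1.2 (fderiv ℝ orthonormalize p e).1 = 0 := by
  set ξ := fderiv ℝ orthonormalize p e
  have hline : HasDerivAt (fun t : ℝ => p + t • e) e 0 := by
    simpa using ((hasDerivAt_id (0 : ℝ)).smul_const e).const_add p
  have hR : HasDerivAt (fun t : ℝ => orthonormalize (p + t • e)) ξ 0 := by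
    have h1 : HasFDerivAt orthonormalize (fderiv ℝ orthonormalize p) (p + (0 : ℝ) • e) := by
      rw [zero_smul, add_zero]
      exact (differentiableAt_orthonormalize hp).hasFDerivAt
    exact h1.comp_hasDerivAt 0 hline
  have hev : ∀ᶠ t in 𝓝 (0 : ℝ), p + t • e ∈ indepPairs := by
    refine hline.continuousAt.eventually (isOpen_indepPairs.mem_nhds ?_)
    simpa using hp
  have h1 : HasDerivAt (fun t : ℝ => (orthonormalize (p + t • e)).1) ξ.1 0 :=
    (ContinuousLinearMap.fst ℝ E3 E3).hasFDerivAt.comp_hasDerivAt 0 hR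
  have h2 : HasDerivAt (fun t : ℝ => (orthonormalize (p + t • e)).2) ξ.2 0 :=
    (ContinuousLinearMap.snd ℝ E3 E3).hasFDerivAt.comp_hasDerivAt 0 hR
  have e1 : (orthonormalize (p + (0 : ℝ) • e)).1 = (retr p).1.1 := by
    rw [zero_smul, add_zero, ← coe_retr hp]; rfl
  have e2 : (orthonormalize (p + (0 : ℝ) • e)).2 = (retr p).1.2 := by
    rw [zero_smul, add_zero, ← coe_retr hp]; rfl
  have key : ∀ (f : ℝ → ℝ) (c d : ℝ), HasDerivAt f d 0 →
      (∀ᶠ t in 𝓝 (0 : ℝ), f t = c) → d = 0 := fun f c d hf hc =>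
    hf.unique ((hasDerivAt_const (0 : ℝ) c).congr_of_eventuallyEq hc)
  have h11 := key _ 1 _ (h1.inner ℝ h1) (by
    filter_upwards [hev] with t ht
    rw [← coe_retr ht, real_inner_self_eq_norm_sq]
    simp [T1S2.coe])
  have h22 := key _ 1 _ (h2.inner ℝ h2) (by
    filter_upwards [hev] with t ht
    rw [← coe_retr ht, real_inner_self_eq_norm_sq]
    simp [T1S2.coe, T1S2.norm_snd])
  have h12 := key _ 0 _ (h1.inner ℝ h2) (by
    filter_upwards [hev] with t ht
    rw [← coe_retr ht]
    exact T1S2.inner_eq_zero _)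
  rw [e1] at h11
  rw [e2] at h22
  rw [e1, e2] at h12
  have c1 := real_inner_comm ((retr p).1.1 : E3) ξ.1
  have c2 := real_inner_comm (retr p).1.2 ξ.2
  have c3 := real_inner_comm (retr p).1.2 ξ.1
  exact ⟨by linarith, by linarith, by linarith⟩

/-- The coefficients of the differential of a function in terms of its derivatives along
infinitesimal rotations. -/
def axisCoef (i : Fin 3) (p : E3 × E3) : (E3 × E3) →L[ℝ] ℝ :=
  (angVel i (orthonormalize p)).comp (fderiv ℝ orthonormalize p)

theorem contDiffOn_axisCoef (i : Fin 3) : ContDiffOn ℝ ∞ (axisCoef i) indepPairs :=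
  ((contDiff_angVel i).comp_contDiffOn contDiffOn_orthonormalize).clm_comp
    (contDiffOn_orthonormalize.fderiv_of_isOpen isOpen_indepPairs (by simp))

/-- The function `θ ∘ retr` factors through `orthonormalize`, whose derivative is tangent to the
bundle and hence a combination of infinitesimal rotations. Regularity can then be measured by
derivatives along rotations alone. -/
theorem fderiv_comp_retr {θ : T1S2 → ℝ} (hθ : DifferentiableOn ℝ (θ ∘ retr) indepPairs)
    {p : E3 × E3} (hp : p ∈ indepPairs) :
    fderiv ℝ (θ ∘ retr) p = ∑ i, axisDeriv i θ (retr p) • axisCoef i p := by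
  have h1 : θ ∘ retr =ᶠ[𝓝 p] (θ ∘ retr) ∘ orthonormalize := by
    filter_upwards [isOpen_indepPairs.mem_nhds hp] with q hq
    simp only [Function.comp_apply, retr_orthonormalize hq]
  have h2 : DifferentiableAt ℝ (θ ∘ retr) (orthonormalize p) :=
    hθ.differentiableAt (isOpen_indepPairs.mem_nhds (orthonormalize_mem hp))
  rw [h1.fderiv_eq, fderiv_comp _ h2 (differentiableAt_orthonormalize hp)]
  refine ContinuousLinearMap.ext fun e => ?_
  obtain ⟨h3, h4, h5⟩ := inner_fderiv_orthonormalize hp e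
  have h6 := sum_angVel_smul_gen (retr p) h3 h4 h5
  rw [coe_retr hp] at h6
  rw [ContinuousLinearMap.comp_apply]
  conv_lhs => rw [← h6]
  rw [map_sum, sum_apply]
  refine Finset.sum_congr rfl fun i _ => ?_
  rw [map_smul, smul_apply, axisDeriv, coe_retr hp, smul_eq_mul, smul_eq_mul,
    mul_comm]
  rfl

/-- Functions of class `C^n` on the unit tangent bundle. -/
def IsCk (n : ℕ) (θ : T1S2 → ℝ) : Prop := ContDiffOn ℝ n (θ ∘ retr) indepPairs

theorem IsCk.of_le {m n : ℕ} {θ : T1S2 → ℝ} (h : IsCk n θ) (hmn : m ≤ n) : IsCk m θ :=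
  ContDiffOn.of_le h (by exact_mod_cast hmn)

theorem IsCk.continuous {n : ℕ} {θ : T1S2 → ℝ} (h : IsCk n θ) : Continuous θ := by
  have h1 : θ = (θ ∘ retr) ∘ T1S2.coe := by
    funext u
    simp
  rw [h1]
  exact ContinuousOn.comp_continuous (ContDiffOn.continuousOn h) T1S2.continuous_coe
    coe_mem_indepPairs

theorem isCk_zero {θ : T1S2 → ℝ} (h : Continuous θ) : IsCk 0 θ := by
  rw [IsCk, Nat.cast_zero, contDiffOn_zero]
  exact h.comp_continuousOn continuousOn_retr

theorem IsCk.differentiableOn {n : ℕ} {θ : T1S2 → ℝ} (h : IsCk (n + 1) θ) :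
    DifferentiableOn ℝ (θ ∘ retr) indepPairs :=
  ContDiffOn.differentiableOn h (by exact_mod_cast Nat.succ_ne_zero n)

theorem isCk_succ_of_hasFDerivAt {n : ℕ} {θ : T1S2 → ℝ} {θ' : E3 × E3 → (E3 × E3) →L[ℝ] ℝ}
    (h : ∀ p ∈ indepPairs, HasFDerivAt (θ ∘ retr) (θ' p) p) (h' : ContDiffOn ℝ n θ' indepPairs) :
    IsCk (n + 1) θ := by
  rw [IsCk, Nat.cast_add, Nat.cast_one,
    contDiffOn_succ_iff_hasFDerivWithinAt_of_uniqueDiffOn isOpen_indepPairs.uniqueDiffOn]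
  exact ⟨fun h => absurd h (by simp), θ', h', fun p hp => (h p hp).hasFDerivWithinAt⟩

theorem contDiffOn_sum_axisCoef {n : ℕ} {d : Fin 3 → T1S2 → ℝ} (hd : ∀ i, IsCk n (d i)) :
    ContDiffOn ℝ n (fun p => ∑ i, d i (retr p) • axisCoef i p) indepPairs :=
  ContDiffOn.sum fun i _ => ContDiffOn.smul (hd i)
    ((contDiffOn_axisCoef i).of_le (by exact_mod_cast le_top))

theorem isCk_succ {n : ℕ} {θ : T1S2 → ℝ} (hθ : DifferentiableOn ℝ (θ ∘ retr) indepPairs)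
    (hd : ∀ i, IsCk n (axisDeriv i θ)) : IsCk (n + 1) θ := by
  refine isCk_succ_of_hasFDerivAt (θ' := fun p => ∑ i, axisDeriv i θ (retr p) • axisCoef i p)
    (fun p hp => ?_) (contDiffOn_sum_axisCoef hd)
  rw [← fderiv_comp_retr hθ hp]
  exact (hθ.differentiableAt (isOpen_indepPairs.mem_nhds hp)).hasFDerivAt

theorem IsCk.axisDeriv {n : ℕ} {θ : T1S2 → ℝ} (h : IsCk (n + 1) θ) (i : Fin 3) :
    IsCk n (axisDeriv i θ) := by
  have h1 : ContDiffOn ℝ n (fderiv ℝ (θ ∘ retr)) indepPairs :=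
    ContDiffOn.fderiv_of_isOpen h isOpen_indepPairs (by norm_cast)
  have hR : ContDiffOn ℝ n orthonormalize indepPairs :=
    contDiffOn_orthonormalize.of_le (by exact_mod_cast le_top)
  have hg : ContDiff ℝ n (gen i) := (contDiff_gen i).of_le (by exact_mod_cast le_top)
  have h2 : ContDiffOn ℝ n (fun p => fderiv ℝ (θ ∘ retr) (orthonormalize p)
      (gen i (orthonormalize p).1, gen i (orthonormalize p).2)) indepPairs :=
    (h1.comp hR fun p hp => orthonormalize_mem hp).clm_apply
      ((hg.comp_contDiffOn hR.fst).prodMk (hg.comp_contDiffOn hR.snd))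
  refine h2.congr fun p hp => ?_
  rw [← coe_retr hp]
  rfl

/-! ### Composition with diffeomorphisms -/

theorem contDiffOn_dext_retr (k : Diff) : ContDiffOn ℝ ∞
    (fun p => dext k (orthonormalize p).1 (orthonormalize p).2) indepPairs :=
  ((contDiffOn_dext k).comp contDiffOn_orthonormalize.fst
    fun _ hp => (orthonormalize_mem hp).1).clm_apply contDiffOn_orthonormalize.snd

theorem dext_orthonormalize (k : Diff) {p : E3 × E3} (hp : p ∈ indepPairs) :
    dext k (orthonormalize p).1 (orthonormalize p).2 = dext k (retr p).1.1 (retr p).1.2 := by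
  rw [← coe_retr hp]
  rfl

theorem dext_snd_ne_zero (k : Diff) (u : T1S2) : dext k u.1.1 u.1.2 ≠ 0 := by
  rw [← norm_ne_zero_iff, ← stretch1_eq]
  exact (stretch1_pos k u).ne'

theorem contDiffOn_stretch1 (k : Diff) : ContDiffOn ℝ ∞ (stretch1 k ∘ retr) indepPairs := by
  have h1 : ContDiffOn ℝ ∞
      (fun p => ‖dext k (orthonormalize p).1 (orthonormalize p).2‖) indepPairs :=
    (contDiffOn_dext_retr k).norm ℝ fun p hp => by
      rw [dext_orthonormalize k hp]
      exact dext_snd_ne_zero k _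
  refine h1.congr fun p hp => ?_
  rw [dext_orthonormalize k hp, Function.comp_apply, stretch1_eq]

theorem contDiffOn_sharp1 (k : Diff) :
    ContDiffOn ℝ ∞ (fun p => (sharp1 k (retr p)).coe) indepPairs := by
  have h1 : ContDiffOn ℝ ∞ (fun p => (ext k (orthonormalize p).1,
      ((stretch1 k ∘ retr) p)⁻¹ • dext k (orthonormalize p).1 (orthonormalize p).2)) indepPairs :=
    ((contDiffOn_ext k).comp contDiffOn_orthonormalize.fst
      fun _ hp => (orthonormalize_mem hp).1).prodMk
      (((contDiffOn_stretch1 k).inv fun p _ => (stretch1_pos k _).ne').smul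
        (contDiffOn_dext_retr k))
  refine h1.congr fun p hp => ?_
  rw [dext_orthonormalize k hp, T1S2.coe, sharp1_fst, sharp1_snd, ← ext_coe, ← coe_retr hp]
  rfl

theorem IsCk.pushDensity {n : ℕ} {φ : T1S2 → ℝ} (hφ : IsCk n φ) (h : Diff) :
    IsCk n (pushDensity h φ) := by
  have hφ' : ContDiffOn ℝ n (φ ∘ retr) indepPairs := hφ
  have hs : ContDiffOn ℝ n (fun p => (sharp1 h.symm (retr p)).coe) indepPairs :=
    (contDiffOn_sharp1 h.symm).of_le (by exact_mod_cast le_top)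
  have ht : ContDiffOn ℝ n (stretch1 h.symm ∘ retr) indepPairs :=
    (contDiffOn_stretch1 h.symm).of_le (by exact_mod_cast le_top)
  have h1 : ContDiffOn ℝ n (fun p => (φ ∘ retr) (sharp1 h.symm (retr p)).coe *
      ((stretch1 h.symm ∘ retr) p)⁻¹ ^ 2) indepPairs :=
    (hφ'.comp hs fun p _ => coe_mem_indepPairs _).mul
      ((ht.inv fun p _ => (stretch1_pos _ _).ne').pow 2)
  refine h1.congr fun p _ => ?_
  simp only [Function.comp_apply, retr_coe]
  rfl

/-! ### Extension and approximation -/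

/-- The function `φ ∘ retr` is smooth only on independent pairs. A cutoff in `‖p.1‖²` and `‖orthPart
p‖²`, both equal to one on the bundle, kills it near the remaining pairs. -/
theorem exists_contDiff_extension {φ : T1S2 → ℝ} (hφ : ∀ n, IsCk n φ) :
    ∃ F : E3 × E3 → ℝ, ContDiff ℝ ∞ F ∧ ∀ u : T1S2, F u.coe = φ u := by
  -- The slope and shift make `χ` vanish for `s ≤ 1/2` and equal one from `s = 3/4` on, in
  -- particular at `s = 1`.
  let χ : ℝ → ℝ := fun s => Real.smoothTransition (4 * s - 2)
  have hχ : ContDiff ℝ ∞ χ :=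
    Real.smoothTransition.contDiff.comp ((contDiff_const.mul contDiff_id).sub contDiff_const)
  have hχ0 : ∀ s, s ≤ 1 / 2 → χ s = 0 := fun s hs =>
    Real.smoothTransition.zero_of_nonpos (by linarith)
  have hχ1 : χ 1 = 1 := Real.smoothTransition.one_of_one_le (by norm_num)
  have hn1 : ContDiff ℝ ∞ fun p : E3 × E3 => χ (‖p.1‖ ^ 2) := hχ.comp (contDiff_fst.norm_sq ℝ)
  have hn2 : ContDiff ℝ ∞ fun p : E3 × E3 => χ (‖orthPart p‖ ^ 2) :=
    hχ.comp (contDiff_orthPart.norm_sq ℝ)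
  have hφ' : ContDiffOn ℝ ∞ (φ ∘ retr) indepPairs := contDiffOn_infty.2 hφ
  refine ⟨fun p => χ (‖p.1‖ ^ 2) * χ (‖orthPart p‖ ^ 2) * (φ ∘ retr) p, ?_, fun u => ?_⟩
  · rw [contDiff_iff_contDiffAt]
    intro p
    by_cases hp : p ∈ indepPairs
    · exact (hn1.contDiffAt.mul hn2.contDiffAt).mul
        (hφ'.contDiffAt (isOpen_indepPairs.mem_nhds hp))
    · have h0 : ∀ᶠ q in 𝓝 p, χ (‖q.1‖ ^ 2) * χ (‖orthPart q‖ ^ 2) * (φ ∘ retr) q = 0 := by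
        have hp' : p.1 = 0 ∨ orthPart p = 0 := by
          by_contra hne
          push Not at hne
          exact hp hne
        rcases hp' with h | h
        · have h1 : Continuous fun q : E3 × E3 => ‖q.1‖ ^ 2 := by fun_prop
          have h2 : ∀ᶠ q : E3 × E3 in 𝓝 p, ‖q.1‖ ^ 2 < 1 / 2 :=
            h1.continuousAt.eventually_lt_const (by simp [h])
          filter_upwards [h2] with q hq
          rw [hχ0 _ hq.le, zero_mul, zero_mul]
        · have h1 : Continuous fun q : E3 × E3 => ‖orthPart q‖ ^ 2 :=
            contDiff_orthPart.continuous.norm.pow 2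
          have h2 : ∀ᶠ q : E3 × E3 in 𝓝 p, ‖orthPart q‖ ^ 2 < 1 / 2 :=
            h1.continuousAt.eventually_lt_const (by simp [h])
          filter_upwards [h2] with q hq
          rw [hχ0 _ hq.le, mul_zero, zero_mul]
      exact (contDiffAt_const (c := (0 : ℝ))).congr_of_eventuallyEq h0
  · have h1 : ‖u.coe.1‖ = 1 := S2.norm_coe _
    simp only [h1, orthPart_coe, u.norm_snd, one_pow, hχ1, Function.comp_apply, retr_coe, one_mul]

/-- The algebra of smooth functions on the unit tangent bundle. -/
def smoothAlgebra : Subalgebra ℝ C(T1S2, ℝ) where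
  carrier := {f | ContDiffOn ℝ ∞ (f ∘ retr) indepPairs}
  mul_mem' hf hg := ContDiffOn.mul hf hg
  add_mem' hf hg := ContDiffOn.add hf hg
  algebraMap_mem' _ := contDiffOn_const

/-- Stone–Weierstrass: linear coordinates of the ambient space are smooth and separate points. -/
theorem exists_isCk_near {θ : T1S2 → ℝ} (hθ : Continuous θ) {ε : ℝ} (hε : 0 < ε) :
    ∃ θ' : T1S2 → ℝ, (∀ n, IsCk n θ') ∧ ∀ u, |θ' u - θ u| < ε := by
  have hsep : smoothAlgebra.SeparatesPoints := by
    intro u v huv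
    have hc : ∃ L : (E3 × E3) →L[ℝ] ℝ, L u.coe ≠ L v.coe := by
      by_contra hne
      push Not at hne
      apply huv
      apply T1S2.coe_injective
      refine Prod.ext ?_ ?_
      · ext j
        exact hne ((EuclideanSpace.proj j : E3 →L[ℝ] ℝ).comp (ContinuousLinearMap.fst ℝ E3 E3))
      · ext j
        exact hne ((EuclideanSpace.proj j : E3 →L[ℝ] ℝ).comp (ContinuousLinearMap.snd ℝ E3 E3))
    obtain ⟨L, hL⟩ := hc
    refine ⟨_, ⟨⟨fun u => L u.coe, L.continuous.comp T1S2.continuous_coe⟩, ?_, rfl⟩, hL⟩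
    refine (L.contDiff.comp_contDiffOn contDiffOn_orthonormalize).congr fun p hp => ?_
    simp only [ContinuousMap.coe_mk, Function.comp_apply, coe_retr hp]
  obtain ⟨g, hg⟩ := ContinuousMap.exists_mem_subalgebra_near_continuous_of_separatesPoints
    smoothAlgebra hsep θ hθ ε hε
  exact ⟨g, fun n => ContDiffOn.of_le g.2 (by exact_mod_cast le_top), hg⟩

end DiffusedSphere
end

noncomputable section

namespace DiffusedSphere

/-! ### Smoothing by convolution -/

theorem conv_retr {δ : ℝ} {θ : T1S2 → ℝ} {p : E3 × E3} (hp : p ∈ indepPairs) :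
    conv δ θ (retr p) = ∫ g : SO3, (θ ∘ retr) (rotPair g⁻¹ p) ∂uniformBall δ := by
  simp only [conv, Function.comp_apply, retr_rotPair hp]

theorem differentiableAt_integral_comp {V X : Type*} [NormedAddCommGroup V] [NormedSpace ℝ V]
    [FiniteDimensional ℝ V] [TopologicalSpace X] [CompactSpace X] [SecondCountableTopology X]
    [MeasurableSpace X] [BorelSpace X] {μ : Measure X} [IsFiniteMeasure μ] {f : V → ℝ} {s : Set V}
    (hs : IsOpen s) (hf : ContDiffOn ℝ 1 f s) {L : X → V →L[ℝ] V} (hL : Continuous L)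
    (hLs : ∀ x, ∀ p ∈ s, L x p ∈ s) {p : V} (hp : p ∈ s) :
    DifferentiableAt ℝ (fun q => ∫ x, f (L x q) ∂μ) p := by
  have hd : DifferentiableOn ℝ f s := hf.differentiableOn one_ne_zero
  have hfc : ContinuousOn (fderiv ℝ f) s := hf.continuousOn_fderiv_of_isOpen hs le_rfl
  have hc : Continuous fun q : X × V => L q.1 q.2 := (hL.comp continuous_fst).clm_apply continuous_snd
  obtain ⟨ε, hε, hball⟩ := Metric.nhds_basis_closedBall.mem_iff.1 (hs.mem_nhds hp)
  have hcl : ContinuousOn (fun q : X × V => (fderiv ℝ f (L q.1 q.2)).comp (L q.1))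
      (Set.univ ×ˢ Metric.closedBall p ε) :=
    (hfc.comp hc.continuousOn fun q hq => hLs _ _ (hball hq.2)).clm_comp
      (hL.comp continuous_fst).continuousOn
  have hproper : ProperSpace V := FiniteDimensional.proper ℝ V
  obtain ⟨C, hC⟩ := (isCompact_univ.prod (isCompact_closedBall p ε)).exists_bound_of_continuousOn hcl
  have hslice : ∀ q : V, Continuous fun x : X => L x q := fun q => hL.clm_apply continuous_const
  have hFc : ∀ q ∈ s, Continuous fun x : X => f (L x q) := fun q hq =>
    hd.continuousOn.comp_continuous (hslice q) fun x => hLs x q hq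
  have hF'c : Continuous fun x : X => (fderiv ℝ f (L x p)).comp (L x) :=
    (hfc.comp_continuous (hslice p) fun x => hLs x p hp).clm_comp hL
  have key := hasFDerivAt_integral_of_dominated_of_fderiv_le (𝕜 := ℝ) (μ := μ)
    (F := fun q x => f (L x q)) (F' := fun q x => (fderiv ℝ f (L x q)).comp (L x))
    (x₀ := p) (bound := fun _ => C) (Metric.closedBall_mem_nhds p hε)
    ((hs.eventually_mem hp).mono fun q hq => (hFc q hq).aestronglyMeasurable)
    (by
      obtain ⟨D, hD⟩ := (isCompact_range (hFc p hp)).isBounded.exists_norm_le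
      exact Integrable.of_bound (hFc p hp).aestronglyMeasurable D
        (ae_of_all _ fun x => hD _ ⟨x, rfl⟩))
    hF'c.aestronglyMeasurable (ae_of_all _ fun x q hq => hC (x, q) ⟨Set.mem_univ _, hq⟩)
    (integrable_const C)
    (ae_of_all _ fun x q hq =>
      (hd.differentiableAt (hs.mem_nhds (hLs x q (hball hq)))).hasFDerivAt.comp q
        (L x).hasFDerivAt)
  exact key.differentiableAt

theorem continuous_rotPair_inv : Continuous fun g : SO3 => rotPair g⁻¹ := by
  have h : ∀ q, Continuous fun g : SO3 => rotPair g⁻¹ q := by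
    intro q
    simp only [rotPair_apply]
    exact (continuous_rotVec.comp (continuous_inv.prodMk continuous_const)).prodMk
      (continuous_rotVec.comp (continuous_inv.prodMk continuous_const))
  exact continuous_clm_apply.2 h

theorem differentiableOn_conv {δ : ℝ} (hδ : 0 < δ) {θ : T1S2 → ℝ} (hθ : IsCk 1 θ) :
    DifferentiableOn ℝ (conv δ θ ∘ retr) indepPairs := by
  intro p hp
  have := isProbabilityMeasure_uniformBall hδ
  have hθ' : ContDiffOn ℝ 1 (θ ∘ retr) indepPairs := by
    have := hθ
    rw [IsCk, Nat.cast_one] at this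
    exact this
  have key := differentiableAt_integral_comp (μ := uniformBall δ) isOpen_indepPairs hθ' continuous_rotPair_inv
    (fun g q hq => rotPair_mem hq) hp
  refine (key.congr_of_eventuallyEq ?_).differentiableWithinAt
  filter_upwards [isOpen_indepPairs.mem_nhds hp] with q hq
  rw [Function.comp_apply, conv_retr hq]

/-- The ball is invariant under conjugation, so averaging over it commutes with the action of every
rotation. This is where bi-invariance of the metric enters. -/
theorem conv_smul {δ : ℝ} {θ : T1S2 → ℝ} (hθ : Continuous θ) (k : SO3) (u : T1S2) :
    conv δ θ (k • u) = ∫ g : SO3, θ (k • g⁻¹ • u) ∂uniformBall δ := by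
  have h1 := measurePreserving_conj_uniformBall δ k
  have h2 : Continuous fun g : SO3 => θ (g⁻¹ • k • u) :=
    hθ.comp (continuous_inv.smul continuous_const)
  rw [conv, ← h1.map_eq, integral_map h1.measurable.aemeasurable h2.aestronglyMeasurable, h1.map_eq]
  refine integral_congr_ae (ae_of_all _ fun g => ?_)
  simp only [mul_inv_rev, inv_inv, smul_smul, mul_assoc]
  simp only [inv_mul_cancel, mul_one]

/-- Since averaging commutes with rotations, it commutes with their infinitesimal generators; the
interchange of derivative and integral is by domination. -/
theorem axisDeriv_conv {δ : ℝ} (hδ : 0 < δ) {θ : T1S2 → ℝ} (hθ : IsCk 1 θ) (i : Fin 3) :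
    axisDeriv i (conv δ θ) = conv δ (axisDeriv i θ) := by
  funext u
  have := isProbabilityMeasure_uniformBall hδ
  have hθc := hθ.continuous
  have hdc : Continuous (axisDeriv i θ) := (hθ.axisDeriv (n := 0) i).continuous
  obtain ⟨C, hC⟩ := exists_abs_le_of_continuous hdc
  obtain ⟨D, hD⟩ := exists_abs_le_of_continuous hθc
  have hu : Continuous fun g : SO3 => g⁻¹ • u := continuous_inv.smul continuous_const
  have hut : ∀ t : ℝ, Continuous fun g : SO3 => axisRot i t • g⁻¹ • u := fun t =>
    (continuous_const_smul (axisRot i t)).comp hu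
  have key := hasDerivAt_integral_of_dominated_loc_of_deriv_le (μ := uniformBall δ)
    (F := fun (t : ℝ) (g : SO3) => θ (axisRot i t • g⁻¹ • u))
    (F' := fun (t : ℝ) (g : SO3) => axisDeriv i θ (axisRot i t • g⁻¹ • u))
    (x₀ := 0) (bound := fun _ => C) (s := Set.univ) univ_mem
    (Eventually.of_forall fun t => (hθc.comp (hut _)).aestronglyMeasurable)
    (Integrable.of_bound (hθc.comp (hut _)).aestronglyMeasurable D
      (ae_of_all _ fun g => hD _))
    (hdc.comp (hut _)).aestronglyMeasurable (ae_of_all _ fun g t _ => hC _)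
    (integrable_const C)
    (ae_of_all _ fun g t _ => hasDerivAt_axisRot_smul hθ.differentiableOn i _ t)
  have h2 := hasDerivAt_axisRot_smul_zero (differentiableOn_conv hδ hθ) i u
  have h3 : (fun t => conv δ θ (axisRot i t • u)) =
      fun t => ∫ g : SO3, θ (axisRot i t • g⁻¹ • u) ∂uniformBall δ :=
    funext fun t => conv_smul hθc _ u
  rw [h3] at h2
  rw [h2.unique key.2, conv]
  simp only [axisRot_zero, one_smul]

/-- The bound involves the supremum of `θ` and no derivative of it, which is the gain of one order.
For negative `t` the estimate is applied backwards from the moved point. -/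
theorem abs_axisDeriv_conv_le {δ : ℝ} (hδ : 0 < δ) {θ : T1S2 → ℝ} (hθ : IsCk 1 θ) {C : ℝ}
    (hC : ∀ u, |θ u| ≤ C) (i : Fin 3) (u : T1S2) :
    |axisDeriv i (conv δ θ) u| ≤ smoothConst δ * C := by
  have hC0 : 0 ≤ C := (abs_nonneg _).trans (hC u)
  have hm := hθ.continuous.measurable
  have hs : 0 ≤ smoothConst δ := by
    rw [smoothConst]
    positivity
  refine (hasDerivAt_axisRot_smul_zero (differentiableOn_conv hδ hθ) i u).le_of_lip'
    (mul_nonneg hs hC0) (Eventually.of_forall fun t => ?_)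
  rw [axisRot_zero, one_smul, sub_zero, Real.norm_eq_abs, Real.norm_eq_abs]
  rcases le_total 0 t with ht | ht
  · rw [abs_of_nonneg ht]
    exact abs_conv_axisRot_sub_le hm hC i ht u
  · have h1 := abs_conv_axisRot_sub_le (δ := δ) hm hC i (neg_nonneg.2 ht) (axisRot i t • u)
    rw [← mul_smul, ← axisRot_add, neg_add_cancel, axisRot_zero, one_smul, abs_sub_comm] at h1
    rwa [abs_of_nonpos ht]

theorem conv_sub {δ : ℝ} (hδ : 0 < δ) {θ θ' : T1S2 → ℝ} (hθ : Continuous θ) (hθ' : Continuous θ')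
    (u : T1S2) : conv δ (θ - θ') u = conv δ θ u - conv δ θ' u := by
  have := isProbabilityMeasure_uniformBall hδ
  have hi : ∀ f : T1S2 → ℝ, Continuous f →
      Integrable (fun g : SO3 => f (g⁻¹ • u)) (uniformBall δ) := by
    intro f hf
    obtain ⟨D, hD⟩ := exists_abs_le_of_continuous hf
    exact Integrable.of_bound
      (hf.comp (continuous_inv.smul continuous_const)).aestronglyMeasurable D
      (ae_of_all _ fun g => hD _)
  exact integral_sub (hi θ hθ) (hi θ' hθ')

theorem abs_conv_le {δ : ℝ} (hδ : 0 < δ) {θ : T1S2 → ℝ} {C : ℝ} (hC : ∀ u, |θ u| ≤ C) (u : T1S2) :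
    |conv δ θ u| ≤ C := by
  have := isProbabilityMeasure_uniformBall hδ
  have h := norm_integral_le_of_norm_le_const (μ := uniformBall δ)
    (f := fun g : SO3 => θ (g⁻¹ • u)) (C := C) (ae_of_all _ fun g => hC _)
  simpa [conv] using h

theorem axisDeriv_sub {θ θ' : T1S2 → ℝ} (hθ : DifferentiableOn ℝ (θ ∘ retr) indepPairs)
    (hθ' : DifferentiableOn ℝ (θ' ∘ retr) indepPairs) (i : Fin 3) (u : T1S2) :
    axisDeriv i (θ - θ') u = axisDeriv i θ u - axisDeriv i θ' u := by
  have hu := isOpen_indepPairs.mem_nhds (coe_mem_indepPairs u)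
  have h1 : (θ - θ') ∘ retr = (θ ∘ retr) - (θ' ∘ retr) := rfl
  rw [axisDeriv, h1, fderiv_sub (hθ.differentiableAt hu) (hθ'.differentiableAt hu)]
  rfl

/-- Smooth functions `a n` approximate `θ` uniformly. By `abs_axisDeriv_conv_le` the derivatives of
their averages form uniform Cauchy sequences, whose limits are the derivatives of `conv δ θ`. -/
theorem isCk_one_conv {δ : ℝ} (hδ : 0 < δ) {θ : T1S2 → ℝ} (hθ : Continuous θ) :
    IsCk 1 (conv δ θ) := by
  have hex : ∀ n : ℕ, ∃ θ' : T1S2 → ℝ, (∀ k, IsCk k θ') ∧ ∀ u, |θ' u - θ u| < 1 / ((n : ℝ) + 1) :=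
    fun n => exists_isCk_near hθ Nat.one_div_pos_of_nat
  choose a ha hnear using hex
  have hs : 0 ≤ smoothConst δ := by
    rw [smoothConst]
    positivity
  have hac : ∀ n, Continuous (a n) := fun n => (ha n 0).continuous
  let K := smoothConst δ
  have hd : ∀ n i, Continuous (axisDeriv i (conv δ (a n))) := fun n i => by
    rw [axisDeriv_conv hδ (ha n 1)]
    have h1 : Continuous (axisDeriv i (a n)) := ((ha n 1).axisDeriv (n := 0) i).continuous
    obtain ⟨C, hC⟩ := exists_abs_le_of_continuous h1
    exact continuous_conv h1.measurable hC
  have hdist : ∀ n m N : ℕ, N ≤ n → N ≤ m → ∀ i u,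
      |axisDeriv i (conv δ (a n)) u - axisDeriv i (conv δ (a m)) u| ≤
        K * (2 * (1 / ((N : ℝ) + 1))) := by
    intro n m N hn hm i u
    have h1 : conv δ (a n) - conv δ (a m) = conv δ (a n - a m) :=
      funext fun v => (conv_sub hδ (hac n) (hac m) v).symm
    rw [← axisDeriv_sub (differentiableOn_conv hδ (ha n 1)) (differentiableOn_conv hδ (ha m 1)), h1]
    refine abs_axisDeriv_conv_le hδ ?_ (fun v => ?_) i u
    · exact ContDiffOn.sub (ha n 1) (ha m 1)
    · have e1 : (1 : ℝ) / ((n : ℝ) + 1) ≤ 1 / ((N : ℝ) + 1) :=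
        Nat.one_div_le_one_div hn
      have e2 : (1 : ℝ) / ((m : ℝ) + 1) ≤ 1 / ((N : ℝ) + 1) :=
        Nat.one_div_le_one_div hm
      have e3 := abs_lt.1 (hnear n v)
      have e4 := abs_lt.1 (hnear m v)
      rw [Pi.sub_apply, abs_le]
      constructor <;> linarith [e3.1, e3.2, e4.1, e4.2]
  have hlim0 : Tendsto (fun N : ℕ => K * (2 * (1 / ((N : ℝ) + 1)))) atTop (𝓝 0) := by
    simpa using (tendsto_one_div_add_atTop_nhds_zero_nat.const_mul 2).const_mul K
  have hlim : ∀ i, ∃ d : C(T1S2, ℝ), Tendsto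
      (fun n => (⟨axisDeriv i (conv δ (a n)), hd n i⟩ : C(T1S2, ℝ))) atTop (𝓝 d) := by
    intro i
    refine cauchySeq_tendsto_of_complete (cauchySeq_of_le_tendsto_0 _ (fun n m N hn hm => ?_) hlim0)
    rw [ContinuousMap.dist_le (by positivity)]
    exact hdist n m N hn hm i
  choose d hdlim using hlim
  have hderiv : ∀ p ∈ indepPairs, HasFDerivAt (conv δ θ ∘ retr)
      (∑ i, d i (retr p) • axisCoef i p) p := by
    intro p hp
    refine hasFDerivAt_of_tendstoLocallyUniformlyOn (𝕜 := ℝ) (l := atTop) isOpen_indepPairs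
      (f := fun n => conv δ (a n) ∘ retr) (g := conv δ θ ∘ retr)
      (f' := fun n q => ∑ i, axisDeriv i (conv δ (a n)) (retr q) • axisCoef i q)
      (g' := fun q => ∑ i, d i (retr q) • axisCoef i q) ?_ ?_ ?_ hp
    · rw [Metric.tendstoLocallyUniformlyOn_iff]
      intro ε hε q hq
      let M : E3 × E3 → ℝ := fun p => ∑ i, ‖axisCoef i p‖
      have hM : ContinuousAt M q := by
        refine tendsto_finsetSum _ fun i _ => ?_
        exact ((contDiffOn_axisCoef i).continuousOn.continuousAt
          (isOpen_indepPairs.mem_nhds hq)).norm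
      have hM0 : 0 ≤ M q := Finset.sum_nonneg fun i _ => norm_nonneg _
      refine ⟨{y | M y < M q + 1}, mem_nhdsWithin_of_mem_nhds
        (hM.eventually_lt_const (lt_add_one _)), ?_⟩
      have hη : 0 < ε / (M q + 1) := by positivity
      have hall : ∀ᶠ n in atTop, ∀ i,
          dist (⟨axisDeriv i (conv δ (a n)), hd n i⟩ : C(T1S2, ℝ)) (d i) < ε / (M q + 1) :=
        eventually_all.2 fun i => Metric.tendsto_nhds.1 (hdlim i) _ hη
      filter_upwards [hall] with n hn y hy
      have hy' : M y < M q + 1 := hy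
      rw [dist_eq_norm, ← Finset.sum_sub_distrib]
      calc _ ≤ ∑ i, ‖d i (retr y) • axisCoef i y -
            axisDeriv i (conv δ (a n)) (retr y) • axisCoef i y‖ := norm_sum_le _ _
        _ ≤ ∑ i, ε / (M q + 1) * ‖axisCoef i y‖ := by
            refine Finset.sum_le_sum fun i _ => ?_
            have h0 : d i (retr y) • axisCoef i y -
                axisDeriv i (conv δ (a n)) (retr y) • axisCoef i y =
                (d i (retr y) - axisDeriv i (conv δ (a n)) (retr y)) • axisCoef i y :=
              (sub_smul (d i (retr y)) (axisDeriv i (conv δ (a n)) (retr y)) (axisCoef i y)).symm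
            rw [h0, norm_smul]
            refine mul_le_mul_of_nonneg_right ?_ (norm_nonneg _)
            have h1 := (ContinuousMap.dist_apply_le_dist (f := d i)
              (g := ⟨axisDeriv i (conv δ (a n)), hd n i⟩) (retr y)).trans
              ((dist_comm _ _).trans_le (hn i).le)
            exact h1
        _ = ε / (M q + 1) * M y := (Finset.mul_sum _ _ _).symm
        _ < ε / (M q + 1) * (M q + 1) := mul_lt_mul_of_pos_left hy' hη
        _ = ε := by field_simp
    · intro n q hq
      rw [← fderiv_comp_retr (differentiableOn_conv hδ (ha n 1)) hq]
      exact ((differentiableOn_conv hδ (ha n 1)).differentiableAt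
        (isOpen_indepPairs.mem_nhds hq)).hasFDerivAt
    · intro q _
      rw [tendsto_iff_dist_tendsto_zero]
      refine squeeze_zero (fun _ => dist_nonneg) (fun n => ?_)
        tendsto_one_div_add_atTop_nhds_zero_nat
      rw [Real.dist_eq, Function.comp_apply, Function.comp_apply, ← conv_sub hδ (hac n) hθ]
      exact abs_conv_le hδ (fun v => (hnear n v).le) _
  exact isCk_succ_of_hasFDerivAt hderiv
    (contDiffOn_sum_axisCoef fun i => isCk_zero (d i).continuous)

/-- The derivatives along rotations are averages of `C^n` derivatives, so the induction descends to
the case of a continuous function. -/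
theorem isCk_conv {δ : ℝ} (hδ : 0 < δ) {n : ℕ} {θ : T1S2 → ℝ} (hθ : IsCk n θ) :
    IsCk (n + 1) (conv δ θ) := by
  induction n generalizing θ with
  | zero => exact isCk_one_conv hδ hθ.continuous
  | succ n ih =>
    have h1 : IsCk 1 θ := hθ.of_le (by omega)
    refine isCk_succ (differentiableOn_conv hδ h1) fun i => ?_
    rw [axisDeriv_conv hδ h1]
    exact ih (hθ.axisDeriv i)

/-- A bootstrap: transport by `h` keeps the class and averaging raises it by one, so the fixed point
equation improves regularity indefinitely. -/
theorem isCk_of_conv_pushDensity_eq {δ : ℝ} (hδ : 0 < δ) (h : Diff) {φ : T1S2 → ℝ}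
    (hφ : Continuous φ) (heq : conv δ (pushDensity h φ) = φ) (n : ℕ) :
    IsCk n φ := by
  induction n with
  | zero => exact isCk_zero hφ
  | succ n ih =>
    rw [← heq]
    exact isCk_conv hδ (ih.pushDensity h)

end DiffusedSphere
end

noncomputable section

namespace DiffusedSphere

/-! ### Existence of a stationary measure -/

/-- The image of a measure under one step of the diffused process on the unit tangent bundle. -/
def pushStep (δ : ℝ) (h : Diff) (m : Measure T1S2) : Measure T1S2 :=
  ((uniformBall δ).prod m).map (Function.uncurry fun g => sharp1 (coset h g))

theorem isStationary_iff_pushStep {δ : ℝ} {h : Diff} {m : Measure T1S2} [SFinite m]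
    [SFinite (uniformBall δ)] :
    IsStationary (uniformBall δ) (fun g => sharp1 (coset h g)) m ↔ pushStep δ h m = m := by
  have h1 : ∀ A, MeasurableSet A → pushStep δ h m A =
      ∫⁻ g, m (sharp1 (coset h g) ⁻¹' A) ∂uniformBall δ := by
    intro A hA
    rw [pushStep, Measure.map_apply (measurable_act h) hA,
      Measure.prod_apply (measurable_act h hA)]
    rfl
  constructor
  · intro hm
    ext A hA
    rw [h1 A hA, hm A hA]
  · intro hm A hA
    rw [← h1 A hA, hm]

theorem isProbabilityMeasure_pushStep {δ : ℝ} (hδ : 0 < δ) (h : Diff) (m : Measure T1S2)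
    [IsProbabilityMeasure m] : IsProbabilityMeasure (pushStep δ h m) := by
  have := isProbabilityMeasure_uniformBall hδ
  exact Measure.isProbabilityMeasure_map (measurable_act h).aemeasurable

theorem conv_eq_integral_smul {δ : ℝ} {f : T1S2 → ℝ} (hf : Continuous f) (u : T1S2) :
    conv δ f u = ∫ g : SO3, f (g • u) ∂uniformBall δ := by
  have h1 := measurePreserving_inv_uniformBall δ
  have h2 : Continuous fun g : SO3 => f (g • u) := hf.comp (continuous_id.smul continuous_const)
  conv_rhs => rw [← h1.map_eq]
  rw [integral_map h1.measurable.aemeasurable h2.aestronglyMeasurable]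
  rfl

theorem integral_pushStep {δ : ℝ} (hδ : 0 < δ) (h : Diff) (m : Measure T1S2)
    [IsProbabilityMeasure m] {f : T1S2 → ℝ} (hf : Continuous f) :
    ∫ u, f u ∂pushStep δ h m = ∫ u, conv δ f (sharp1 h u) ∂m := by
  have := isProbabilityMeasure_uniformBall hδ
  obtain ⟨C, hC⟩ := exists_abs_le_of_continuous hf
  rw [pushStep, integral_map (measurable_act h).aemeasurable hf.aestronglyMeasurable,
    integral_prod_symm]
  · refine integral_congr_ae (ae_of_all _ fun u => ?_)
    simp only [Function.uncurry, sharp1_coset]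
    exact (conv_eq_integral_smul hf _).symm
  · exact Integrable.of_bound (hf.measurable.comp (measurable_act h)).aestronglyMeasurable C
      (ae_of_all _ fun p => hC _)

theorem map_base_pushStep {δ : ℝ} (hδ : 0 < δ) {h : Diff} (hp : MeasurePreserving h area area)
    {m : Measure T1S2} [IsProbabilityMeasure m] (hm : m.map T1S2.base = area) :
    (pushStep δ h m).map T1S2.base = area := by
  have := isProbabilityMeasure_uniformBall hδ
  refine Measure.ext_of_lintegral _ fun F hF => ?_
  have hb := continuous_base.measurable
  have hFb : Measurable fun u : T1S2 => F u.base := hF.comp hb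
  rw [lintegral_map hF hb, pushStep, lintegral_map hFb (measurable_act h),
    lintegral_prod (fun z => F (Function.uncurry (fun g => sharp1 (coset h g)) z).base)
      (hFb.comp (measurable_act h)).aemeasurable]
  have h1 : ∀ g : SO3, ∫⁻ u : T1S2, F (sharp1 (coset h g) u).base ∂m = ∫⁻ x, F x ∂area := by
    intro g
    have h2 : Measurable fun x : S2 => F (g • h x) :=
      hF.comp ((measurePreserving_smul_area g).comp hp).measurable
    have h3 : (fun u : T1S2 => F (sharp1 (coset h g) u).base) =
        fun u : T1S2 => (fun x : S2 => F (g • h x)) u.base := by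
      funext u
      rw [sharp1_base]
      rfl
    rw [h3, ← lintegral_map h2 hb, hm]
    exact ((measurePreserving_smul_area g).comp hp).lintegral_comp hF
  simp only [Function.uncurry]
  simp_rw [h1]
  simp

/-- Krylov–Bogoliubov on a compact space: Cesàro means of the iterates of Liouville measure have a
limit along an ultrafilter. The step is continuous on test functions, so the limit is stationary,
and each iterate projects to area. -/
theorem exists_stationary {δ : ℝ} (hδ : 0 < δ) {h : Diff} (hp : MeasurePreserving h area area) :
    ∃ m : Measure T1S2, IsProbabilityMeasure m ∧ pushStep δ h m = m ∧ m.map T1S2.base = area := by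
  have hν := isProbabilityMeasure_uniformBall hδ
  let M : ℕ → Measure T1S2 := fun k => (pushStep δ h)^[k] liouville1
  have hM1 : ∀ k, M (k + 1) = pushStep δ h (M k) := fun k =>
    Function.iterate_succ_apply' _ _ _
  have hMp : ∀ k, IsProbabilityMeasure (M k) := by
    intro k
    induction k with
    | zero => exact inferInstanceAs (IsProbabilityMeasure liouville1)
    | succ k ih =>
      rw [hM1]
      exact isProbabilityMeasure_pushStep hδ h _
  have hMb : ∀ k, (M k).map T1S2.base = area := by
    intro k
    induction k with
    | zero => exact measurePreserving_base.map_eq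
    | succ k ih =>
      rw [hM1]
      exact map_base_pushStep hδ hp ih
  -- Means over `n + 1` terms are probability measures already at `n = 0`.
  let c : ℕ → ENNReal := fun n => ((n + 1 : ℕ) : ENNReal)⁻¹
  let A : ℕ → Measure T1S2 := fun n => c n • ∑ k ∈ Finset.range (n + 1), M k
  have hAp : ∀ n, IsProbabilityMeasure (A n) := by
    intro n
    constructor
    simp only [A, c, Measure.smul_apply, Measure.finsetSum_apply, measure_univ, smul_eq_mul,
      Finset.sum_const, Finset.card_range, nsmul_eq_mul, mul_one]
    exact ENNReal.inv_mul_cancel (by simp) (ENNReal.natCast_ne_top _)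
  have hint : ∀ {m : Measure T1S2} [IsProbabilityMeasure m] {f : T1S2 → ℝ}, Continuous f →
      Integrable f m := by
    intro m _ f hf
    obtain ⟨C, hC⟩ := exists_abs_le_of_continuous hf
    exact Integrable.of_bound hf.aestronglyMeasurable C (ae_of_all _ hC)
  have hAint : ∀ n {f : T1S2 → ℝ}, Continuous f → ∫ u, f u ∂A n =
      ((n + 1 : ℕ) : ℝ)⁻¹ * ∑ k ∈ Finset.range (n + 1), ∫ u, f u ∂M k := by
    intro n f hf
    simp only [A, c]
    rw [integral_smul_measure, integral_finsetSum_measure fun k _ => hint hf,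
      ENNReal.toReal_inv, ENNReal.toReal_natCast, smul_eq_mul]
  let U : Ultrafilter ℕ := hyperfilter ℕ
  obtain ⟨m, -, hm⟩ := (isCompact_univ (X := ProbabilityMeasure T1S2)).ultrafilter_le_nhds'
    (U.map fun n => (⟨A n, hAp n⟩ : ProbabilityMeasure T1S2)) univ_mem
  have hlim : ∀ {f : T1S2 → ℝ}, Continuous f →
      Tendsto (fun n => ∫ u, f u ∂A n) U (𝓝 (∫ u, f u ∂(m : Measure T1S2))) := by
    intro f hf
    exact ProbabilityMeasure.tendsto_iff_forall_integral_tendsto.1 hm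
      (BoundedContinuousFunction.mkOfCompact ⟨f, hf⟩)
  have hUle : (U : Filter ℕ) ≤ atTop := Nat.hyperfilter_le_atTop
  refine ⟨m, inferInstance, ?_, ?_⟩
  · have := isProbabilityMeasure_pushStep hδ h (m : Measure T1S2)
    refine ext_of_forall_integral_eq_of_IsFiniteMeasure fun f => ?_
    obtain ⟨C, hC⟩ := exists_abs_le_of_continuous f.continuous
    have hfc : Continuous fun u => conv δ f (sharp1 h u) :=
      (continuous_conv f.continuous.measurable hC).comp (continuous_sharp1 h)
    rw [integral_pushStep hδ h _ f.continuous]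
    have h1 := (hlim hfc).sub (hlim f.continuous)
    have h2 : Tendsto (fun n => ∫ u, conv δ f (sharp1 h u) ∂A n - ∫ u, f u ∂A n) U (𝓝 0) := by
      -- The sum telescopes, leaving two bounded boundary terms over `n + 1`.
      have h3 : ∀ n, ∫ u, conv δ f (sharp1 h u) ∂A n - ∫ u, f u ∂A n =
          ((n + 1 : ℕ) : ℝ)⁻¹ * (∫ u, f u ∂M (n + 1) - ∫ u, f u ∂M 0) := by
        intro n
        rw [hAint n hfc, hAint n f.continuous, ← mul_sub, ← Finset.sum_sub_distrib,
          ← Finset.sum_range_sub (fun k => ∫ u, f u ∂M k)]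
        congr 1
        refine Finset.sum_congr rfl fun k _ => ?_
        rw [hM1, integral_pushStep hδ h _ f.continuous]
      simp_rw [h3]
      refine Tendsto.mono_left ?_ hUle
      have h4 : Tendsto (fun n : ℕ => ((n + 1 : ℕ) : ℝ)⁻¹ * (2 * C)) atTop (𝓝 0) := by
        have h5 := (tendsto_one_div_add_atTop_nhds_zero_nat (𝕜 := ℝ)).mul_const (2 * C)
        simpa using h5
      refine squeeze_zero_norm (fun n => ?_) h4
      rw [norm_mul, Real.norm_of_nonneg (by positivity)]
      refine mul_le_mul_of_nonneg_left ?_ (by positivity)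
      have hb : ∀ k, ‖∫ u, f u ∂M k‖ ≤ C := fun k => by
        simpa using norm_integral_le_of_norm_le_const (μ := M k) (f := fun u => f u) (C := C)
          (ae_of_all _ hC)
      calc _ ≤ ‖∫ u, f u ∂M (n + 1)‖ + ‖∫ u, f u ∂M 0‖ := norm_sub_le _ _
        _ ≤ 2 * C := by linarith [hb (n + 1), hb 0]
    exact sub_eq_zero.1 (tendsto_nhds_unique h1 h2)
  · have : IsProbabilityMeasure ((m : Measure T1S2).map T1S2.base) :=
      Measure.isProbabilityMeasure_map continuous_base.measurable.aemeasurable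
    refine ext_of_forall_integral_eq_of_IsFiniteMeasure fun f => ?_
    have hfb : Continuous fun u : T1S2 => f u.base := f.continuous.comp continuous_base
    rw [integral_map continuous_base.measurable.aemeasurable f.continuous.aestronglyMeasurable]
    refine tendsto_nhds_unique (hlim hfb) (tendsto_const_nhds.congr fun n => ?_)
    rw [hAint n hfb]
    have h1 : ∀ k, ∫ u : T1S2, f u.base ∂M k = ∫ x, f x ∂area := fun k => by
      rw [← hMb k, integral_map continuous_base.measurable.aemeasurable
        f.continuous.aestronglyMeasurable]
    simp_rw [h1]
    rw [Finset.sum_const, Finset.card_range, nsmul_eq_mul, inv_mul_cancel_left₀]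
    positivity

/-! ### The density of a stationary measure -/

/-- Domination bounds the Radon–Nikodym derivative almost everywhere; truncation at `c` makes the
bound hold at every point without changing the measure. -/
theorem exists_bounded_density {m : Measure T1S2} [IsFiniteMeasure m] {c : ENNReal} (hc : c ≠ ⊤)
    (hm : m ≤ c • liouville1) : ∃ φ : T1S2 → ℝ, Measurable φ ∧ (∀ u, 0 ≤ φ u) ∧
      (∀ u, |φ u| ≤ c.toReal) ∧ m = liouville1.withDensity fun u => ENNReal.ofReal (φ u) := by
  have : m.HaveLebesgueDecomposition liouville1 :=
    Measure.haveLebesgueDecomposition_of_sigmaFinite _ _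
  have hac : m ≪ liouville1 :=
    (Measure.absolutelyContinuous_of_le hm).trans Measure.smul_absolutelyContinuous
  have hle : m.rnDeriv liouville1 ≤ᵐ[liouville1] fun _ => c := by
    refine ae_le_of_forall_setLIntegral_le_of_sigmaFinite (Measure.measurable_rnDeriv _ _)
      fun s hs _ => ?_
    rw [Measure.setLIntegral_rnDeriv hac, setLIntegral_const]
    exact hm s
  refine ⟨fun u => (min (m.rnDeriv liouville1 u) c).toReal,
    ((Measure.measurable_rnDeriv _ _).min measurable_const).ennreal_toReal,
    fun u => ENNReal.toReal_nonneg, fun u => ?_, ?_⟩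
  · rw [abs_of_nonneg ENNReal.toReal_nonneg]
    exact ENNReal.toReal_mono hc (min_le_right _ _)
  · conv_lhs => rw [← Measure.withDensity_rnDeriv_eq m liouville1 hac]
    refine withDensity_congr_ae ?_
    filter_upwards [hle] with u hu
    rw [min_eq_left hu, ENNReal.ofReal_toReal (ne_top_of_le_ne_top hc hu)]

theorem withDensity_conv_of_stationary {δ : ℝ} (hδ : 0 < δ) {h : Diff}
    (hp : MeasurePreserving h area area) {φ : T1S2 → ℝ} {C : ℝ} (hφ : Measurable φ)
    (h0 : ∀ u, 0 ≤ φ u) (hC : ∀ u, |φ u| ≤ C) {m : Measure T1S2} [IsProbabilityMeasure m]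
    (hm : IsStationary (uniformBall δ) (fun g => sharp1 (coset h g)) m)
    (hφm : m = liouville1.withDensity fun u => ENNReal.ofReal (φ u)) :
    m = liouville1.withDensity fun u => ENNReal.ofReal (conv δ (pushDensity h φ) u) := by
  have hν := isProbabilityMeasure_uniformBall hδ
  obtain ⟨C', hC'⟩ := exists_abs_pushDensity_le h hC
  have hcm : Measurable (conv δ (pushDensity h φ)) :=
    (continuous_conv (measurable_pushDensity h hφ) hC').measurable
  refine Measure.ext_of_lintegral _ fun F hF => ?_
  rw [lintegral_withDensity_eq_lintegral_mul _ hcm.ennreal_ofReal hF,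
    ← hm.lintegral_eq (measurable_act h) hF]
  have hG : Measurable fun u : T1S2 => ∫⁻ g : SO3, F (sharp1 (coset h g) u) ∂uniformBall δ := by
    have h1 : Measurable fun p : T1S2 × SO3 => F (p.2 • sharp1 h p.1) :=
      hF.comp (measurable_smul'.comp
        (measurable_snd.prodMk ((continuous_sharp1 h).measurable.comp measurable_fst)))
    simp only [sharp1_coset]
    exact h1.lintegral_prod_right'
  conv_lhs => rw [hφm]
  rw [lintegral_withDensity_eq_lintegral_mul _ hφ.ennreal_ofReal hG]
  have h2 := lintegral_smul_sharp1 hδ h hp hφ h0 hC hF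
  simp only [Pi.mul_apply, sharp1_coset, mul_comm] at h2 ⊢
  exact h2

theorem conv_nonneg {δ : ℝ} {ψ : T1S2 → ℝ} (hψ : ∀ u, 0 ≤ ψ u) (u : T1S2) : 0 ≤ conv δ ψ u :=
  integral_nonneg fun _ => hψ _

theorem eq_of_withDensity_eq {φ ψ : T1S2 → ℝ} (hφ : Continuous φ) (hψ : Continuous ψ)
    (hφ0 : ∀ u, 0 ≤ φ u) (hψ0 : ∀ u, 0 ≤ ψ u)
    (h : liouville1.withDensity (fun u => ENNReal.ofReal (φ u)) =
      liouville1.withDensity fun u => ENNReal.ofReal (ψ u)) : φ = ψ := by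
  rw [withDensity_eq_iff_of_sigmaFinite hφ.measurable.ennreal_ofReal.aemeasurable
    hψ.measurable.ennreal_ofReal.aemeasurable] at h
  refine (hφ.ae_eq_iff_eq liouville1 hψ).1 ?_
  filter_upwards [h] with u hu
  rwa [ENNReal.ofReal_eq_ofReal_iff (hφ0 u) (hψ0 u)] at hu

/-- A stationary measure has a continuous density, which is a fixed point of the transfer
operator. -/
theorem exists_continuous_density {δ : ℝ} (hδ : 0 < δ) {h : Diff}
    (hp : MeasurePreserving h area area) {m : Measure T1S2} [IsProbabilityMeasure m]
    (hm : IsStationary (uniformBall δ) (fun g => sharp1 (coset h g)) m) :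
    ∃ φ : T1S2 → ℝ, Continuous φ ∧ (∀ u, 0 ≤ φ u) ∧ conv δ (pushDensity h φ) = φ ∧
      m = liouville1.withDensity fun u => ENNReal.ofReal (φ u) := by
  obtain ⟨φ, hφ, h0, hC, hφm⟩ := exists_bounded_density
    (ENNReal.inv_ne_top.2 (haarProb_rotBall_ne_zero hδ)) (hm.le_liouville1 hδ)
  have hφm1 := withDensity_conv_of_stationary hδ hp hφ h0 hC hm hφm
  obtain ⟨C', hC'⟩ := exists_abs_pushDensity_le h hC
  -- One application of the transfer operator replaces the density by a continuous one of the same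
  -- measure. A second application compares two continuous densities, which must agree everywhere.
  set φ1 := conv δ (pushDensity h φ)
  have hφ1 : Continuous φ1 := continuous_conv (measurable_pushDensity h hφ) hC'
  have h10 : ∀ u, 0 ≤ φ1 u := conv_nonneg (pushDensity_nonneg h h0)
  obtain ⟨C1, hC1⟩ := exists_abs_le_of_continuous hφ1
  obtain ⟨C1', hC1'⟩ := exists_abs_pushDensity_le h hC1
  have hφm2 := withDensity_conv_of_stationary hδ hp hφ1.measurable h10 hC1 hm hφm1
  refine ⟨φ1, hφ1, h10, ?_, hφm1⟩
  exact eq_of_withDensity_eq (continuous_conv (measurable_pushDensity h hφ1.measurable) hC1') hφ1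
    (conv_nonneg (pushDensity_nonneg h h10)) h10 (hφm2.symm.trans hφm1)

end DiffusedSphere
end

noncomputable section

namespace DiffusedSphere

/-! ### Lifting measures from the projective bundle -/

/-- The quotient map to the projective bundle. -/
def toProj (u : T1S2) : PS2 := Quotient.mk antipodal u

theorem measurable_toProj : Measurable toProj := measurable_mk

theorem toProj_antip (u : T1S2) : toProj (antip u) = toProj u := mk_antip u

theorem measurable_of_comp_toProj {β : Type*} [MeasurableSpace β] {f : PS2 → β}
    (hf : Measurable (f ∘ toProj)) : Measurable f :=
  measurable_from_quotient.2 hf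

theorem measurable_sharp (h : Diff) : Measurable (sharp h) :=
  measurable_of_comp_toProj (measurable_toProj.comp (continuous_sharp1 h).measurable)

theorem measurable_proj : Measurable PS2.proj :=
  measurable_of_comp_toProj continuous_base.measurable

theorem measurable_stretch (h : Diff) : Measurable (stretch h) :=
  measurable_of_comp_toProj (continuous_stretch1 h).measurable

theorem integral_log_stretch (h : Diff) (m : Measure T1S2) :
    ∫ v, Real.log (stretch h v) ∂m.map toProj = ∫ u, Real.log (stretch1 h u) ∂m := by
  have h1 : Measurable fun v => Real.log (stretch h v) :=
    Real.measurable_log.comp (measurable_stretch h)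
  rw [integral_map measurable_toProj.aemeasurable h1.aestronglyMeasurable]
  rfl

/-- The antipodal map commutes with rotations, so on the group it is a right translation, which
preserves Haar measure. -/
theorem measurePreserving_antip : MeasurePreserving antip liouville1 liouville1 := by
  refine ⟨continuous_antip.measurable, ?_⟩
  have h1 := measurePreserving_smul_u0
  have h2 := measurePreserving_mul_right_haarProb (frame (antip u0))
  have h3 : antip ∘ (fun k : SO3 => k • u0) =
      (fun k : SO3 => k • u0) ∘ fun k => k * frame (antip u0) := by
    funext k
    simp only [Function.comp_apply, mul_smul, frame_smul_u0, smul_antip]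
  conv_lhs => rw [← h1.map_eq]
  rw [Measure.map_map continuous_antip.measurable h1.measurable, h3,
    ← Measure.map_map h1.measurable h2.measurable, h2.map_eq, h1.map_eq]

/-- An even measure is determined by its integrals of `F + F ∘ antip`, and these functions descend
to the projective bundle. -/
theorem ext_of_map_toProj {m m' : Measure T1S2} (hm : m.map antip = m) (hm' : m'.map antip = m')
    (h : m.map toProj = m'.map toProj) : m = m' := by
  refine Measure.ext_of_lintegral _ fun F hF => ?_
  have ha := continuous_antip.measurable
  let F' : PS2 → ENNReal := Quotient.lift (fun u => F u + F (antip u)) (by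
    intro u v huv
    rcases mk_eq_mk_iff.1 (Quotient.sound huv) with e | e
    · rw [e]
    · simp only [e, antip_antip]
      exact add_comm _ _)
  have hF' : Measurable F' := measurable_of_comp_toProj (hF.add (hF.comp ha))
  have key : ∀ m : Measure T1S2, m.map antip = m →
      ∫⁻ v, F' v ∂m.map toProj = 2 * ∫⁻ u, F u ∂m := by
    intro m hm
    rw [lintegral_map hF' measurable_toProj]
    have h1 : ∫⁻ u, F (antip u) ∂m = ∫⁻ u, F u ∂m := by
      rw [← lintegral_map hF ha, hm]
    change ∫⁻ u, F u + F (antip u) ∂m = _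
    rw [lintegral_add_left hF, h1, two_mul]
  have h2 := key m hm
  rw [h, key m' hm'] at h2
  exact ((ENNReal.mul_right_inj (by simp) (by simp)).1 h2).symm

theorem map_antip_pushStep {δ : ℝ} (hδ : 0 < δ) (h : Diff) {m : Measure T1S2}
    [IsProbabilityMeasure m] (hm : m.map antip = m) :
    (pushStep δ h m).map antip = pushStep δ h m := by
  have hν := isProbabilityMeasure_uniformBall hδ
  have ha := continuous_antip.measurable
  have hact := measurable_act h
  rw [pushStep, Measure.map_map ha hact]
  have h1 : antip ∘ (Function.uncurry fun g => sharp1 (coset h g)) =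
      (Function.uncurry fun g => sharp1 (coset h g)) ∘ Prod.map id antip := by
    funext p
    exact (sharp1_antip _ _).symm
  rw [h1, ← Measure.map_map hact (measurable_id.prodMap ha),
    ← Measure.map_prod_map _ _ measurable_id ha, Measure.map_id, hm]

theorem isStationary_map_toProj {δ : ℝ} {h : Diff} {m : Measure T1S2}
    (hm : IsStationary (uniformBall δ) (fun g => sharp1 (coset h g)) m) :
    IsStationary (uniformBall δ) (fun g => sharp (coset h g)) (m.map toProj) := by
  intro A hA
  rw [Measure.map_apply measurable_toProj hA, hm _ (measurable_toProj hA)]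
  refine lintegral_congr fun g => ?_
  rw [Measure.map_apply measurable_toProj (measurable_sharp _ hA)]
  rfl

/-- An absolutely continuous stationary measure on the projective bundle lifts to an invariant
one on the unit tangent bundle. -/
theorem IsDiffusedStationary.exists_lift {δ : ℝ} (hδ : 0 < δ) {h : Diff} {m' : Measure PS2}
    (hm' : IsDiffusedStationary h δ m') : ∃ m : Measure T1S2, IsProbabilityMeasure m ∧
      m.map toProj = m' ∧ m.map antip = m ∧ m.map T1S2.base = area ∧
      IsStationary (uniformBall δ) (fun g => sharp1 (coset h g)) m := by
  have hν := isProbabilityMeasure_uniformBall hδ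
  have hlp : IsProbabilityMeasure liouville := by
    rw [← map_mk_liouville1]
    exact Measure.isProbabilityMeasure_map measurable_mk.aemeasurable
  have hmp : IsProbabilityMeasure m' := by
    constructor
    have h1 := congrArg (fun m : Measure S2 => m Set.univ) hm'.map_proj
    simpa [Measure.map_apply measurable_proj MeasurableSet.univ] using h1
  have := Measure.haveLebesgueDecomposition_of_sigmaFinite m' liouville
  have ha := continuous_antip.measurable
  set ρ := m'.rnDeriv liouville
  have hρ : Measurable ρ := Measure.measurable_rnDeriv _ _
  have hρm : liouville.withDensity ρ = m' :=
    Measure.withDensity_rnDeriv_eq _ _ hm'.absolutelyContinuous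
  let m : Measure T1S2 := liouville1.withDensity (ρ ∘ toProj)
  have hmap : m.map toProj = m' := by
    refine Measure.ext_of_lintegral _ fun F hF => ?_
    rw [lintegral_map hF measurable_toProj,
      lintegral_withDensity_eq_lintegral_mul _ (hρ.comp measurable_toProj)
        (show Measurable fun u => F (toProj u) from hF.comp measurable_toProj)]
    conv_rhs => rw [← hρm]
    rw [lintegral_withDensity_eq_lintegral_mul _ hρ hF]
    exact measurePreserving_mk.lintegral_comp (hρ.mul hF)
  have hmprob : IsProbabilityMeasure m := by
    constructor
    have h1 := congrArg (fun m : Measure PS2 => m Set.univ) hmap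
    simpa [Measure.map_apply measurable_toProj MeasurableSet.univ] using h1
  have hanti : m.map antip = m := by
    refine Measure.ext_of_lintegral _ fun F hF => ?_
    rw [lintegral_map hF ha, lintegral_withDensity_eq_lintegral_mul _ (hρ.comp measurable_toProj)
        (show Measurable fun u => F (antip u) from hF.comp ha), lintegral_withDensity_eq_lintegral_mul _ (hρ.comp measurable_toProj) hF,
      ← measurePreserving_antip.lintegral_comp ((hρ.comp measurable_toProj).mul hF)]
    simp only [Pi.mul_apply, Function.comp_apply, toProj_antip]
  have hbase : m.map T1S2.base = area := by
    rw [← hm'.map_proj, ← hmap, Measure.map_map measurable_proj measurable_toProj]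
    rfl
  refine ⟨m, hmprob, hmap, hanti, hbase, isStationary_iff_pushStep.2 ?_⟩
  -- The lift and its image under one step are both even, so it is enough to compare them
  -- downstairs, where stationarity is given.
  refine ext_of_map_toProj (map_antip_pushStep hδ h hanti) hanti ?_
  rw [hmap]
  ext A hA
  rw [Measure.map_apply measurable_toProj hA, pushStep,
    Measure.map_apply (measurable_act h) (measurable_toProj hA),
    Measure.prod_apply (measurable_act h (measurable_toProj hA)), hm'.stationary A hA]
  refine lintegral_congr fun g => ?_
  conv_rhs => rw [← hmap]
  rw [Measure.map_apply measurable_toProj (measurable_sharp _ hA)]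
  rfl

/-- Existence of a stationary measure with a smooth density. -/
theorem exists_smooth_stationary {δ : ℝ} (hδ : 0 < δ) {h : Diff}
    (hp : MeasurePreserving h area area) : ∃ (m : Measure T1S2) (φ : T1S2 → ℝ),
      IsProbabilityMeasure m ∧ m.map antip = m ∧ m.map T1S2.base = area ∧
      IsStationary (uniformBall δ) (fun g => sharp1 (coset h g)) m ∧
      Continuous φ ∧ (∀ u, 0 ≤ φ u) ∧ conv δ (pushDensity h φ) = φ ∧
      m = liouville1.withDensity (fun u => ENNReal.ofReal (φ u)) ∧
      IsDiffusedStationary h δ (m.map toProj) ∧ HasSmoothDensity (m.map toProj) := by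
  have hν := isProbabilityMeasure_uniformBall hδ
  obtain ⟨m₀, hm₀p, hm₀s, hm₀b⟩ := exists_stationary hδ hp
  have hst := isStationary_iff_pushStep.2 hm₀s
  obtain ⟨φ₀, hφ₀, -, -, hφ₀m⟩ := exists_continuous_density hδ hp hst
  have hac : m₀ ≪ liouville1 := by
    rw [hφ₀m]
    exact withDensity_absolutelyContinuous _ _
  -- Evenness of the limit measure was not tracked; projecting it and lifting back yields an even
  -- stationary measure.
  have hds : IsDiffusedStationary h δ (m₀.map toProj) := by
    refine ⟨isStationary_map_toProj hst, ?_, ?_⟩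
    · rw [← map_mk_liouville1]
      exact hac.map measurable_toProj
    · rw [Measure.map_map measurable_proj measurable_toProj]
      exact hm₀b
  obtain ⟨m, hmp, hmap, hanti, hbase, hms⟩ := hds.exists_lift hδ
  obtain ⟨φ, hφ, h0, hfix, hφm⟩ := exists_continuous_density hδ hp hms
  have hφa : (fun u => φ (antip u)) = φ := by
    refine eq_of_withDensity_eq (hφ.comp continuous_antip) hφ (fun u => h0 _) h0 ?_
    rw [← hφm]
    conv_rhs => rw [← hanti]
    refine Measure.ext_of_lintegral _ fun F hF => ?_
    have ha := continuous_antip.measurable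
    have hφa : Measurable fun u => φ (antip u) := hφ.measurable.comp ha
    conv_rhs => rw [hφm]
    rw [lintegral_map hF ha, lintegral_withDensity_eq_lintegral_mul _ hφ.measurable.ennreal_ofReal
      (show Measurable fun u => F (antip u) from hF.comp ha), lintegral_withDensity_eq_lintegral_mul _
      hφa.ennreal_ofReal hF,
      ← measurePreserving_antip.lintegral_comp (hφa.ennreal_ofReal.mul hF)]
    simp only [Pi.mul_apply, antip_antip]
  let ψ : PS2 → ℝ := Quotient.lift φ (by
    intro u v huv
    rcases mk_eq_mk_iff.1 (Quotient.sound huv) with e | e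
    · rw [e]
    · rw [e]
      exact congrFun hφa v)
  have hψ : Measurable ψ := measurable_of_comp_toProj hφ.measurable
  refine ⟨m, φ, hmp, hanti, hbase, hms, hφ, h0, hfix, hφm, by rwa [hmap], ψ, ?_, ?_, ?_⟩
  · exact exists_contDiff_extension fun n => isCk_of_conv_pushDensity_eq hδ h hφ hfix n
  · exact fun v => Quotient.inductionOn v h0
  · refine Measure.ext_of_lintegral _ fun F hF => ?_
    rw [lintegral_map hF measurable_toProj, hφm,
      lintegral_withDensity_eq_lintegral_mul _ hφ.measurable.ennreal_ofReal
        (show Measurable fun u => F (toProj u) from hF.comp measurable_toProj),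
      lintegral_withDensity_eq_lintegral_mul _ hψ.ennreal_ofReal hF,
      ← measurePreserving_mk.lintegral_comp (hψ.ennreal_ofReal.mul hF)]
    rfl

end DiffusedSphere
end

noncomputable section

namespace DiffusedSphere

/-! ### Transitivity of products of axis rotations -/

theorem exists_rotate_to_axis (a b : ℝ) : ∃ t : ℝ,
    Real.sin t * a + Real.cos t * b = 0 ∧ 0 ≤ Real.cos t * a - Real.sin t * b := by
  let z : ℂ := ⟨a, b⟩
  refine ⟨-z.arg, ?_, ?_⟩
  · have h1 : ‖z‖ * Real.cos z.arg = a := Complex.norm_mul_cos_arg z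
    have h2 : ‖z‖ * Real.sin z.arg = b := Complex.norm_mul_sin_arg z
    rw [Real.sin_neg, Real.cos_neg, ← h1, ← h2]
    ring
  · have h1 : ‖z‖ * Real.cos z.arg = a := Complex.norm_mul_cos_arg z
    have h2 : ‖z‖ * Real.sin z.arg = b := Complex.norm_mul_sin_arg z
    rw [Real.sin_neg, Real.cos_neg, ← h1, ← h2]
    have : Real.cos z.arg * (‖z‖ * Real.cos z.arg) - -Real.sin z.arg * (‖z‖ * Real.sin z.arg) =
        ‖z‖ := by
      linear_combination ‖z‖ * Real.sin_sq_add_cos_sq z.arg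
    rw [this]
    exact norm_nonneg z

/-- Euler angles: two rotations bring the base point to the first axis, and a third about that axis
turns the tangent vector. -/
theorem exists_axisRot_smul_eq_u0 (u : T1S2) :
    ∃ r s t : ℝ, axisRot 0 t • axisRot 2 s • axisRot 0 r • u = u0 := by
  obtain ⟨r, hr, -⟩ := exists_rotate_to_axis ((u.1.1 : E3) 1) ((u.1.1 : E3) 2)
  set u1 := axisRot 0 r • u with hu1
  have h12 : (u1.1.1 : E3) 2 = 0 := by
    rw [hu1, T1S2.smul_fst, S2.coe_smul, E3.rotVec_apply]
    simpa [axisRot, axisMat] using hr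
  obtain ⟨s, hs, hs0⟩ := exists_rotate_to_axis ((u1.1.1 : E3) 0) ((u1.1.1 : E3) 1)
  set u2 := axisRot 2 s • u1 with hu2
  have h21 : (u2.1.1 : E3) 1 = 0 := by
    rw [hu2, T1S2.smul_fst, S2.coe_smul, E3.rotVec_apply]
    simpa [axisRot, axisMat] using hs
  have h20 : 0 ≤ (u2.1.1 : E3) 0 := by
    rw [hu2, T1S2.smul_fst, S2.coe_smul, E3.rotVec_apply]
    simpa [axisRot, axisMat, sub_eq_add_neg] using hs0
  have h22 : (u2.1.1 : E3) 2 = 0 := by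
    rw [hu2, T1S2.smul_fst, S2.coe_smul, E3.rotVec_apply]
    simpa [axisRot, axisMat] using h12
  have h20' : (u2.1.1 : E3) 0 = 1 := by
    have h := E3.norm_sq (u2.1.1 : E3)
    rw [S2.norm_coe, h21, h22] at h
    nlinarith
  have hv0 : u2.1.2 0 = 0 := by
    have h := u2.inner_eq_zero
    rw [E3.inner_eq, h20', h21, h22] at h
    linarith
  obtain ⟨t, ht, ht0⟩ := exists_rotate_to_axis (u2.1.2 1) (u2.1.2 2)
  refine ⟨r, s, t, ?_⟩
  rw [← hu1, ← hu2]
  set u3 := axisRot 0 t • u2 with hu3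
  have hx : ∀ i, (u3.1.1 : E3) i = (e0 : E3) i := by
    intro i
    rw [hu3, T1S2.smul_fst, S2.coe_smul, E3.rotVec_apply, h20', h21, h22]
    fin_cases i <;> simp [axisRot, axisMat, e0]
  have h32 : u3.1.2 2 = 0 := by
    rw [hu3, T1S2.smul_snd, E3.rotVec_apply]
    simpa [axisRot, axisMat] using ht
  have h31 : 0 ≤ u3.1.2 1 := by
    rw [hu3, T1S2.smul_snd, E3.rotVec_apply]
    simpa [axisRot, axisMat, sub_eq_add_neg] using ht0
  have h30 : u3.1.2 0 = 0 := by
    rw [hu3, T1S2.smul_snd, E3.rotVec_apply, hv0]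
    simp [axisRot, axisMat]
  have h31' : u3.1.2 1 = 1 := by
    have h := E3.norm_sq u3.1.2
    rw [T1S2.norm_snd, h30, h32] at h
    nlinarith
  refine T1S2.ext' (Subtype.ext (PiLp.ext hx)) (PiLp.ext fun i => ?_)
  fin_cases i
  · exact h30
  · exact h31'
  · exact h32

/-- A function invariant under all rotations close to the identity is constant. -/
theorem eq_of_smul_eq {β : Type*} {ψ : T1S2 → β} {U : Set SO3} (hU : U ∈ 𝓝 (1 : SO3))
    (hψ : ∀ g ∈ U, ∀ u, ψ (g • u) = ψ u) (u v : T1S2) : ψ u = ψ v := by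
  have hax : ∀ (i : Fin 3) (t : ℝ) (u : T1S2), ψ (axisRot i t • u) = ψ u := by
    intro i t
    -- Any axis rotation is a power of one arbitrarily close to the identity.
    have h1 : Tendsto (fun n : ℕ => axisRot i (t * (1 / ((n : ℝ) + 1)))) atTop (𝓝 1) := by
      rw [← axisRot_zero i]
      refine (continuous_axisRot i).continuousAt.tendsto.comp ?_
      simpa using (tendsto_one_div_add_atTop_nhds_zero_nat (𝕜 := ℝ)).const_mul t
    obtain ⟨n, hn⟩ := (h1.eventually hU).exists
    have h2 : ∀ (k : ℕ) (u : T1S2), ψ (axisRot i (k * (t * (1 / ((n : ℝ) + 1)))) • u) = ψ u := by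
      intro k
      induction k with
      | zero => intro u; simp [axisRot_zero]
      | succ k ih =>
        intro u
        have h3 : ((k + 1 : ℕ) : ℝ) * (t * (1 / ((n : ℝ) + 1))) =
            k * (t * (1 / ((n : ℝ) + 1))) + t * (1 / ((n : ℝ) + 1)) := by
          push_cast
          ring
        rw [h3, axisRot_add, mul_smul, ih, hψ _ hn]
    intro u
    have h4 := h2 (n + 1) u
    have h5 : ((n + 1 : ℕ) : ℝ) * (t * (1 / ((n : ℝ) + 1))) = t := by
      push_cast
      field_simp
    rwa [h5] at h4
  have h0 : ∀ u, ψ u = ψ u0 := by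
    intro u
    obtain ⟨r, s, t, h⟩ := exists_axisRot_smul_eq_u0 u
    rw [← h, hax, hax, hax]
  rw [h0 u, h0 v]

/-! ### Isometries -/

/-- The derivative respects the splitting into radial and tangential parts, which stay orthogonal,
and it preserves the length of each. -/
theorem norm_dext_of_stretch1_eq_one {h : Diff} (hs : ∀ u, stretch1 h u = 1) (x : S2) (w : E3) :
    ‖dext h x w‖ = ‖w‖ := by
  set c : ℝ := inner ℝ (x : E3) w
  set v : E3 := w - c • (x : E3) with hv
  have hxx : inner ℝ (x : E3) (x : E3) = (1 : ℝ) := by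
    rw [real_inner_self_eq_norm_sq, S2.norm_coe, one_pow]
  have hxv : inner ℝ (x : E3) v = 0 := by
    rw [hv, inner_sub_right, inner_smul_right, hxx, mul_one, sub_self]
  have hnv : ‖dext h x v‖ = ‖v‖ := by
    by_cases hv0 : v = 0
    · rw [hv0, map_zero]
    · have hn : ‖v‖ ≠ 0 := norm_ne_zero_iff.2 hv0
      have h1 := hs ⟨(x, ‖v‖⁻¹ • v), by
        rw [mem_tangentPlane_iff, inner_smul_right, hxv, mul_zero], by
        rw [norm_smul, norm_inv, norm_norm, inv_mul_cancel₀ hn]⟩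
      rw [stretch1_eq] at h1
      simp only [map_smul, norm_smul, norm_inv, norm_norm] at h1
      field_simp at h1
      exact h1
  have hw : w = v + c • (x : E3) := by rw [hv, sub_add_cancel]
  have hdx : dext h x x = (h x : E3) := by rw [dext_self h (S2.coe_ne_zero x), ext_coe]
  have key : ‖dext h x w‖ ^ 2 = ‖w‖ ^ 2 := by
    have e1 : dext h x w = dext h x v + c • (h x : E3) := by
      conv_lhs => rw [hw]
      rw [map_add, map_smul, hdx]
    have i1 : inner ℝ (dext h x v) (c • (h x : E3)) = 0 := by
      rw [inner_smul_right, real_inner_comm, inner_dext h x hxv, mul_zero]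
    have i2 : inner ℝ v (c • (x : E3)) = 0 := by
      rw [inner_smul_right, real_inner_comm, hxv, mul_zero]
    rw [e1]
    conv_rhs => rw [hw]
    rw [norm_add_sq_real, norm_add_sq_real, i1, i2, hnv, norm_smul, norm_smul, S2.norm_coe,
      S2.norm_coe]
  rwa [sq_eq_sq₀ (norm_nonneg _) (norm_nonneg _)] at key

/-- The extension has derivative of norm at most one away from the origin, so it does not lengthen
chords that miss the origin. A chord through the origin joins antipodal points, already at the
maximal distance 2. -/
theorem dist_le_of_stretch1_eq_one {h : Diff} (hs : ∀ u, stretch1 h u = 1) (x y : S2) :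
    dist (h x) (h y) ≤ dist x y := by
  rw [Subtype.dist_eq, Subtype.dist_eq, dist_eq_norm, dist_eq_norm]
  by_cases h0 : (0 : E3) ∈ segment ℝ (x : E3) y
  · have h1 : ‖(x : E3) - y‖ = 2 := by
      have h2 := dist_add_dist_of_mem_segment h0
      rw [dist_zero_right, dist_zero_left, S2.norm_coe, S2.norm_coe, dist_eq_norm] at h2
      linarith
    rw [h1]
    refine (norm_sub_le _ _).trans ?_
    rw [S2.norm_coe, S2.norm_coe]
    norm_num
  · have hne : ∀ z ∈ segment ℝ (y : E3) x, z ≠ 0 := by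
      rintro z hz rfl
      exact h0 (segment_symm ℝ (x : E3) y ▸ hz)
    have h1 := Convex.norm_image_sub_le_of_norm_fderiv_le (𝕜 := ℝ) (f := ext h) (C := 1)
      (fun z hz => differentiableAt_ext h (hne z hz)) (fun z hz => ?_)
      (convex_segment (y : E3) (x : E3)) (left_mem_segment ℝ _ _) (right_mem_segment ℝ _ _)
    · rwa [ext_coe, ext_coe, one_mul] at h1
    · refine ContinuousLinearMap.opNorm_le_bound _ zero_le_one fun w => ?_
      have hz0 := hne z hz
      have h2 : dext h z = dext h (radial z) := by
        rw [coe_radial hz0, dext_smul h (inv_pos.2 (norm_pos_iff.2 hz0)) hz0]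
      change ‖dext h z w‖ ≤ _
      rw [h2, norm_dext_of_stretch1_eq_one hs, one_mul]

theorem isometry_of_stretch1_eq_one {h : Diff} (hs : ∀ u, stretch1 h u = 1) : Isometry h := by
  have hs' : ∀ u, stretch1 h.symm u = 1 := by
    intro u
    have h1 := stretch1_symm h (sharp1 h.symm u)
    rwa [sharp1_sharp1_symm, hs, inv_one] at h1
  refine Isometry.of_dist_eq fun x y => le_antisymm (dist_le_of_stretch1_eq_one hs x y) ?_
  have h1 := dist_le_of_stretch1_eq_one hs' (h x) (h y)
  have h2 : ∀ z, h.symm (h z) = z := h.symm_apply_apply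
  rwa [h2, h2] at h1

/-! ### Positivity of the mean logarithmic stretch -/

theorem map_sharp1_withDensity (h : Diff) (hp : MeasurePreserving h area area) {φ : T1S2 → ℝ}
    (hφ : Measurable φ) :
    (liouville1.withDensity fun u => ENNReal.ofReal (φ u)).map (sharp1 h) =
      liouville1.withDensity fun u => ENNReal.ofReal (pushDensity h φ u) := by
  refine Measure.ext_of_lintegral _ fun F hF => ?_
  have hH := (continuous_sharp1 h).measurable
  rw [lintegral_map hF hH,
    lintegral_withDensity_eq_lintegral_mul _ hφ.ennreal_ofReal
      (show Measurable fun u => F (sharp1 h u) from hF.comp hH),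
    lintegral_withDensity_eq_lintegral_mul _ (measurable_pushDensity h hφ).ennreal_ofReal hF]
  simp only [Pi.mul_apply]
  have h1 := lintegral_pushDensity h hp hφ hF
  simp only [mul_comm] at h1 ⊢
  exact h1

theorem integral_withDensity_ofReal {φ : T1S2 → ℝ} (hφ : Measurable φ) (h0 : ∀ u, 0 ≤ φ u)
    (F : T1S2 → ℝ) : ∫ u, F u ∂liouville1.withDensity (fun u => ENNReal.ofReal (φ u)) =
      ∫ u, φ u * F u ∂liouville1 := by
  rw [integral_withDensity_eq_integral_toReal_smul hφ.ennreal_ofReal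
    (ae_of_all _ fun u => ENNReal.ofReal_lt_top)]
  refine integral_congr_ae (ae_of_all _ fun u => ?_)
  simp only [ENNReal.toReal_ofReal (h0 u), smul_eq_mul]

theorem integrable_of_continuous {m : Measure T1S2} [IsFiniteMeasure m] {f : T1S2 → ℝ}
    (hf : Continuous f) : Integrable f m := by
  obtain ⟨C, hC⟩ := exists_abs_le_of_continuous hf
  exact Integrable.of_bound hf.aestronglyMeasurable C (ae_of_all _ hC)

theorem continuous_log_stretch1 (h : Diff) : Continuous fun u => Real.log (stretch1 h u) :=
  (continuous_stretch1 h).log fun u => (stretch1_pos h u).ne'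

/-- Along `sharp1 h` the transported density is `φ` times the square of the stretch, so its
logarithm gains `2 log ‖Th u‖`. Where `φ` vanishes, both sides vanish by `0 log 0 = 0`. -/
theorem integral_mul_log_pushDensity (h : Diff) (hp : MeasurePreserving h area area)
    {φ : T1S2 → ℝ} (hφ : Continuous φ) (h0 : ∀ u, 0 ≤ φ u) :
    ∫ u, pushDensity h φ u * Real.log (pushDensity h φ u) ∂liouville1 =
      ∫ u, φ u * Real.log (φ u) ∂liouville1 + 2 * ∫ u, φ u * Real.log (stretch1 h u) ∂liouville1 := by
  have hψ := measurable_pushDensity h hφ.measurable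
  have hlog : Measurable fun u => Real.log (pushDensity h φ u) := Real.measurable_log.comp hψ
  rw [← integral_withDensity_ofReal hψ (pushDensity_nonneg h h0), ← map_sharp1_withDensity h hp
    hφ.measurable, integral_map (continuous_sharp1 h).measurable.aemeasurable
    hlog.aestronglyMeasurable, integral_withDensity_ofReal hφ.measurable h0, ← integral_const_mul,
    ← integral_add]
  · refine integral_congr_ae (ae_of_all _ fun u => ?_)
    simp only [pushDensity_sharp1]
    rcases (h0 u).eq_or_lt with he | hlt
    · rw [← he]
      simp
    · rw [Real.log_mul hlt.ne' (pow_pos (stretch1_pos h u) 2).ne', Real.log_pow]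
      push_cast
      ring
  · exact integrable_of_continuous (Real.continuous_mul_log.comp hφ)
  · exact (integrable_of_continuous (hφ.mul (continuous_log_stretch1 h))).const_mul 2

theorem integral_conv {δ : ℝ} (hδ : 0 < δ) {f : T1S2 → ℝ} (hf : Continuous f) :
    ∫ u, conv δ f u ∂liouville1 = ∫ u, f u ∂liouville1 := by
  have hν := isProbabilityMeasure_uniformBall hδ
  obtain ⟨C, hC⟩ := exists_abs_le_of_continuous hf
  have h1 : Integrable (Function.uncurry fun (u : T1S2) (g : SO3) => f (g⁻¹ • u))
      (liouville1.prod (uniformBall δ)) := by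
    refine Integrable.of_bound ?_ C (ae_of_all _ fun p => hC _)
    exact (hf.measurable.comp (measurable_inv_smul.comp measurable_swap)).aestronglyMeasurable
  simp only [conv]
  rw [integral_integral_swap h1]
  have h2 : ∀ g : SO3, ∫ u, f (g⁻¹ • u) ∂liouville1 = ∫ u, f u ∂liouville1 := by
    intro g
    have h3 := measurePreserving_smul_liouville1 g⁻¹
    conv_rhs => rw [← h3.map_eq]
    rw [integral_map h3.measurable.aemeasurable hf.aestronglyMeasurable]
  simp_rw [h2]
  simp

/-- Entropy balance at a fixed density: the change due to transport must equal the loss due to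
averaging, a Jensen defect for `x log x`. Zero loss makes the density constant, and then
`pushDensity_sharp1` forces unit stretch. -/
theorem integral_log_stretch1_pos {δ : ℝ} (hδ : 0 < δ) {h : Diff}
    (hp : MeasurePreserving h area area) (hiso : ¬ Isometry h) {m : Measure T1S2}
    [IsProbabilityMeasure m] {φ : T1S2 → ℝ} (hφ : Continuous φ) (h0 : ∀ u, 0 ≤ φ u)
    (hfix : conv δ (pushDensity h φ) = φ)
    (hφm : m = liouville1.withDensity fun u => ENNReal.ofReal (φ u)) :
    0 < ∫ u, Real.log (stretch1 h u) ∂m := by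
  have hν := isProbabilityMeasure_uniformBall hδ
  set ψ := pushDensity h φ with hψdef
  have hψ : Continuous ψ := continuous_pushDensity h hφ
  have hψ0 : ∀ u, 0 ≤ ψ u := pushDensity_nonneg h h0
  let η : ℝ → ℝ := fun x => x * Real.log x
  have hη : Continuous η := Real.continuous_mul_log
  have hηψ : Continuous fun u => η (ψ u) := hη.comp hψ
  have hηφ : Continuous fun u => η (φ u) := hη.comp hφ
  obtain ⟨C, hC⟩ := exists_abs_le_of_continuous hηψ
  have hJc : Continuous fun u => conv δ (fun u => η (ψ u)) u - η (φ u) :=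
    (continuous_conv hηψ.measurable hC).sub hηφ
  have hslice : ∀ {f : T1S2 → ℝ}, Continuous f → ∀ u : T1S2,
      Integrable (fun g : SO3 => f (g⁻¹ • u)) (uniformBall δ) := by
    intro f hf u
    obtain ⟨D, hD⟩ := exists_abs_le_of_continuous hf
    exact Integrable.of_bound
      (hf.comp (continuous_inv.smul continuous_const)).aestronglyMeasurable D
      (ae_of_all _ fun g => hD _)
  have hφu : ∀ u, φ u = ∫ g : SO3, ψ (g⁻¹ • u) ∂uniformBall δ := fun u => by
    conv_lhs => rw [← hfix]
    rfl
  have hJ0 : ∀ u, 0 ≤ conv δ (fun u => η (ψ u)) u - η (φ u) := by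
    intro u
    rw [sub_nonneg, hφu]
    exact Real.convexOn_mul_log.map_integral_le hη.continuousOn isClosed_Ici
      (ae_of_all _ fun g => hψ0 _) (hslice hψ u) (hslice hηψ u)
  have hval : 2 * ∫ u, Real.log (stretch1 h u) ∂m =
      ∫ u, (conv δ (fun u => η (ψ u)) u - η (φ u)) ∂liouville1 := by
    rw [integral_sub (integrable_of_continuous (continuous_conv hηψ.measurable hC))
      (integrable_of_continuous hηφ), integral_conv hδ hηψ, hφm,
      integral_withDensity_ofReal hφ.measurable h0]
    have h1 := integral_mul_log_pushDensity h hp hφ h0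
    simp only [η]
    linarith
  have hnn : 0 ≤ ∫ u, (conv δ (fun u => η (ψ u)) u - η (φ u)) ∂liouville1 := integral_nonneg hJ0
  by_contra hneg
  apply hiso
  have hz : ∫ u, (conv δ (fun u => η (ψ u)) u - η (φ u)) ∂liouville1 = 0 := by linarith
  have hJz : (fun u => conv δ (fun u => η (ψ u)) u - η (φ u)) = fun _ => 0 := by
    refine (hJc.ae_eq_iff_eq liouville1 continuous_const).1 ?_
    exact (integral_eq_zero_iff_of_nonneg hJ0 (integrable_of_continuous hJc)).1 hz
  -- Equality in Jensen for a strictly convex function gives constancy almost everywhere on the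
  -- ball, and continuity on the open ball removes the exceptional set.
  have hconst : ∀ u, ∀ g ∈ rotBall δ, ψ (g⁻¹ • u) = φ u := by
    intro u
    have h1 := Real.strictConvexOn_mul_log.ae_eq_const_or_map_average_lt
      (μ := uniformBall δ) (f := fun g : SO3 => ψ (g⁻¹ • u)) hη.continuousOn isClosed_Ici
      (ae_of_all _ fun g => hψ0 _) (hslice hψ u) (hslice hηψ u)
    rw [average_eq_integral, average_eq_integral, ← hφu] at h1
    have h2 : (fun g : SO3 => ψ (g⁻¹ • u)) =ᵐ[uniformBall δ] Function.const SO3 (φ u) := by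
      refine h1.resolve_right fun hlt => ?_
      have h3 := congrFun hJz u
      simp only [conv] at h3
      have h4 : φ u * Real.log (φ u) = η (φ u) := rfl
      have h5 : ∫ g : SO3, ψ (g⁻¹ • u) * Real.log (ψ (g⁻¹ • u)) ∂uniformBall δ =
        ∫ g : SO3, η (ψ (g⁻¹ • u)) ∂uniformBall δ := rfl
      linarith
    have h3 : (fun g : SO3 => ψ (g⁻¹ • u)) =ᵐ[haarProb.restrict (rotBall δ)]
        Function.const SO3 (φ u) := by
      rw [uniformBall_eq, ProbabilityTheory.cond] at h2
      exact (Measure.ae_ennreal_smul_measure_iff (ENNReal.inv_ne_zero.2 (measure_ne_top _ _))).1 h2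
    have h4 := Measure.eqOn_open_of_ae_eq h3 (isOpen_rotBall δ)
      (hψ.comp (continuous_inv.smul continuous_const)).continuousOn continuousOn_const
    exact fun g hg => h4 hg
  have h1 := one_mem_rotBall hδ
  have hψφ : ∀ u, ψ u = φ u := fun u => by
    have := hconst u 1 h1
    rwa [inv_one, one_smul] at this
  -- Taking `g = 1` identifies `ψ` with `φ`, so `ψ` is invariant under all rotations in a
  -- neighbourhood of the identity, which generate a transitive action.
  have hψc : ∀ u v, ψ u = ψ v := by
    refine eq_of_smul_eq ((isOpen_rotBall δ).mem_nhds h1) fun g hg u => ?_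
    have h2 := hconst u g⁻¹ (inv_mem_rotBall.2 hg)
    rw [inv_inv] at h2
    rw [h2, hψφ]
  have hpos : 0 < φ u0 := by
    refine (h0 u0).lt_of_ne fun he => ?_
    have h2 : φ = fun _ => 0 := funext fun u => by rw [← hψφ, hψc u u0, hψφ, he]
    have h3 : m Set.univ = 1 := measure_univ
    rw [hφm, h2] at h3
    simp at h3
  refine isometry_of_stretch1_eq_one fun u => ?_
  have h2 := pushDensity_sharp1 h φ u
  rw [← hψdef, hψc _ u, hψφ] at h2
  have h3 : φ u = φ u0 := by rw [← hψφ, hψc u u0, hψφ]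
  rw [h3] at h2
  have h4 : stretch1 h u ^ 2 = 1 := by
    have : φ u0 * (stretch1 h u ^ 2 - 1) = 0 := by linarith
    rcases mul_eq_zero.1 this with h5 | h5
    · exact absurd h5 hpos.ne'
    · linarith
  exact (pow_eq_one_iff_of_nonneg (stretch1_pos h u).le two_ne_zero).1 h4

end DiffusedSphere
end

noncomputable section

namespace DiffusedSphere

/-! ### Ergodicity of the diffused process on the sphere -/

theorem measurable_act_base (h : Diff) :
    Measurable (Function.uncurry fun (g : SO3) (x : S2) => coset h g x) := by
  have h1 : Continuous fun p : SO3 × S2 => p.1 • h p.2 :=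
    continuous_fst.smul (h.continuous.comp continuous_snd)
  exact h1.measurable

theorem isStationary_area {δ : ℝ} (hδ : 0 < δ) {h : Diff} (hp : MeasurePreserving h area area) :
    IsStationary (uniformBall δ) (fun g x => coset h g x) area := by
  have := isProbabilityMeasure_uniformBall hδ
  intro A hA
  have h1 : ∀ g : SO3, area ((fun x => coset h g x) ⁻¹' A) = area A := fun g =>
    ((measurePreserving_smul_area g).comp hp).measure_preimage hA.nullMeasurableSet
  simp_rw [h1]
  simp

theorem eq_of_ae_rotBall {δ : ℝ} {f k : SO3 → ℝ} (hf : Continuous f) (hk : Continuous k)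
    (h : f =ᵐ[uniformBall δ] k) : ∀ g ∈ rotBall δ, f g = k g := by
  have h3 : f =ᵐ[haarProb.restrict (rotBall δ)] k := by
    rw [uniformBall_eq, ProbabilityTheory.cond] at h
    exact (Measure.ae_ennreal_smul_measure_iff (ENNReal.inv_ne_zero.2 (measure_ne_top _ _))).1 h
  have h4 := Measure.eqOn_open_of_ae_eq h3 (isOpen_rotBall δ) hf.continuousOn hk.continuousOn
  exact fun g hg => h4 hg

/-- For harmonic `F` the variance of `F (g • h x)` over `g` is the mean of its square minus `F x ^
2`, which integrates to zero because every map preserves area. Hence `F (g • h x) = F x` on the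
whole ball; `g = 1` gives invariance under `h`, and then invariance under small rotations follows.
-/
theorem eq_of_harmonic_base {δ : ℝ} (hδ : 0 < δ) {h : Diff} (hp : MeasurePreserving h area area)
    {F : S2 → ℝ} (hF : Continuous F)
    (hharm : ∀ x, F x = ∫ g : SO3, F (g • h x) ∂uniformBall δ) (x y : S2) : F x = F y := by
  have hν := isProbabilityMeasure_uniformBall hδ
  obtain ⟨C, hC⟩ := isCompact_univ.exists_bound_of_continuousOn (f := F) hF.continuousOn
  have hC' : ∀ x, |F x| ≤ C := fun x => hC x trivial
  have hC0 : 0 ≤ C := (abs_nonneg _).trans (hC' e0)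
  let D : S2 → SO3 → ℝ := fun x g => F (g • h x) - F x
  have hDc : Continuous (Function.uncurry D) := by
    have h1 : Continuous fun p : S2 × SO3 => F (p.2 • h p.1) - F p.1 :=
      (hF.comp (continuous_snd.smul (h.continuous.comp continuous_fst))).sub
        (hF.comp continuous_fst)
    exact h1
  have hFi : ∀ x, Integrable (fun g : SO3 => F (g • h x)) (uniformBall δ) := fun x =>
    Integrable.of_bound (hF.comp (continuous_id.smul continuous_const)).aestronglyMeasurable C
      (ae_of_all _ fun g => hC' _)
  have hF2i : ∀ x, Integrable (fun g : SO3 => F (g • h x) ^ 2) (uniformBall δ) := fun x =>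
    Integrable.of_bound
      ((hF.comp (continuous_id.smul continuous_const)).pow 2).aestronglyMeasurable (C ^ 2)
      (ae_of_all _ fun g => by
        rw [Real.norm_eq_abs, abs_pow]
        exact pow_le_pow_left₀ (abs_nonneg _) (hC' _) 2)
  have hJ : ∀ x, ∫ g, D x g ^ 2 ∂uniformBall δ =
      ∫ g : SO3, F (g • h x) ^ 2 ∂uniformBall δ - F x ^ 2 := by
    intro x
    have h1 : ∀ g, D x g ^ 2 = F (g • h x) ^ 2 - (2 * F x * F (g • h x) - F x ^ 2) := fun g => by
      simp only [D]; ring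
    simp_rw [h1]
    have h2 : Integrable (fun g : SO3 => 2 * F x * F (g • h x)) (uniformBall δ) :=
      (hFi x).const_mul _
    have h3 : Integrable (fun g : SO3 => 2 * F x * F (g • h x) - F x ^ 2) (uniformBall δ) :=
      h2.sub (integrable_const _)
    rw [integral_sub (hF2i x) h3, integral_sub h2 (integrable_const _), integral_const_mul,
      ← hharm]
    simp
    ring
  have hprod : Integrable (Function.uncurry fun (x : S2) (g : SO3) => F (g • h x) ^ 2)
      (area.prod (uniformBall δ)) := by
    have h1 : Continuous fun p : S2 × SO3 => F (p.2 • h p.1) ^ 2 :=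
      (hF.comp (continuous_snd.smul (h.continuous.comp continuous_fst))).pow 2
    refine Integrable.of_bound h1.aestronglyMeasurable (C ^ 2) (ae_of_all _ fun p => ?_)
    simp only [Function.uncurry]
    rw [Real.norm_eq_abs, abs_pow]
    exact pow_le_pow_left₀ (abs_nonneg _) (hC' _) 2
  have hFsq : Integrable (fun x => F x ^ 2) area :=
    Integrable.of_bound (hF.pow 2).aestronglyMeasurable (C ^ 2) (ae_of_all _ fun x => by
        rw [Real.norm_eq_abs, abs_pow]
        exact pow_le_pow_left₀ (abs_nonneg _) (hC' _) 2)
  have hint : ∫ x, ∫ g, D x g ^ 2 ∂uniformBall δ ∂area = 0 := by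
    simp_rw [hJ]
    have h1 : Integrable (fun x => ∫ g : SO3, F (g • h x) ^ 2 ∂uniformBall δ) area :=
      hprod.integral_prod_left
    rw [integral_sub h1 hFsq, integral_integral_swap hprod]
    have h2 : ∀ g : SO3, ∫ x, F (g • h x) ^ 2 ∂area = ∫ x, F x ^ 2 ∂area := by
      intro g
      have h3 := (measurePreserving_smul_area g).comp hp
      conv_rhs => rw [← h3.map_eq]
      rw [integral_map h3.measurable.aemeasurable
        (show Continuous fun x => F x ^ 2 from hF.pow 2).aestronglyMeasurable]
      rfl
    simp_rw [h2]
    simp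
  have hnn : ∀ x, 0 ≤ ∫ g, D x g ^ 2 ∂uniformBall δ := fun x =>
    integral_nonneg fun g => sq_nonneg _
  have hJi : Integrable (fun x => ∫ g, D x g ^ 2 ∂uniformBall δ) area := by
    simp_rw [hJ]
    exact hprod.integral_prod_left.sub hFsq
  have hae := (integral_eq_zero_iff_of_nonneg hnn hJi).1 hint
  have hae2 : ∀ᵐ x ∂area, ∀ g ∈ rotBall δ, F (g • h x) = F x := by
    filter_upwards [hae] with x hx
    have hDx : Continuous fun g => D x g := hDc.comp (by fun_prop : Continuous fun g => (x, g))
    have h1 : Integrable (fun g => D x g ^ 2) (uniformBall δ) :=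
      Integrable.of_bound (hDx.pow 2).aestronglyMeasurable ((2 * C) ^ 2) (ae_of_all _ fun g => by
        rw [Real.norm_eq_abs, abs_pow]
        refine pow_le_pow_left₀ (abs_nonneg _) ?_ 2
        refine (abs_sub _ _).trans ?_
        linarith [hC' (g • h x), hC' x])
    have h2 := (integral_eq_zero_iff_of_nonneg (fun g => sq_nonneg (D x g)) h1).1 hx
    have h3 : (fun g => D x g ^ 2) =ᵐ[uniformBall δ] fun _ => 0 := h2
    intro g hg
    have h4 := eq_of_ae_rotBall (hDx.pow 2) continuous_const h3 g hg
    exact sub_eq_zero.1 (pow_eq_zero_iff two_ne_zero |>.1 h4)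
  have hall : ∀ g ∈ rotBall δ, ∀ x, F (g • h x) = F x := by
    intro g hg
    have h1 : (fun x => F (g • h x)) =ᵐ[area] F := by
      filter_upwards [hae2] with x hx using hx g hg
    have h2 : Continuous fun x => F (g • h x) :=
      hF.comp ((continuous_const_smul g).comp h.continuous)
    exact congrFun ((h2.ae_eq_iff_eq area hF).1 h1)
  have h1 : ∀ x, F (h x) = F x := fun x => by
    simpa using hall 1 (one_mem_rotBall hδ) x
  have h2 : ∀ u v : T1S2, F u.base = F v.base :=
    eq_of_smul_eq (ψ := fun u : T1S2 => F u.base)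
      ((isOpen_rotBall δ).mem_nhds (one_mem_rotBall hδ)) fun g hg u => by
        have h3 := hall g hg (h.symm u.base)
        have h4 : h (h.symm u.base) = u.base := h.apply_symm_apply _
        have h5 := h1 (h.symm u.base)
        rw [h4] at h3 h5
        change F (g • u.base) = F u.base
        rw [h3, h5]
  exact h2 (unitField x) (unitField y)

/-- A measurable harmonic function is its own average over the ball of rotations, so it is
automatically continuous and `eq_of_harmonic_base` applies. -/
theorem ergodic_skew_area {δ : ℝ} (hδ : 0 < δ) {h : Diff} (hp : MeasurePreserving h area area) :
    have := isProbabilityMeasure_uniformBall hδ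
    Ergodic (skew fun (g : SO3) (x : S2) => coset h g x) (area.prod (seqLaw (uniformBall δ))) := by
  have hν := isProbabilityMeasure_uniformBall hδ
  have : Nonempty S2 := ⟨e0⟩
  refine ergodic_skew (measurable_act_base h) (isStationary_area hδ hp) fun f hf hf1 hharm => ?_
  have hfin : ∀ x, f x ≠ ⊤ := fun x => ((hf1 x).trans_lt ENNReal.one_lt_top).ne
  let F : S2 → ℝ := fun x => (f x).toReal
  have hFm : Measurable F := hf.ennreal_toReal
  have hFC : ∀ x, |F x| ≤ 1 := fun x => by
    rw [abs_of_nonneg ENNReal.toReal_nonneg]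
    exact ENNReal.toReal_le_of_le_ofReal zero_le_one (by simpa using hf1 x)
  have hharm' : ∀ x, F x = ∫ g : SO3, F (g • h x) ∂uniformBall δ := by
    intro x
    have hsm : Measurable fun g : SO3 => f (g • h x) :=
      hf.comp (continuous_id.smul continuous_const).measurable
    simp only [F]
    rw [integral_toReal hsm.aemeasurable (ae_of_all _ fun g => (hfin _).lt_top)]
    congr 1
    exact hharm x
  have hF : Continuous F := by
    have h1 := (continuous_integral_smul_S2 (δ := δ) hFm hFC).comp h.continuous
    refine h1.congr fun x => ?_
    exact (hharm' x).symm
  intro x y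
  exact (ENNReal.toReal_eq_toReal_iff' (hfin x) (hfin y)).1
    (eq_of_harmonic_base hδ hp hF hharm' x y)

end DiffusedSphere
end

noncomputable section

namespace DiffusedSphere

/-! ### The derivative cocycle -/

/-- The composition of the first `n` maps of the diffused process. -/
def iterDiff (h : Diff) (w : ℕ → SO3) (n : ℕ) : Diff := iterComp (fun i => coset h (w i)) n

theorem iterDiff_zero (h : Diff) (w : ℕ → SO3) :
    iterDiff h w 0 = Diffeomorph.refl (𝓡 2) S2 ∞ := rfl

theorem iterDiff_succ (h : Diff) (w : ℕ → SO3) (n : ℕ) :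
    iterDiff h w (n + 1) = (iterDiff h w n).trans (coset h (w n)) := rfl

theorem iterate_seqTail_zero {Γ : Type*} (w : ℕ → Γ) (n : ℕ) : (seqTail^[n] w) 0 = w n := by
  induction n generalizing w with
  | zero => rfl
  | succ n ih => rw [Function.iterate_succ_apply, ih]; rfl

theorem iterate_skew_sharp1 (h : Diff) (u : T1S2) (w : ℕ → SO3) (n : ℕ) :
    (skew fun g => sharp1 (coset h g))^[n] (u, w) =
      (sharp1 (iterDiff h w n) u, seqTail^[n] w) := by
  induction n with
  | zero => rw [iterDiff_zero, sharp1_refl]; rfl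
  | succ n ih =>
    rw [Function.iterate_succ_apply', ih, iterDiff_succ, sharp1_trans, Function.iterate_succ_apply',
      ← iterate_seqTail_zero w n]
    rfl

/-- The chain rule makes the stretch multiplicative along the orbit, and the rotation factors
contribute one. -/
theorem log_stretch1_iterDiff (h : Diff) (u : T1S2) (w : ℕ → SO3) (n : ℕ) :
    Real.log (stretch1 (iterDiff h w n) u) =
      birkhoffSum (skew fun g => sharp1 (coset h g)) (fun p => Real.log (stretch1 h p.1)) n
        (u, w) := by
  induction n with
  | zero => rw [iterDiff_zero, stretch1_refl, Real.log_one, birkhoffSum_zero]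
  | succ n ih =>
    rw [iterDiff_succ, stretch1_trans, stretch1_coset,
      Real.log_mul (stretch1_pos _ _).ne' (stretch1_pos _ _).ne', ih, birkhoffSum_succ,
      iterate_skew_sharp1]

theorem base_skew (h : Diff) (p : T1S2 × (ℕ → SO3)) :
    (skew fun (g : SO3) (x : S2) => coset h g x) (p.1.base, p.2) =
      (((skew fun g => sharp1 (coset h g)) p).1.base, ((skew fun g => sharp1 (coset h g)) p).2) :=
  rfl

/-! ### Growth of the operator norm from two directions. -/

/-- The determinant of two vectors of the plane. -/
def cross (a b : E2) : ℝ := a 0 * b 1 - a 1 * b 0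

theorem E2.abs_apply_le (y : E2) (i : Fin 2) : |y i| ≤ ‖y‖ := PiLp.norm_apply_le y i

theorem abs_cross_le (a b : E2) : |cross a b| ≤ 2 * (‖a‖ * ‖b‖) := by
  unfold cross
  refine (abs_sub _ _).trans ?_
  rw [abs_mul, abs_mul, two_mul]
  exact add_le_add
    (mul_le_mul (E2.abs_apply_le _ _) (E2.abs_apply_le _ _) (abs_nonneg _) (norm_nonneg _))
    (mul_le_mul (E2.abs_apply_le _ _) (E2.abs_apply_le _ _) (abs_nonneg _) (norm_nonneg _))

theorem cross_smul_eq (a b y : E2) : cross a b • y = cross y b • a + cross a y • b := by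
  ext i
  fin_cases i <;> simp [cross] <;> ring

/-- Cramer's rule expands `y` in `a` and `b`. Each of the two coefficients is bounded crudely by `2
* ‖y‖ / |cross a b|`, whence the factor 4. -/
theorem norm_apply_le_of_cross_ne_zero (A : E2 →ₗ[ℝ] E2) {a b : S1}
    (hab : cross a b ≠ 0) (y : E2) :
    ‖A y‖ ≤ (4 / |cross a b| * max ‖A a‖ ‖A b‖) * ‖y‖ := by
  have hna : ‖(a : E2)‖ = 1 := mem_sphere_zero_iff_norm.1 a.2
  have hnb : ‖(b : E2)‖ = 1 := mem_sphere_zero_iff_norm.1 b.2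
  have hpos : 0 < |cross a b| := abs_pos.2 hab
  have h1 := congrArg (fun z => ‖A z‖) (cross_smul_eq (a : E2) b y)
  simp only [map_add, map_smul, norm_smul, Real.norm_eq_abs] at h1
  have h2 : ‖cross y b • A a + cross a y • A b‖ ≤ (4 * max ‖A a‖ ‖A b‖) * ‖y‖ := by
    refine (norm_add_le _ _).trans ?_
    rw [norm_smul, norm_smul, Real.norm_eq_abs, Real.norm_eq_abs]
    have e1 := abs_cross_le y b
    have e2 := abs_cross_le (a : E2) y
    rw [hnb, mul_one] at e1
    rw [hna, one_mul] at e2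
    have e3 := mul_le_mul e1 (le_max_left ‖A a‖ ‖A b‖) (norm_nonneg _) (by positivity)
    have e4 := mul_le_mul e2 (le_max_right ‖A a‖ ‖A b‖) (norm_nonneg _) (by positivity)
    linarith
  rw [← h1] at h2
  have h3 : ‖A y‖ = (|cross a b| * ‖A y‖) / |cross a b| := by field_simp
  rw [h3, div_le_iff₀ hpos]
  refine h2.trans (le_of_eq ?_)
  field_simp

theorem exists_norm_tangentMap_eq (k : Diff) (x : S2) (v : tangentPlane x) :
    ∃ y : E2, ‖y‖ = ‖v‖ ∧ ‖tangentMap k x v‖ = ‖planeDeriv k x y‖ := by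
  have hfr : rotVec (fr x) e0 = x := congrArg Subtype.val (fr_smul_e0 x)
  have h0 : (rotLin (fr x)).symm (v : E3) 0 = 0 := by
    have h1 : inner ℝ (e0 : E3) ((rotLin (fr x)).symm (v : E3)) = 0 := by
      rw [← (rotLin (fr x)).inner_map_map, LinearIsometryEquiv.apply_symm_apply, rotLin_apply, hfr]
      exact mem_tangentPlane_iff.1 v.2
    simpa [E3.inner_eq, e0] using h1
  refine ⟨planeProj ((rotLin (fr x)).symm (v : E3)), ?_, ?_⟩
  · rw [← norm_planeVec, planeVec_planeProj h0, LinearIsometryEquiv.norm_map]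
    rfl
  · rw [← norm_planeVec (planeDeriv k x _), planeVec_planeDeriv, planeVec_planeProj h0,
      frameDeriv_apply, ← rotLin_apply (fr x), LinearIsometryEquiv.apply_symm_apply,
      LinearIsometryEquiv.norm_map, Submodule.coe_norm, coe_tangentMap]

theorem stretch1_le_tangentNorm (k : Diff) (u : T1S2) : stretch1 k u ≤ tangentNorm k u.base := by
  have h1 := ((tangentMap k u.base : tangentPlane u.base ≃L[ℝ] tangentPlane (k u.base)) :
    tangentPlane u.base →L[ℝ] tangentPlane (k u.base)).le_opNorm u.vec
  have h2 : ‖u.vec‖ = 1 := u.2.2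
  rw [h2, mul_one] at h1
  exact h1

theorem tangentNorm_pos (k : Diff) (x : S2) : 0 < tangentNorm k x :=
  (stretch1_pos k (unitField x)).trans_le (stretch1_le_tangentNorm k (unitField x))

theorem tangentNorm_le (k : Diff) (x : S2) {a b : S1} (hab : cross a b ≠ 0) :
    tangentNorm k x ≤
      4 / |cross a b| * max (stretch1 k (triv (x, a))) (stretch1 k (triv (x, b))) := by
  rw [stretch1_triv, stretch1_triv]
  refine ContinuousLinearMap.opNorm_le_bound _ (by positivity) fun v => ?_
  obtain ⟨y, hy, hy'⟩ := exists_norm_tangentMap_eq k x v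
  have h1 := norm_apply_le_of_cross_ne_zero (planeDeriv k x) hab y
  rw [hy, ← hy'] at h1
  exact h1

theorem log_tangentNorm_le (k : Diff) (x : S2) {a b : S1} (hab : cross a b ≠ 0) :
    Real.log (tangentNorm k x) ≤ Real.log (4 / |cross a b|) +
      max (Real.log (stretch1 k (triv (x, a)))) (Real.log (stretch1 k (triv (x, b)))) := by
  have hpos : 0 < |cross a b| := abs_pos.2 hab
  have h1 := Real.log_le_log (tangentNorm_pos k x) (tangentNorm_le k x hab)
  have hm : 0 < max (stretch1 k (triv (x, a))) (stretch1 k (triv (x, b))) :=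
    lt_max_of_lt_left (stretch1_pos _ _)
  rw [Real.log_mul (by positivity) hm.ne'] at h1
  refine h1.trans (add_le_add le_rfl ?_)
  rcases max_choice (stretch1 k (triv (x, a))) (stretch1 k (triv (x, b))) with h | h <;> rw [h]
  · exact le_max_left _ _
  · exact le_max_right _ _

theorem log_stretch1_le (k : Diff) (x : S2) (c : S1) :
    Real.log (stretch1 k (triv (x, c))) ≤ Real.log (tangentNorm k x) := by
  have h1 := stretch1_le_tangentNorm k (triv (x, c))
  rw [triv_base] at h1
  exact Real.log_le_log (stretch1_pos _ _) h1

/-- Two independent directions suffice to find the growth rate of a cocycle. -/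
theorem tendsto_log_tangentNorm {k : ℕ → Diff} {x : S2} {a b : S1} (hab : cross a b ≠ 0) {l l' : ℝ}
    (ha : Tendsto (fun n : ℕ => (n : ℝ)⁻¹ * Real.log (stretch1 (k n) (triv (x, a)))) atTop (𝓝 l))
    (hb : Tendsto (fun n : ℕ => (n : ℝ)⁻¹ * Real.log (stretch1 (k n) (triv (x, b)))) atTop
      (𝓝 l')) :
    Tendsto (fun n : ℕ => (n : ℝ)⁻¹ * Real.log (tangentNorm (k n) x)) atTop (𝓝 (max l l')) := by
  have h1 := ha.max hb
  have h2 : Tendsto (fun n : ℕ => (n : ℝ)⁻¹ * Real.log (4 / |cross a b|) +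
      max ((n : ℝ)⁻¹ * Real.log (stretch1 (k n) (triv (x, a))))
        ((n : ℝ)⁻¹ * Real.log (stretch1 (k n) (triv (x, b))))) atTop (𝓝 (max l l')) := by
    have h3 := (tendsto_inv_atTop_nhds_zero_nat (𝕜 := ℝ)).mul_const (Real.log (4 / |cross a b|))
    rw [zero_mul] at h3
    simpa using h3.add h1
  refine tendsto_of_tendsto_of_tendsto_of_le_of_le h1 h2 (fun n => ?_) (fun n => ?_)
  · have hn : (0 : ℝ) ≤ (n : ℝ)⁻¹ := by positivity
    exact max_le (mul_le_mul_of_nonneg_left (log_stretch1_le _ _ _) hn)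
      (mul_le_mul_of_nonneg_left (log_stretch1_le _ _ _) hn)
  · have hn : (0 : ℝ) ≤ (n : ℝ)⁻¹ := by positivity
    have h3 := mul_le_mul_of_nonneg_left (log_tangentNorm_le (k n) x hab) hn
    rw [mul_add, mul_max_of_nonneg _ _ hn] at h3
    exact h3

theorem cross_ne_zero_of_ne {a b : S1} (h1 : b ≠ a) (h2 : (b : E2) ≠ -(a : E2)) :
    cross a b ≠ 0 := by
  intro h
  have na := E2.norm_sq (a : E2)
  have nb := E2.norm_sq (b : E2)
  rw [mem_sphere_zero_iff_norm.1 a.2] at na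
  rw [mem_sphere_zero_iff_norm.1 b.2] at nb
  unfold cross at h
  set p := (a : E2) 0
  set q := (a : E2) 1
  set r := (b : E2) 0
  set s := (b : E2) 1
  have hd : (p * r + q * s) ^ 2 = 1 := by nlinarith
  have hr : r = (p * r + q * s) * p := by linear_combination r * na - q * h
  have hs : s = (p * r + q * s) * q := by linear_combination s * na + p * h
  have hd' : (p * r + q * s - 1) * (p * r + q * s + 1) = 0 := by linear_combination hd
  rcases mul_eq_zero.1 hd' with h3 | h3
  · have h4 : p * r + q * s = 1 := by linarith
    rw [h4, one_mul] at hr hs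
    refine h1 (Subtype.ext (PiLp.ext fun i => ?_))
    fin_cases i
    · exact hr
    · exact hs
  · have h4 : p * r + q * s = -1 := by linarith
    rw [h4, neg_one_mul] at hr hs
    refine h2 (PiLp.ext fun i => ?_)
    fin_cases i
    · exact hr
    · exact hs

theorem ae_cross_ne_zero (a : S1) : ∀ᵐ c : S1 ∂circleLaw, cross a c ≠ 0 := by
  have h1 : ∀ᵐ c ∂circleLaw, c ≠ a := Measure.ae_ne circleLaw a
  have h2 : ∀ᵐ c ∂circleLaw, c ≠ -a := Measure.ae_ne circleLaw (-a)
  filter_upwards [h1, h2] with c hc1 hc2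
  exact cross_ne_zero_of_ne hc1 fun h => hc2 (Subtype.ext h)

/-- Any two independent directions have growth rates whose maximum is the rate `L` of the norm. If
one direction grows at another rate, every direction independent of it must grow at rate `L`, and
the excluded pair of opposite points is null. -/
theorem exists_tendsto_log_tangentNorm {k : ℕ → Diff} {x : S2} {s : Set S1}
    (hs : circleLaw s ≠ 0) {l : S1 → ℝ}
    (hl : ∀ᵐ c ∂circleLaw, c ∈ s →
      Tendsto (fun n : ℕ => (n : ℝ)⁻¹ * Real.log (stretch1 (k n) (triv (x, c)))) atTop (𝓝 (l c))) :
    ∃ L, Tendsto (fun n : ℕ => (n : ℝ)⁻¹ * Real.log (tangentNorm (k n) x)) atTop (𝓝 L) ∧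
      ∀ᵐ c ∂circleLaw, c ∈ s → l c = L := by
  have hpick : ∀ {p : S1 → Prop}, (∀ᵐ c ∂circleLaw, p c) → ∃ c ∈ s, p c := by
    intro p hp
    by_contra! hcon
    exact hs (measure_mono_null (fun c hc => hcon c hc) hp)
  obtain ⟨a, has, ha⟩ := hpick hl
  obtain ⟨b, hbs, hb, hab⟩ := hpick (hl.and (ae_cross_ne_zero a))
  have hL := tendsto_log_tangentNorm hab (ha has) (hb hbs)
  refine ⟨_, hL, ?_⟩
  set L := max (l a) (l b)
  by_cases h : ∃ c ∈ s, Tendsto (fun n : ℕ => (n : ℝ)⁻¹ * Real.log (stretch1 (k n) (triv (x, c))))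
      atTop (𝓝 (l c)) ∧ l c ≠ L
  · obtain ⟨c, -, hc, hcL⟩ := h
    filter_upwards [hl, ae_cross_ne_zero c] with d hd hcd hds
    have h1 := tendsto_nhds_unique hL (tendsto_log_tangentNorm hcd hc (hd hds))
    rcases max_choice (l c) (l d) with h2 | h2
    · exact absurd (h1.trans h2).symm hcL
    · exact (h1.trans h2).symm
  · push Not at h
    filter_upwards [hl] with d hd hds
    exact h d hds (hd hds)

/-! ### Measures with a density, fibre by fibre -/

theorem ae_withDensity_iff_fibre {φ : T1S2 → ℝ} (hφ : Measurable φ) {p : T1S2 → Prop}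
    (hp : MeasurableSet {u | p u}) :
    (∀ᵐ u ∂liouville1.withDensity (fun u => ENNReal.ofReal (φ u)), p u) ↔
      ∀ᵐ x ∂area, ∀ᵐ c ∂circleLaw, 0 < φ (triv (x, c)) → p (triv (x, c)) := by
  rw [ae_withDensity_iff hφ.ennreal_ofReal]
  have h1 : (fun u => ENNReal.ofReal (φ u) ≠ 0 → p u) = fun u => 0 < φ u → p u := by
    funext u
    rw [ne_eq, ENNReal.ofReal_eq_zero, not_le]
  have h2 : MeasurableSet {u | 0 < φ u → p u} := by
    have h3 : {u | 0 < φ u → p u} = {u | 0 < φ u}ᶜ ∪ {u | p u} := by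
      ext u; simp [imp_iff_not_or]
    rw [h3]
    exact (measurableSet_lt measurable_const hφ).compl.union hp
  rw [h1, liouville1_eq_map, ae_map_iff measurable_triv.aemeasurable h2]
  exact Measure.ae_prod_iff_ae_ae (measurable_triv h2)

/-- Projection to area says that the fibre integrals of the density have the same integral as one
over every set of base points. -/
theorem lintegral_density_fibre {φ : T1S2 → ℝ} (hφ : Measurable φ)
    (hb : (liouville1.withDensity fun u => ENNReal.ofReal (φ u)).map T1S2.base = area) :
    ∀ᵐ x ∂area, ∫⁻ c, ENNReal.ofReal (φ (triv (x, c))) ∂circleLaw = 1 := by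
  have hφt : Measurable fun q : S2 × S1 => ENNReal.ofReal (φ (triv q)) :=
    hφ.ennreal_ofReal.comp measurable_triv
  have hm : Measurable fun x => ∫⁻ c, ENNReal.ofReal (φ (triv (x, c))) ∂circleLaw :=
    hφt.lintegral_prod_right'
  refine ae_eq_of_forall_setLIntegral_eq_of_sigmaFinite hm measurable_const fun s hs _ => ?_
  have h1 : (liouville1.withDensity fun u => ENNReal.ofReal (φ u)).map T1S2.base s = area s := by
    rw [hb]
  have hbs : MeasurableSet (T1S2.base ⁻¹' s) := continuous_base.measurable hs
  rw [Measure.map_apply continuous_base.measurable hs, withDensity_apply _ hbs,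
    ← lintegral_indicator hbs, ← measurePreserving_triv.lintegral_comp
      (hφ.ennreal_ofReal.indicator hbs), lintegral_prod
      (fun q => (T1S2.base ⁻¹' s).indicator (fun u => ENNReal.ofReal (φ u)) (triv q))
      (((hφ.ennreal_ofReal.indicator hbs).comp measurable_triv).aemeasurable)] at h1
  rw [setLIntegral_const, one_mul, ← h1, ← lintegral_indicator hs]
  refine lintegral_congr fun x => ?_
  by_cases hx : x ∈ s
  · rw [Set.indicator_of_mem hx]
    refine lintegral_congr fun c => ?_
    rw [Set.indicator_of_mem]
    rwa [Set.mem_preimage, triv_base]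
  · rw [Set.indicator_of_notMem hx]
    refine (lintegral_eq_zero_of_ae_eq_zero (ae_of_all _ fun c => ?_)).symm
    rw [Set.indicator_of_notMem]
    · rfl
    · rwa [Set.mem_preimage, triv_base]

theorem circleLaw_density_pos {φ : T1S2 → ℝ} {x : S2}
    (hx : ∫⁻ c, ENNReal.ofReal (φ (triv (x, c))) ∂circleLaw = 1) :
    circleLaw {c | 0 < φ (triv (x, c))} ≠ 0 := by
  intro h
  have h1 : ∫⁻ c, ENNReal.ofReal (φ (triv (x, c))) ∂circleLaw = 0 := by
    refine lintegral_eq_zero_of_ae_eq_zero ?_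
    have h2 : ∀ᵐ c ∂circleLaw, ¬ 0 < φ (triv (x, c)) := measure_eq_zero_iff_ae_notMem.1 h
    filter_upwards [h2] with c hc
    exact ENNReal.ofReal_of_nonpos (not_lt.1 hc)
  rw [h1] at hx
  exact zero_ne_one hx

end DiffusedSphere
end

noncomputable section

namespace DiffusedSphere

/-! ### The random exponent -/

/-- The first and the second coordinate direction of the plane. -/
def axisDir (i : Fin 2) : S1 := ⟨EuclideanSpace.single i 1, by simp⟩

theorem cross_axisDir : cross (axisDir 0) (axisDir 1) ≠ 0 := by
  simp [cross, axisDir]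

/-- The logarithmic growth of the derivative cocycle, measured on a basis. -/
def basisGrowth (h : Diff) (n : ℕ) (q : S2 × (ℕ → SO3)) : ℝ :=
  (n : ℝ)⁻¹ * max (Real.log (stretch1 (iterDiff h q.2 n) (triv (q.1, axisDir 0))))
    (Real.log (stretch1 (iterDiff h q.2 n) (triv (q.1, axisDir 1))))

/-- The upper growth rate of the derivative cocycle. -/
def growthRate (h : Diff) (q : S2 × (ℕ → SO3)) : ℝ :=
  limsup (fun n => basisGrowth h n q) atTop

theorem measurable_log_stretch1_iterDiff (h : Diff) (n : ℕ) :
    Measurable fun p : T1S2 × (ℕ → SO3) => Real.log (stretch1 (iterDiff h p.2 n) p.1) := by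
  have h1 : Measurable fun p : T1S2 × (ℕ → SO3) => Real.log (stretch1 h p.1) :=
    (continuous_log_stretch1 h).measurable.comp measurable_fst
  have h2 := measurable_birkhoffSum (measurable_skew (measurable_act h)) h1 n
  have h3 : (fun p : T1S2 × (ℕ → SO3) => Real.log (stretch1 (iterDiff h p.2 n) p.1)) =
      birkhoffSum (skew fun g => sharp1 (coset h g)) (fun p => Real.log (stretch1 h p.1)) n :=
    funext fun p => log_stretch1_iterDiff h p.1 p.2 n
  rw [h3]
  exact h2

theorem measurable_growthRate (h : Diff) : Measurable (growthRate h) := by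
  refine Measurable.limsup fun n => ?_
  have h1 : ∀ c : S1, Measurable fun q : S2 × (ℕ → SO3) =>
      Real.log (stretch1 (iterDiff h q.2 n) (triv (q.1, c))) := by
    intro c
    have h2 : Measurable fun q : S2 × (ℕ → SO3) => (triv (q.1, c), q.2) :=
      (measurable_triv.comp (measurable_fst.prodMk measurable_const)).prodMk measurable_snd
    simpa only [Function.comp_def] using (measurable_log_stretch1_iterDiff h n).comp h2
  exact ((h1 _).max (h1 _)).const_mul _

/-- Two fixed coordinate directions control the operator norm up to a constant, which disappears
after division by `n`. This supplies a jointly measurable version of the growth rate, although the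
norm lives on varying planes. -/
theorem growthRate_eq {h : Diff} {x : S2} {w : ℕ → SO3} {L : ℝ}
    (hL : Tendsto (fun n : ℕ => (n : ℝ)⁻¹ * Real.log (tangentNorm (iterDiff h w n) x)) atTop
      (𝓝 L)) : growthRate h (x, w) = L := by
  refine Tendsto.limsup_eq ?_
  set C := Real.log (4 / |cross (axisDir 0) (axisDir 1)|)
  have h1 : Tendsto (fun n : ℕ => (n : ℝ)⁻¹ * Real.log (tangentNorm (iterDiff h w n) x) -
      (n : ℝ)⁻¹ * C) atTop (𝓝 L) := by
    have h3 := (tendsto_inv_atTop_nhds_zero_nat (𝕜 := ℝ)).mul_const C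
    rw [zero_mul] at h3
    simpa using hL.sub h3
  refine tendsto_of_tendsto_of_tendsto_of_le_of_le h1 hL (fun n => ?_) (fun n => ?_)
  · have hn : (0 : ℝ) ≤ (n : ℝ)⁻¹ := by positivity
    have h3 := mul_le_mul_of_nonneg_left
      (log_tangentNorm_le (iterDiff h w n) x cross_axisDir) hn
    rw [mul_add] at h3
    simp only [basisGrowth]
    linarith
  · have hn : (0 : ℝ) ≤ (n : ℝ)⁻¹ := by positivity
    exact mul_le_mul_of_nonneg_left (max_le (log_stretch1_le _ _ _) (log_stretch1_le _ _ _)) hn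

attribute [irreducible] growthRate basisGrowth

theorem ae_ae_swap {X Y : Type*} [MeasurableSpace X] [MeasurableSpace Y] {μ : Measure X}
    {ν : Measure Y} [SFinite μ] [SFinite ν] {p : X × Y → Prop} (hp : ∀ᵐ q ∂μ.prod ν, p q) :
    ∀ᵐ y ∂ν, ∀ᵐ x ∂μ, p (x, y) :=
  Measure.ae_ae_of_ae_prod
    ((Measure.measurePreserving_swap (μ := ν) (ν := μ)).quasiMeasurePreserving.ae hp)

theorem ae_prod_of_ae_ae_swap {X Y : Type*} [MeasurableSpace X] [MeasurableSpace Y] {μ : Measure X}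
    {ν : Measure Y} [SFinite μ] [SFinite ν] {p : X × Y → Prop} (hm : MeasurableSet {q | p q})
    (hp : ∀ᵐ y ∂ν, ∀ᵐ x ∂μ, p (x, y)) : ∀ᵐ q ∂μ.prod ν, p q := by
  have h1 : ∀ᵐ q ∂ν.prod μ, p q.swap :=
    (Measure.ae_prod_iff_ae_ae (p := fun q => p q.swap) (measurable_swap hm)).2 hp
  exact (Measure.measurePreserving_swap (μ := μ) (ν := ν)).quasiMeasurePreserving.ae h1

/-- The limit `lam` from Birkhoff's theorem is shown to be a function of base point and sequence, by
the comparison of directions. Ergodicity is needed only for the base skew product, and the constant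
is read off from the integral in Birkhoff's theorem. -/
theorem ae_growth {δ : ℝ} (hδ : 0 < δ) {h : Diff} (hp : MeasurePreserving h area area)
    {m : Measure T1S2} [IsProbabilityMeasure m] (hb : m.map T1S2.base = area)
    (hs : IsStationary (uniformBall δ) (fun g => sharp1 (coset h g)) m) {φ : T1S2 → ℝ}
    (hφ : Measurable φ) (hm : m = liouville1.withDensity fun u => ENNReal.ofReal (φ u)) :
    ∀ᵐ w ∂seqLaw (uniformBall δ),
      (∀ᵐ x ∂area, Tendsto
        (fun n : ℕ => (n : ℝ)⁻¹ * Real.log (tangentNorm (iterDiff h w n) x)) atTop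
        (𝓝 (∫ u, Real.log (stretch1 h u) ∂m))) ∧
      (∀ᵐ u ∂m, Tendsto
        (fun n : ℕ => (n : ℝ)⁻¹ * Real.log (stretch1 (iterDiff h w n) u)) atTop
        (𝓝 (∫ u, Real.log (stretch1 h u) ∂m))) := by
  have hν := isProbabilityMeasure_uniformBall hδ
  obtain ⟨C, hC⟩ := exists_abs_le_of_continuous (continuous_log_stretch1 h)
  set P := seqLaw (uniformBall δ)
  set T : T1S2 × (ℕ → SO3) → T1S2 × (ℕ → SO3) := skew fun g => sharp1 (coset h g) with hTdef
  set f : T1S2 × (ℕ → SO3) → ℝ := fun p => Real.log (stretch1 h p.1) with hfdef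
  have hf : Measurable f := (continuous_log_stretch1 h).measurable.comp measurable_fst
  have hfC : ∀ p, |f p| ≤ C := fun p => hC p.1
  have hT : MeasurePreserving T (m.prod P) (m.prod P) := measurePreserving_skew (measurable_act h) hs
  set lam := upperAverage T f
  have hlam : Measurable lam := measurable_upperAverage hT.measurable hf
  obtain ⟨hB, hBint⟩ := ae_tendsto_birkhoffAverage hT hf hfC
  have hG := measurable_growthRate h
  have hbase : Measurable fun p : T1S2 × (ℕ → SO3) => (p.1.base, p.2) :=
    (continuous_base.measurable.comp measurable_fst).prodMk measurable_snd
  have hGb : Measurable fun p : T1S2 × (ℕ → SO3) => growthRate h (p.1.base, p.2) := hG.comp hbase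
  have h1 : ∀ᵐ w ∂P, ∀ᵐ u ∂m, Tendsto
      (fun n : ℕ => (n : ℝ)⁻¹ * Real.log (stretch1 (iterDiff h w n) u)) atTop (𝓝 (lam (u, w))) := by
    filter_upwards [ae_ae_swap hB] with w hw
    filter_upwards [hw] with u hu
    refine hu.congr fun n => ?_
    rw [log_stretch1_iterDiff]
    rfl
  have hfib : ∀ᵐ x ∂area, ∫⁻ c, ENNReal.ofReal (φ (triv (x, c))) ∂circleLaw = 1 :=
    lintegral_density_fibre hφ (by rw [← hm, hb])
  -- Over almost every base point the density charges a set of positive circle measure, which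
  -- contains the two independent directions required.
  have h2 : ∀ᵐ w ∂P, (∀ᵐ x ∂area, Tendsto
        (fun n : ℕ => (n : ℝ)⁻¹ * Real.log (tangentNorm (iterDiff h w n) x)) atTop
        (𝓝 (growthRate h (x, w)))) ∧ ∀ᵐ u ∂m, lam (u, w) = growthRate h (u.base, w) := by
    filter_upwards [h1] with w hw
    have hlw : Measurable fun u => lam (u, w) := hlam.comp measurable_prodMk_right
    have hGw : Measurable fun u : T1S2 => growthRate h (u.base, w) :=
      hG.comp (continuous_base.measurable.prodMk measurable_const)
    have hset : MeasurableSet {u | Tendsto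
        (fun n : ℕ => (n : ℝ)⁻¹ * Real.log (stretch1 (iterDiff h w n) u)) atTop
        (𝓝 (lam (u, w)))} :=
      measurableSet_tendsto_fun
        (fun n => (continuous_log_stretch1 (iterDiff h w n)).measurable.const_mul _) hlw
    rw [hm, ae_withDensity_iff_fibre hφ hset] at hw
    have h3 : ∀ᵐ x ∂area, Tendsto
        (fun n : ℕ => (n : ℝ)⁻¹ * Real.log (tangentNorm (iterDiff h w n) x)) atTop
        (𝓝 (growthRate h (x, w))) ∧ ∀ᵐ c ∂circleLaw, 0 < φ (triv (x, c)) →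
          lam (triv (x, c), w) = growthRate h ((triv (x, c)).base, w) := by
      filter_upwards [hw, hfib] with x hx hx1
      obtain ⟨L, hL, hL'⟩ := exists_tendsto_log_tangentNorm (circleLaw_density_pos hx1) hx
      rw [growthRate_eq hL]
      refine ⟨hL, ?_⟩
      filter_upwards [hL'] with c hc hpos
      rw [triv_base, growthRate_eq hL]
      exact hc hpos
    refine ⟨h3.mono fun x hx => hx.1, ?_⟩
    rw [hm, ae_withDensity_iff_fibre hφ (measurableSet_eq_fun hlw hGw)]
    exact h3.mono fun x hx => hx.2
  have h4 : ∀ᵐ p ∂m.prod P, lam p = growthRate h (p.1.base, p.2) :=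
    ae_prod_of_ae_ae_swap (measurableSet_eq_fun hlam hGb) (h2.mono fun w hw => hw.2)
  have hmap : (m.prod P).map (fun p : T1S2 × (ℕ → SO3) => (p.1.base, p.2)) = area.prod P := by
    have h5 := Measure.map_prod_map m P continuous_base.measurable measurable_id
    rw [hb, Measure.map_id] at h5
    exact h5.symm
  have hS := ergodic_skew_area hδ hp
  -- Invariance of the growth rate on the base is inherited from that of `lam` upstairs, through the
  -- projection that intertwines the skew products.
  have hinv : ∀ᵐ q ∂area.prod P,
      growthRate h (skew (fun (g : SO3) (x : S2) => coset h g x) q) = growthRate h q := by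
    have h5 : MeasurableSet {q : S2 × (ℕ → SO3) |
        growthRate h (skew (fun (g : SO3) (x : S2) => coset h g x) q) = growthRate h q} :=
      measurableSet_eq_fun (hG.comp hS.measurable) hG
    rw [← hmap, ae_map_iff hbase.aemeasurable h5]
    filter_upwards [h4, hT.quasiMeasurePreserving.ae h4] with p hp1 hp2
    rw [base_skew, ← hp2, ← hp1]
    exact upperAverage_comp hfC p
  obtain ⟨R, hR⟩ := ae_eq_const_of_skew_invariant hS hG hinv
  have hR1 : ∀ᵐ p ∂m.prod P, lam p = R := by
    have h5 : ∀ᵐ p ∂m.prod P, growthRate h (p.1.base, p.2) = R :=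
      (⟨hbase, hmap⟩ : MeasurePreserving _ _ _).quasiMeasurePreserving.ae hR
    filter_upwards [h4, h5] with p hp1 hp2
    rw [hp1, hp2]
  have hRint : ∫ u, Real.log (stretch1 h u) ∂m = R := by
    have h5 : ∫ p, lam p ∂m.prod P = R := by
      rw [integral_congr_ae hR1]
      simp
    have h6 : ∫ p, f p ∂m.prod P = ∫ u, Real.log (stretch1 h u) ∂m := by
      rw [hfdef, integral_fun_fst fun u => Real.log (stretch1 h u)]
      simp
    rw [← h5, hBint, h6]
  rw [hRint]
  filter_upwards [h1, h2, ae_ae_swap hR, ae_ae_swap hR1] with w hw1 hw2 hw3 hw4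
  constructor
  · filter_upwards [hw2.1, hw3] with x hx1 hx2
    rwa [hx2] at hx1
  · filter_upwards [hw1, hw4] with u hu1 hu2
    rwa [hu2] at hu1

theorem hasRandomExponent {δ : ℝ} (hδ : 0 < δ) {h : Diff} (hp : MeasurePreserving h area area)
    {m : Measure T1S2} [IsProbabilityMeasure m] (hb : m.map T1S2.base = area)
    (hs : IsStationary (uniformBall δ) (fun g => sharp1 (coset h g)) m) {φ : T1S2 → ℝ}
    (hφ : Measurable φ) (hm : m = liouville1.withDensity fun u => ENNReal.ofReal (φ u)) :
    HasRandomExponent (uniformBall δ) (coset h) (∫ u, Real.log (stretch1 h u) ∂m) := by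
  have hν := isProbabilityMeasure_uniformBall hδ
  filter_upwards [ae_growth hδ hp hb hs hφ hm] with w hw
  refine ⟨fun _ => ∫ u, Real.log (stretch1 h u) ∂m, integrable_const _, ?_, by simp⟩
  simp only [one_div]
  exact hw.1

end DiffusedSphere
end

noncomputable section

namespace DiffusedSphere

/-! ### Contraction of angles -/

theorem abs_cross_map (A : E2 →ₗ[ℝ] E2) (a b : E2) :
    |cross (A a) (A b)| = |LinearMap.det A| * |cross a b| := by
  rw [← abs_mul]
  congr 1
  let b2 := (EuclideanSpace.basisFun (Fin 2) ℝ).toBasis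
  have hdecomp : ∀ y : E2, A y = y 0 • A (EuclideanSpace.single 0 1) +
      y 1 • A (EuclideanSpace.single 1 1) := by
    intro y
    rw [← map_smul, ← map_smul, ← map_add]
    congr 1
    ext i; fin_cases i <;> simp
  have e2 : ∀ i j, LinearMap.toMatrix b2 b2 A i j = A (EuclideanSpace.single j 1) i :=
    fun i j => by simp [LinearMap.toMatrix_apply, b2]
  rw [← LinearMap.det_toMatrix b2, Matrix.det_fin_two]
  simp only [e2]
  rw [hdecomp a, hdecomp b]
  simp only [cross, PiLp.add_apply, PiLp.smul_apply, smul_eq_mul]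
  ring

theorem cross_smul_smul (s t : ℝ) (a b : E2) : cross (s • a) (t • b) = s * t * cross a b := by
  simp only [cross, PiLp.smul_apply, smul_eq_mul]
  ring

/-- The area of the parallelogram on `a` and `b` is preserved, so after normalizing the images it is
divided by the product of their stretches. -/
theorem abs_cross_dir_le {k : Diff} {x : S2} (hk : absDet k x = 1) (a b : S1) :
    |cross (dir (planeDeriv k x a)) (dir (planeDeriv k x b))| ≤
      2 * ((stretch1 k (triv (x, a)))⁻¹ * (stretch1 k (triv (x, b)))⁻¹) := by
  rw [coe_dir (planeDeriv_ne_zero k x a), coe_dir (planeDeriv_ne_zero k x b), cross_smul_smul,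
    abs_mul, abs_cross_map, abs_det_planeDeriv, hk, one_mul, stretch1_triv, stretch1_triv,
    abs_of_nonneg (by positivity), mul_comm]
  have h1 := abs_cross_le (a : E2) b
  rw [mem_sphere_zero_iff_norm.1 a.2, mem_sphere_zero_iff_norm.1 b.2] at h1
  exact mul_le_mul_of_nonneg_right (by linarith) (by positivity)

theorem dist_triv (x : S2) (a b : S1) : dist (triv (x, a)) (triv (x, b)) = ‖(a : E2) - b‖ := by
  rw [Subtype.dist_eq, Prod.dist_eq, triv_fst, triv_fst, dist_self, triv_snd, triv_snd,
    dist_eq_norm, ← rotLin_apply, ← rotLin_apply, ← map_sub, LinearIsometryEquiv.norm_map]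
  have h1 : planeVec (a : E2) - planeVec b = planeVec ((a : E2) - b) :=
    (map_sub planeLin (a : E2) b).symm
  rw [h1, norm_planeVec]
  exact max_eq_right (norm_nonneg _)

theorem antip_triv (x : S2) (a : S1) : antip (triv (x, a)) = triv (x, -a) := by
  refine T1S2.ext' ?_ ?_
  · rw [triv_fst]
    exact triv_fst _
  · change -(triv (x, a)).1.2 = _
    rw [triv_snd, triv_snd, ← rotLin_apply, ← rotLin_apply, ← map_neg]
    congr 1
    exact (map_neg planeLin (a : E2)).symm

/-- With `α` the angle between the vectors, the left side is `(2 - 2 cos α)(2 + 2 cos α) = 4 sin²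
α`. A small area thus means that the vectors are nearly equal or nearly opposite. -/
theorem norm_sub_sq_mul_norm_add_sq (a b : S1) :
    ‖(a : E2) - b‖ ^ 2 * ‖(a : E2) + b‖ ^ 2 = 4 * |cross a b| ^ 2 := by
  have na := E2.norm_sq (a : E2)
  have nb := E2.norm_sq (b : E2)
  rw [mem_sphere_zero_iff_norm.1 a.2] at na
  rw [mem_sphere_zero_iff_norm.1 b.2] at nb
  rw [E2.norm_sq, E2.norm_sq, sq_abs, cross]
  simp only [PiLp.add_apply, PiLp.sub_apply]
  generalize (a : E2) 0 = p at *
  generalize (a : E2) 1 = q at *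
  generalize (b : E2) 0 = r at *
  generalize (b : E2) 1 = s at *
  have e1 : (p - r) ^ 2 + (q - s) ^ 2 = 2 - 2 * (p * r + q * s) := by linarith
  have e2 : (p + r) ^ 2 + (q + s) ^ 2 = 2 + 2 * (p * r + q * s) := by linarith
  rw [e1, e2]
  have e3 : (p ^ 2 + q ^ 2) * (r ^ 2 + s ^ 2) = 1 := by rw [← na, ← nb]; norm_num
  linear_combination (-4) * e3

/-- An even continuous function does not distinguish directions that span a small area. -/
theorem exists_abs_sub_lt_of_cross {F : T1S2 → ℝ} (hF : Continuous F)
    (he : ∀ u, F (antip u) = F u) {ε : ℝ} (hε : 0 < ε) :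
    ∃ η > 0, ∀ (x : S2) (a b : S1), |cross a b| < η → |F (triv (x, a)) - F (triv (x, b))| < ε := by
  have huc := CompactSpace.uniformContinuous_of_continuous hF
  obtain ⟨ρ, hρ, hρ'⟩ := Metric.uniformContinuous_iff.1 huc ε hε
  -- If both `‖a - b‖` and `‖a + b‖` were at least `ρ`, the identity would give `ρ ^ 4 ≤ 4 * |cross
  -- a b| ^ 2 < ρ ^ 4`.
  refine ⟨ρ ^ 2 / 2, by positivity, fun x a b hab => ?_⟩
  have h1 := norm_sub_sq_mul_norm_add_sq a b
  have h2 : ‖(a : E2) - b‖ < ρ ∨ ‖(a : E2) + b‖ < ρ := by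
    by_contra! hcon
    have h3 : ρ ^ 2 ≤ ‖(a : E2) - b‖ ^ 2 := pow_le_pow_left₀ hρ.le hcon.1 2
    have h4 : ρ ^ 2 ≤ ‖(a : E2) + b‖ ^ 2 := pow_le_pow_left₀ hρ.le hcon.2 2
    have h5 := mul_le_mul h3 h4 (by positivity) (by positivity)
    have h6 : |cross a b| ^ 2 < (ρ ^ 2 / 2) ^ 2 := pow_lt_pow_left₀ hab (abs_nonneg _) two_ne_zero
    nlinarith
  rcases h2 with h2 | h2
  · have h3 := hρ' (a := triv (x, a)) (b := triv (x, b)) (by rwa [dist_triv])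
    rwa [Real.dist_eq] at h3
  · have h3 := hρ' (a := triv (x, a)) (b := triv (x, -b)) (by
      rw [dist_triv]
      have h4 : ((-b : S1) : E2) = -(b : E2) := rfl
      rwa [h4, sub_neg_eq_add])
    rw [← antip_triv, he] at h3
    rwa [Real.dist_eq] at h3

theorem tendsto_sub_of_stretch {F : T1S2 → ℝ} (hF : Continuous F) (he : ∀ u, F (antip u) = F u)
    {k : ℕ → Diff} {x : S2} (hk : ∀ n, absDet (k n) x = 1) {a b : S1}
    (ha : Tendsto (fun n => stretch1 (k n) (triv (x, a))) atTop atTop)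
    (hb : Tendsto (fun n => stretch1 (k n) (triv (x, b))) atTop atTop) :
    Tendsto (fun n => F (sharp1 (k n) (triv (x, a))) - F (sharp1 (k n) (triv (x, b)))) atTop
      (𝓝 0) := by
  rw [Metric.tendsto_nhds]
  intro ε hε
  obtain ⟨η, hη, hη'⟩ := exists_abs_sub_lt_of_cross hF he hε
  have h1 : Tendsto (fun n => 2 * ((stretch1 (k n) (triv (x, a)))⁻¹ *
      (stretch1 (k n) (triv (x, b)))⁻¹)) atTop (𝓝 0) := by
    simpa using (ha.inv_tendsto_atTop.mul hb.inv_tendsto_atTop).const_mul 2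
  filter_upwards [h1.eventually (gt_mem_nhds hη)] with n hn
  rw [Real.dist_eq, sub_zero, sharp1_triv, sharp1_triv]
  exact hη' _ _ _ ((abs_cross_dir_le (hk n) a b).trans_lt hn)

theorem integrable_density_fibre {φ : T1S2 → ℝ} (hφ : Measurable φ) (h0 : ∀ u, 0 ≤ φ u) {x : S2}
    (hx : ∫⁻ c, ENNReal.ofReal (φ (triv (x, c))) ∂circleLaw = 1) :
    Integrable (fun c => φ (triv (x, c))) circleLaw ∧ ∫ c, φ (triv (x, c)) ∂circleLaw = 1 := by
  have hφm : Measurable fun c => φ (triv (x, c)) := hφ.comp (measurable_triv_left x)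
  refine ⟨⟨hφm.aestronglyMeasurable, ?_⟩, ?_⟩
  · rw [hasFiniteIntegral_iff_ofReal (ae_of_all _ fun c => h0 _), hx]
    exact ENNReal.one_lt_top
  · rw [integral_eq_lintegral_of_nonneg_ae (ae_of_all _ fun c => h0 _) hφm.aestronglyMeasurable, hx]
    rfl

/-- All stretched directions in one fibre are asymptotically the same line, so for even `F` the
fibre measure acts in the limit as a point mass on the image of any one of them. -/
theorem tendsto_integral_fibre {F : T1S2 → ℝ} (hF : Continuous F) (he : ∀ u, F (antip u) = F u)
    {k : ℕ → Diff} {x : S2} (hk : ∀ n, absDet (k n) x = 1) {φ : T1S2 → ℝ} (hφ : Measurable φ)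
    (h0 : ∀ u, 0 ≤ φ u) (hx : ∫⁻ c, ENNReal.ofReal (φ (triv (x, c))) ∂circleLaw = 1) {a : S1}
    (ha : Tendsto (fun n => stretch1 (k n) (triv (x, a))) atTop atTop)
    (hg : ∀ᵐ c ∂circleLaw, 0 < φ (triv (x, c)) →
      Tendsto (fun n => stretch1 (k n) (triv (x, c))) atTop atTop) :
    Tendsto (fun n => ∫ c, φ (triv (x, c)) * F (sharp1 (k n) (triv (x, c))) ∂circleLaw -
      F (sharp1 (k n) (triv (x, a)))) atTop (𝓝 0) := by
  obtain ⟨C, hC⟩ := exists_abs_le_of_continuous hF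
  have hφm : Measurable fun c => φ (triv (x, c)) := hφ.comp (measurable_triv_left x)
  obtain ⟨hφi, hφ1⟩ := integrable_density_fibre hφ h0 hx
  have hFm : ∀ n, Measurable fun c => F (sharp1 (k n) (triv (x, c))) := fun n =>
    (hF.comp (continuous_sharp1 (k n))).measurable.comp (measurable_triv_left x)
  have hFi : ∀ n, Integrable (fun c => φ (triv (x, c)) * F (sharp1 (k n) (triv (x, c))))
      circleLaw := fun n =>
    hφi.mul_bdd (c := C) (hFm n).aestronglyMeasurable (ae_of_all _ fun c => hC _)
  have h1 : ∀ n, ∫ c, φ (triv (x, c)) * F (sharp1 (k n) (triv (x, c))) ∂circleLaw -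
      F (sharp1 (k n) (triv (x, a))) = ∫ c, φ (triv (x, c)) *
        (F (sharp1 (k n) (triv (x, c))) - F (sharp1 (k n) (triv (x, a)))) ∂circleLaw := by
    intro n
    simp_rw [mul_sub]
    rw [integral_sub (hFi n) (hφi.mul_const _), integral_mul_const, hφ1, one_mul]
  simp_rw [h1]
  have h2 : ∫ _ : S1, (0 : ℝ) ∂circleLaw = 0 := integral_zero _ _
  rw [← h2]
  refine tendsto_integral_of_dominated_convergence (fun c => φ (triv (x, c)) * (2 * C))
    (fun n => (hφm.mul ((hFm n).sub_const _)).aestronglyMeasurable) (hφi.mul_const _)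
    (fun n => ae_of_all _ fun c => ?_) ?_
  · rw [norm_mul, Real.norm_of_nonneg (h0 _)]
    refine mul_le_mul_of_nonneg_left ((norm_sub_le _ _).trans ?_) (h0 _)
    have e1 := hC (sharp1 (k n) (triv (x, c)))
    have e2 := hC (sharp1 (k n) (triv (x, a)))
    rw [Real.norm_eq_abs, Real.norm_eq_abs]
    linarith
  · filter_upwards [hg] with c hc
    rcases (h0 (triv (x, c))).eq_or_lt with h | h
    · simp [← h]
    · simpa using (tendsto_sub_of_stretch hF he hk (hc h) ha).const_mul (φ (triv (x, c)))

theorem integral_density_fibre {φ : T1S2 → ℝ} (hφ : Measurable φ) (h0 : ∀ u, 0 ≤ φ u)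
    {m : Measure T1S2} [IsProbabilityMeasure m]
    (hm : m = liouville1.withDensity fun u => ENNReal.ofReal (φ u)) {F : T1S2 → ℝ} {C : ℝ}
    (hF : Measurable F) (hC : ∀ u, |F u| ≤ C) :
    Integrable (fun x => ∫ c, φ (triv (x, c)) * F (triv (x, c)) ∂circleLaw) area ∧
    ∫ u, F u ∂m = ∫ x, ∫ c, φ (triv (x, c)) * F (triv (x, c)) ∂circleLaw ∂area := by
  have hφi : Integrable φ liouville1 := by
    refine ⟨hφ.aestronglyMeasurable, ?_⟩
    rw [hasFiniteIntegral_iff_ofReal (ae_of_all _ h0)]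
    have h1 : m Set.univ = 1 := measure_univ
    rw [hm, withDensity_apply _ MeasurableSet.univ, setLIntegral_univ] at h1
    rw [h1]
    exact ENNReal.one_lt_top
  have hi : Integrable (fun u => φ u * F u) liouville1 :=
    hφi.mul_bdd (c := C) hF.aestronglyMeasurable (ae_of_all _ hC)
  have hi2 : Integrable (fun q : S2 × S1 => φ (triv q) * F (triv q)) (area.prod circleLaw) := by
    rw [liouville1_eq_map] at hi
    exact hi.comp_measurable measurable_triv
  refine ⟨hi2.integral_prod_left, ?_⟩
  rw [hm, integral_withDensity_ofReal hφ h0, liouville1_eq_map,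
    integral_map measurable_triv.aemeasurable
      (show Measurable fun u => φ u * F u from hφ.mul hF).aestronglyMeasurable]
  exact integral_prod _ hi2

theorem tendsto_integral_sub {F : T1S2 → ℝ} (hF : Continuous F) (he : ∀ u, F (antip u) = F u)
    {k : ℕ → Diff} (hk : ∀ n x, absDet (k n) x = 1) {m₁ m₂ : Measure T1S2}
    [IsProbabilityMeasure m₁] [IsProbabilityMeasure m₂] {φ₁ φ₂ : T1S2 → ℝ} (hφ₁ : Measurable φ₁)
    (hφ₂ : Measurable φ₂) (h₁ : ∀ u, 0 ≤ φ₁ u) (h₂ : ∀ u, 0 ≤ φ₂ u)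
    (hm₁ : m₁ = liouville1.withDensity fun u => ENNReal.ofReal (φ₁ u))
    (hm₂ : m₂ = liouville1.withDensity fun u => ENNReal.ofReal (φ₂ u))
    (hb₁ : m₁.map T1S2.base = area) (hb₂ : m₂.map T1S2.base = area)
    (hg₁ : ∀ᵐ u ∂m₁, Tendsto (fun n => stretch1 (k n) u) atTop atTop)
    (hg₂ : ∀ᵐ u ∂m₂, Tendsto (fun n => stretch1 (k n) u) atTop atTop) :
    Tendsto (fun n => ∫ u, F (sharp1 (k n) u) ∂m₁ - ∫ u, F (sharp1 (k n) u) ∂m₂) atTop (𝓝 0) := by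
  obtain ⟨C, hC⟩ := exists_abs_le_of_continuous hF
  have hFm : ∀ n, Measurable fun u => F (sharp1 (k n) u) := fun n =>
    (hF.comp (continuous_sharp1 (k n))).measurable
  have hd₁ := fun n => integral_density_fibre hφ₁ h₁ hm₁ (hFm n) fun u => hC _
  have hd₂ := fun n => integral_density_fibre hφ₂ h₂ hm₂ (hFm n) fun u => hC _
  have hset : MeasurableSet {u | Tendsto (fun n => stretch1 (k n) u) atTop atTop} :=
    measurableSet_tendsto atTop fun n => (continuous_stretch1 (k n)).measurable
  have hf₁ := lintegral_density_fibre hφ₁ (by rw [← hm₁, hb₁])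
  have hf₂ := lintegral_density_fibre hφ₂ (by rw [← hm₂, hb₂])
  rw [hm₁, ae_withDensity_iff_fibre hφ₁ hset] at hg₁
  rw [hm₂, ae_withDensity_iff_fibre hφ₂ hset] at hg₂
  have hbd : ∀ {φ : T1S2 → ℝ} (_ : Measurable φ) (_ : ∀ u, 0 ≤ φ u) (n : ℕ) (x : S2)
      (_ : ∫⁻ c, ENNReal.ofReal (φ (triv (x, c))) ∂circleLaw = 1),
      |∫ c, φ (triv (x, c)) * F (sharp1 (k n) (triv (x, c))) ∂circleLaw| ≤ C := by
    intro φ hφ h0 n x hx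
    obtain ⟨hφi, hφ1⟩ := integrable_density_fibre hφ h0 hx
    have h3 := norm_integral_le_of_norm_le (hφi.mul_const C)
      (f := fun c => φ (triv (x, c)) * F (sharp1 (k n) (triv (x, c)))) (ae_of_all _ fun c => by
        rw [norm_mul, Real.norm_of_nonneg (h0 _)]
        exact mul_le_mul_of_nonneg_left (hC _) (h0 _))
    rwa [integral_mul_const, hφ1, one_mul] at h3
  have h3 : ∀ n, ∫ u, F (sharp1 (k n) u) ∂m₁ - ∫ u, F (sharp1 (k n) u) ∂m₂ =
      ∫ x, (∫ c, φ₁ (triv (x, c)) * F (sharp1 (k n) (triv (x, c))) ∂circleLaw -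
        ∫ c, φ₂ (triv (x, c)) * F (sharp1 (k n) (triv (x, c))) ∂circleLaw) ∂area := fun n => by
    rw [(hd₁ n).2, (hd₂ n).2, integral_sub (hd₁ n).1 (hd₂ n).1]
  simp_rw [h3]
  have h4 : ∫ _ : S2, (0 : ℝ) ∂area = 0 := integral_zero _ _
  rw [← h4]
  refine tendsto_integral_of_dominated_convergence (fun _ => 2 * C)
    (fun n => ((hd₁ n).1.sub (hd₂ n).1).aestronglyMeasurable) (integrable_const _)
    (fun n => ?_) ?_
  · filter_upwards [hf₁, hf₂] with x hx₁ hx₂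
    refine (norm_sub_le _ _).trans ?_
    have e1 := hbd hφ₁ h₁ n x hx₁
    have e2 := hbd hφ₂ h₂ n x hx₂
    rw [Real.norm_eq_abs, Real.norm_eq_abs]
    linarith
  · filter_upwards [hf₁, hf₂, hg₁, hg₂] with x hx₁ hx₂ hgx₁ hgx₂
    -- The reference direction comes from the first measure but serves for both fibre integrals;
    -- this ties the two measures together without any overlap of their densities.
    obtain ⟨a, ha⟩ : ∃ a, Tendsto (fun n => stretch1 (k n) (triv (x, a))) atTop atTop := by
      by_contra! hcon
      refine circleLaw_density_pos hx₁ (measure_mono_null (fun c hc => ?_) hgx₁)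
      exact fun h => hcon c (h hc)
    have t1 := tendsto_integral_fibre hF he (fun n => hk n x) hφ₁ h₁ hx₁ ha hgx₁
    have t2 := tendsto_integral_fibre hF he (fun n => hk n x) hφ₂ h₂ hx₂ ha hgx₂
    simpa using t1.sub t2

end DiffusedSphere
end

noncomputable section

namespace DiffusedSphere

/-! ### Uniqueness of the stationary measure -/

theorem measurePreserving_coset {h : Diff} (hp : MeasurePreserving h area area) (g : SO3) :
    MeasurePreserving (coset h g) area area :=
  (measurePreserving_smul_area g).comp hp

theorem measurePreserving_iterDiff {h : Diff} (hp : MeasurePreserving h area area)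
    (w : ℕ → SO3) (n : ℕ) : MeasurePreserving (iterDiff h w n) area area := by
  induction n with
  | zero => exact MeasurePreserving.id area
  | succ n ih => exact (measurePreserving_coset hp (w n)).comp ih

/-- The iterated skew product preserves `m.prod P`, so averaging over sequences undoes the effect of
the random composition. -/
theorem integral_iterDiff {δ : ℝ} (hδ : 0 < δ) {h : Diff} {m : Measure T1S2}
    [IsProbabilityMeasure m] (hs : IsStationary (uniformBall δ) (fun g => sharp1 (coset h g)) m)
    {F : T1S2 → ℝ} (hF : Continuous F) (n : ℕ) :
    Integrable (fun w => ∫ u, F (sharp1 (iterDiff h w n) u) ∂m) (seqLaw (uniformBall δ)) ∧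
    ∫ w, ∫ u, F (sharp1 (iterDiff h w n) u) ∂m ∂seqLaw (uniformBall δ) = ∫ u, F u ∂m := by
  have hν := isProbabilityMeasure_uniformBall hδ
  obtain ⟨C, hC⟩ := exists_abs_le_of_continuous hF
  set P := seqLaw (uniformBall δ)
  have hT : MeasurePreserving (skew fun g => sharp1 (coset h g)) (m.prod P) (m.prod P) :=
    measurePreserving_skew (measurable_act h) hs
  have hTn := hT.iterate n
  have hFm : Measurable fun p : T1S2 × (ℕ → SO3) => F p.1 := hF.measurable.comp measurable_fst
  have h1 : Measurable fun p : T1S2 × (ℕ → SO3) => F (sharp1 (iterDiff h p.2 n) p.1) := by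
    have h2 := hFm.comp hTn.measurable
    have h3 : ((fun p : T1S2 × (ℕ → SO3) => F p.1) ∘ (skew fun g => sharp1 (coset h g))^[n]) =
        fun p : T1S2 × (ℕ → SO3) => F (sharp1 (iterDiff h p.2 n) p.1) := by
      funext p
      rw [Function.comp_apply, iterate_skew_sharp1 h p.1 p.2 n]
    rwa [h3] at h2
  have h2 : Integrable (fun p : T1S2 × (ℕ → SO3) => F (sharp1 (iterDiff h p.2 n) p.1))
      (m.prod P) :=
    Integrable.of_bound h1.aestronglyMeasurable C (ae_of_all _ fun p => hC _)
  refine ⟨h2.integral_prod_right, ?_⟩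
  have h3 : ∫ p : T1S2 × (ℕ → SO3), F p.1 ∂m.prod P = ∫ u, F u ∂m := by
    rw [integral_fun_fst F]
    simp
  rw [← h3]
  conv_rhs => rw [← hTn.map_eq]
  rw [integral_map hTn.measurable.aemeasurable hFm.aestronglyMeasurable]
  have h4 : ∀ p : T1S2 × (ℕ → SO3), F ((skew fun g => sharp1 (coset h g))^[n] p).1 =
      F (sharp1 (iterDiff h p.2 n) p.1) := fun p => by rw [iterate_skew_sharp1 h p.1 p.2 n]
  simp_rw [h4]
  exact (integral_prod_symm _ h2).symm

theorem tendsto_stretch1_atTop {k : ℕ → Diff} {u : T1S2} {R : ℝ} (hR : 0 < R)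
    (h : Tendsto (fun n : ℕ => (n : ℝ)⁻¹ * Real.log (stretch1 (k n) u)) atTop (𝓝 R)) :
    Tendsto (fun n => stretch1 (k n) u) atTop atTop := by
  have h1 : Tendsto (fun n : ℕ => (n : ℝ) * ((n : ℝ)⁻¹ * Real.log (stretch1 (k n) u))) atTop atTop :=
    tendsto_natCast_atTop_atTop.atTop_mul_pos hR h
  refine (Real.tendsto_exp_atTop.comp h1).congr' ?_
  filter_upwards [eventually_ne_atTop 0] with n hn
  have hn' : (n : ℝ) ≠ 0 := Nat.cast_ne_zero.2 hn
  rw [Function.comp_apply, ← mul_assoc, mul_inv_cancel₀ hn', one_mul,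
    Real.exp_log (stretch1_pos _ _)]

/-- For almost every sequence the difference of the integrals of an even function tends to zero; its
mean over sequences does not depend on `n`, so the original difference is zero. -/
theorem eq_of_isStationary {δ : ℝ} (hδ : 0 < δ) {h : Diff} (hp : MeasurePreserving h area area)
    (hiso : ¬ Isometry h) {m₁ m₂ : Measure T1S2} [IsProbabilityMeasure m₁]
    [IsProbabilityMeasure m₂] (ha₁ : m₁.map antip = m₁) (ha₂ : m₂.map antip = m₂)
    (hb₁ : m₁.map T1S2.base = area) (hb₂ : m₂.map T1S2.base = area)
    (hs₁ : IsStationary (uniformBall δ) (fun g => sharp1 (coset h g)) m₁)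
    (hs₂ : IsStationary (uniformBall δ) (fun g => sharp1 (coset h g)) m₂)
    {φ₁ φ₂ : T1S2 → ℝ} (hφ₁ : Continuous φ₁) (hφ₂ : Continuous φ₂)
    (h₁ : ∀ u, 0 ≤ φ₁ u) (h₂ : ∀ u, 0 ≤ φ₂ u)
    (hf₁ : conv δ (pushDensity h φ₁) = φ₁) (hf₂ : conv δ (pushDensity h φ₂) = φ₂)
    (hm₁ : m₁ = liouville1.withDensity fun u => ENNReal.ofReal (φ₁ u))
    (hm₂ : m₂ = liouville1.withDensity fun u => ENNReal.ofReal (φ₂ u)) : m₁ = m₂ := by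
  have hν := isProbabilityMeasure_uniformBall hδ
  have hR₁ := integral_log_stretch1_pos hδ hp hiso hφ₁ h₁ hf₁ hm₁
  have hR₂ := integral_log_stretch1_pos hδ hp hiso hφ₂ h₂ hf₂ hm₂
  have heven : ∀ F : T1S2 → ℝ, Continuous F → (∀ u, F (antip u) = F u) →
      ∫ u, F u ∂m₁ = ∫ u, F u ∂m₂ := by
    intro F hF he
    obtain ⟨C, hC⟩ := exists_abs_le_of_continuous hF
    have hd₁ := integral_iterDiff hδ hs₁ hF
    have hd₂ := integral_iterDiff hδ hs₂ hF
    have hlim : ∀ᵐ w ∂seqLaw (uniformBall δ), Tendsto (fun n =>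
        ∫ u, F (sharp1 (iterDiff h w n) u) ∂m₁ - ∫ u, F (sharp1 (iterDiff h w n) u) ∂m₂)
        atTop (𝓝 0) := by
      filter_upwards [ae_growth hδ hp hb₁ hs₁ hφ₁.measurable hm₁,
        ae_growth hδ hp hb₂ hs₂ hφ₂.measurable hm₂] with w hw₁ hw₂
      exact tendsto_integral_sub hF he
        (fun n x => absDet_eq_one _ (measurePreserving_iterDiff hp w n) x) hφ₁.measurable
        hφ₂.measurable h₁ h₂ hm₁ hm₂ hb₁ hb₂ (hw₁.2.mono fun u hu => tendsto_stretch1_atTop hR₁ hu)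
        (hw₂.2.mono fun u hu => tendsto_stretch1_atTop hR₂ hu)
    have hbd : ∀ (m : Measure T1S2) [IsProbabilityMeasure m] (k : Diff),
        |∫ u, F (sharp1 k u) ∂m| ≤ C := by
      intro m _ k
      have h3 := norm_integral_le_of_norm_le_const (μ := m) (C := C)
        (f := fun u => F (sharp1 k u)) (ae_of_all _ fun u => hC _)
      simpa using h3
    have hdct := tendsto_integral_of_dominated_convergence (fun _ => 2 * C)
      (fun n => ((hd₁ n).1.sub (hd₂ n).1).aestronglyMeasurable)
      (integrable_const (μ := seqLaw (uniformBall δ)) _) (fun n => ae_of_all _ fun w => ?_) hlim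
    · have hval : ∀ n, ∫ w, (∫ u, F (sharp1 (iterDiff h w n) u) ∂m₁ -
          ∫ u, F (sharp1 (iterDiff h w n) u) ∂m₂) ∂seqLaw (uniformBall δ) =
          ∫ u, F u ∂m₁ - ∫ u, F u ∂m₂ := fun n => by
        rw [integral_sub (hd₁ n).1 (hd₂ n).1, (hd₁ n).2, (hd₂ n).2]
      have h3 : Tendsto (fun _ : ℕ => ∫ u, F u ∂m₁ - ∫ u, F u ∂m₂) atTop (𝓝 0) := by
        rw [integral_zero] at hdct
        refine hdct.congr fun n => ?_
        exact hval n
      exact sub_eq_zero.1 (tendsto_nhds_unique tendsto_const_nhds h3)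
    · refine (norm_sub_le _ _).trans ?_
      have e1 := hbd m₁ (iterDiff h w n)
      have e2 := hbd m₂ (iterDiff h w n)
      rw [Real.norm_eq_abs, Real.norm_eq_abs]
      linarith
  -- Both measures are even, so a general test function may be replaced by its symmetrization.
  refine ext_of_forall_integral_eq_of_IsFiniteMeasure fun f => ?_
  have hfa : Continuous fun u => f (antip u) := f.continuous.comp continuous_antip
  have hsym : ∀ (m : Measure T1S2) [IsProbabilityMeasure m], m.map antip = m →
      2 * ∫ u, f u ∂m = ∫ u, (f u + f (antip u)) ∂m := by
    intro m _ ha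
    rw [integral_add (integrable_of_continuous f.continuous) (integrable_of_continuous hfa)]
    have h3 : ∫ u, f (antip u) ∂m = ∫ u, f u ∂m := by
      conv_rhs => rw [← ha]
      rw [integral_map continuous_antip.measurable.aemeasurable f.continuous.aestronglyMeasurable]
    rw [h3, two_mul]
  have h3 := heven (fun u => f u + f (antip u)) (f.continuous.add hfa) fun u => by
    rw [antip_antip, add_comm]
  rw [← hsym m₁ ha₁, ← hsym m₂ ha₂] at h3
  linarith

/-- The conclusions of the theorem for a diffeomorphism that is not an isometry. -/
theorem exists_unique_isDiffusedStationary {h : Diff} (hp : MeasurePreserving h area area)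
    (hiso : ¬ Isometry h) {δ : ℝ} (hδ : 0 < δ) :
    ∃ m : Measure PS2, IsDiffusedStationary h δ m ∧ HasSmoothDensity m ∧
      (∀ m' : Measure PS2, IsDiffusedStationary h δ m' → m' = m) ∧
      HasRandomExponent (uniformBall δ) (coset h) (∫ v, Real.log (stretch h v) ∂m) ∧
      0 < ∫ v, Real.log (stretch h v) ∂m := by
  obtain ⟨m, φ, hprob, ha, hb, hs, hφ, h0, hf, hm, hD, hsm⟩ := exists_smooth_stationary hδ hp
  refine ⟨m.map toProj, hD, hsm, fun m' hm' => ?_, ?_, ?_⟩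
  · obtain ⟨m₁, hprob₁, he, ha₁, hb₁, hs₁⟩ := IsDiffusedStationary.exists_lift hδ hm'
    obtain ⟨φ₁, hφ₁, h₁, hf₁, hm₁⟩ := exists_continuous_density hδ hp hs₁
    rw [← he, eq_of_isStationary hδ hp hiso ha₁ ha hb₁ hb hs₁ hs hφ₁ hφ h₁ h0 hf₁ hf hm₁ hm]
  · rw [integral_log_stretch]
    exact hasRandomExponent hδ hp hb hs hφ.measurable hm
  · rw [integral_log_stretch]
    exact integral_log_stretch1_pos hδ hp hiso hφ h0 hf hm

end DiffusedSphere
end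

noncomputable section

namespace DiffusedSphere

/-! ### The twist maps -/

/-- The generator of the rotations about the first axis. -/
def axisGen : E3 →L[ℝ] E3 :=
  LinearMap.toContinuousLinearMap
    { toFun := fun y => !₂[0, -y 2, y 1]
      map_add' := fun x y => by ext i; fin_cases i <;> simp; ring
      map_smul' := fun c x => by ext i; fin_cases i <;> simp }

theorem axisGen_apply (y : E3) : axisGen y = !₂[0, -y 2, y 1] := rfl

theorem axisGen_axisGen_axisGen (y : E3) : axisGen (axisGen (axisGen y)) = -axisGen y := by
  ext i; fin_cases i <;> simp [axisGen_apply]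

theorem rotVec_axisRot_zero (t : ℝ) (y : E3) : rotVec (axisRot 0 t) y =
    y + (1 - Real.cos t) • axisGen (axisGen y) + Real.sin t • axisGen y := by
  ext i
  rw [E3.rotVec_apply]
  fin_cases i <;> simp [axisGen_apply, axisRot, axisMat] <;> ring

/-- Rodrigues' formula writes the rotation through its generator. Differentiating an angle that
depends on the point adds a rank-one term in the direction of rotation. -/
theorem hasFDerivAt_rotVec_axisRot {θ : E3 → ℝ} {θ' : E3 →L[ℝ] ℝ} {x : E3}
    (hθ : HasFDerivAt θ θ' x) :
    HasFDerivAt (fun y => rotVec (axisRot 0 (θ y)) y)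
      ((rotLin (axisRot 0 (θ x)) : E3 →L[ℝ] E3).comp
        (ContinuousLinearMap.id ℝ E3 + θ'.smulRight (axisGen x))) x := by
  have h1 : (fun y => rotVec (axisRot 0 (θ y)) y) = fun y =>
      y + (1 - Real.cos (θ y)) • axisGen (axisGen y) + Real.sin (θ y) • axisGen y :=
    funext fun y => rotVec_axisRot_zero _ _
  rw [h1]
  have h2 := ((hasFDerivAt_id (𝕜 := ℝ) x).add ((hθ.cos.const_sub 1).smul
    (axisGen.comp axisGen).hasFDerivAt)).add (hθ.sin.smul axisGen.hasFDerivAt)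
  refine h2.congr_fderiv ?_
  ext v : 1
  change _ = rotLin (axisRot 0 (θ x)) (v + θ' v • axisGen x)
  rw [rotLin_apply, rotVec_axisRot_zero]
  simp only [map_add, map_smul, axisGen_axisGen_axisGen]
  simp
  module

/-- The angle of the twist at height `r`. -/
def twistAngle (ε r : ℝ) : ℝ := 2 * Real.pi * (r / 2 + 1 / 2) * ε

theorem coe_twist (ε : ℝ) (x : S2) :
    (twist ε x : E3) = rotVec (axisRot 0 (twistAngle ε ((x : E3) 0))) x := by
  have h1 : (twist ε x : E3) = twistVec ε x := rfl
  rw [h1, twistVec_eq]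
  ext i
  rw [E3.rotVec_apply]
  fin_cases i <;> simp [axisRot, axisMat, twistAngle] <;> ring

theorem ext_twist {ε : ℝ} {y : E3} (hy : y ≠ 0) :
    ext (twist ε) y = rotVec (axisRot 0 (twistAngle ε (‖y‖⁻¹ * y 0))) y := by
  have h1 : ext (twist ε) y = ‖y‖ • (twist ε (radial y) : E3) := rfl
  rw [h1, coe_twist, ← rotLin_apply, ← rotLin_apply, ← map_smul, norm_smul_radial, coe_radial hy]
  rfl

/-- The angle is constant along rotations about the axis, so `θ'` kills `axisGen x`. The rank-one
term is then a transvection of determinant one, and the rotation in front preserves volume. -/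
theorem absDet_twist (ε : ℝ) (x : S2) : absDet (twist ε) x = 1 := by
  have hx := S2.coe_ne_zero x
  let θ : E3 → ℝ := fun y => twistAngle ε (‖y‖⁻¹ * y 0)
  have hθd : DifferentiableAt ℝ θ x := by
    have h1 : DifferentiableAt ℝ (fun y : E3 => ‖y‖⁻¹) x :=
      (differentiableAt_id.norm ℝ hx).inv (norm_ne_zero_iff.2 hx)
    have h2 : DifferentiableAt ℝ (fun y : E3 => y 0) x := by fun_prop
    have h3 : DifferentiableAt ℝ (fun y : E3 => ‖y‖⁻¹ * y 0) x := h1.mul h2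
    have h4 : Differentiable ℝ (twistAngle ε) := by unfold twistAngle; fun_prop
    exact (h4 _).comp (x : E3) h3
  have hθ := hθd.hasFDerivAt
  set θ' := fderiv ℝ θ (x : E3)
  have hzero : θ' (axisGen x) = 0 := by
    have h1 : rotVec (axisRot 0 0) (x : E3) = x := by
      rw [axisRot_zero]; exact rotVec_one _
    have hθ1 : HasFDerivAt θ θ' (rotVec (axisRot 0 0) (x : E3)) := by rwa [h1]
    have h2 := hθ1.comp_hasDerivAt (0 : ℝ) (hasDerivAt_rotVec_axisRot 0 (x : E3))
    have h3 : (θ ∘ fun s => rotVec (axisRot 0 s) (x : E3)) = fun _ => θ x := by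
      funext s
      have h4 : rotVec (axisRot 0 s) (x : E3) 0 = (x : E3) 0 := by
        rw [E3.rotVec_apply]
        simp [axisRot, axisMat]
      simp only [Function.comp_apply, θ, norm_rotVec, h4]
    rw [h3] at h2
    exact h2.unique (hasDerivAt_const 0 _)
  have hd : dext (twist ε) x = (rotLin (axisRot 0 (θ x)) : E3 →L[ℝ] E3).comp
      (ContinuousLinearMap.id ℝ E3 + θ'.smulRight (axisGen x)) := by
    refine HasFDerivAt.fderiv ?_
    refine (hasFDerivAt_rotVec_axisRot hθ).congr_of_eventuallyEq ?_
    filter_upwards [isOpen_ne.mem_nhds hx] with y hy using ext_twist hy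
  have hdet : (dext (twist ε) x).det = LinearMap.det
      (((rotLin (axisRot 0 (θ x))).toLinearEquiv : E3 →ₗ[ℝ] E3) ∘ₗ
        LinearMap.transvection (θ' : E3 →ₗ[ℝ] ℝ) (axisGen x)) := by
    rw [hd]
    congr 1
  rw [absDet, hdet, LinearMap.det_comp, abs_mul, abs_det_linearIsometryEquiv, one_mul,
    LinearMap.transvection.det]
  simp [hzero]

theorem measurePreserving_twist (ε : ℝ) : MeasurePreserving (twist ε) area area :=
  measurePreserving_of_absDet _ (absDet_twist ε)

theorem not_isometry_twist {ε : ℝ} (hε : ε ≠ 0) : ¬ Isometry (twist ε) := by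
  intro hiso
  -- Two points of one meridian, at heights `0` and `t`, are turned by angles differing by `π t ε`.
  -- This choice of `t` gives `0 < |t ε| < 1`, so the difference is not a multiple of `2π` and the
  -- distance changes.
  set t : ℝ := (1 + |ε|)⁻¹ with ht
  have hε0 : 0 < |ε| := abs_pos.2 hε
  have ht0 : 0 < t := by positivity
  have ht1 : t < 1 := inv_lt_one_of_one_lt₀ (by linarith)
  set s : ℝ := √(1 - t ^ 2)
  have hs2 : s ^ 2 = 1 - t ^ 2 := Real.sq_sqrt (by nlinarith)
  have hs0 : 0 < s := Real.sqrt_pos.2 (by nlinarith)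
  let p : S2 := ⟨!₂[0, 1, 0], by
    rw [mem_sphere_zero_iff_norm, ← sq_eq_sq₀ (norm_nonneg _) zero_le_one, E3.norm_sq]
    simp⟩
  let q : S2 := ⟨!₂[t, s, 0], by
    rw [mem_sphere_zero_iff_norm, ← sq_eq_sq₀ (norm_nonneg _) zero_le_one, E3.norm_sq]
    simp [hs2]⟩
  have h1 : dist (twist ε p) (twist ε q) ^ 2 = dist p q ^ 2 := by rw [hiso.dist_eq]
  rw [Subtype.dist_eq, Subtype.dist_eq, dist_eq_norm, dist_eq_norm, E3.norm_sq, E3.norm_sq,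
    coe_twist, coe_twist] at h1
  simp only [PiLp.sub_apply, E3.rotVec_apply, axisRot, axisMat, p, q] at h1
  simp at h1
  set A := twistAngle ε 0
  set B := twistAngle ε t
  have hA := Real.sin_sq_add_cos_sq A
  have hB := Real.sin_sq_add_cos_sq B
  have h2 : s * (Real.cos (B - A) - 1) = 0 := by
    rw [Real.cos_sub]
    nlinarith
  have h3 : Real.cos (B - A) = 1 := by
    rcases mul_eq_zero.1 h2 with h | h
    · exact absurd h hs0.ne'
    · linarith
  have h4 : B - A = Real.pi * (t * ε) := by
    simp only [A, B, twistAngle]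
    ring
  have h5 : |t * ε| < 1 := by
    rw [abs_mul, abs_of_pos ht0, ht, inv_mul_lt_iff₀ (by positivity)]
    linarith
  have hpi := Real.pi_pos
  have h6 := abs_lt.1 h5
  rw [h4, Real.cos_eq_one_iff_of_lt_of_lt (by nlinarith) (by nlinarith)] at h3
  have h7 : t * ε = 0 := (mul_eq_zero.1 h3).resolve_left hpi.ne'
  exact mul_ne_zero ht0.ne' hε h7

theorem isometry_of_coset {h : Diff} {g : SO3} (hi : Isometry (coset h g)) : Isometry h := by
  refine Isometry.of_dist_eq fun x y => ?_
  rw [← hi.dist_eq x y, coset_apply, coset_apply, Subtype.dist_eq, Subtype.dist_eq, S2.coe_smul,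
    S2.coe_smul, dist_eq_norm, dist_eq_norm, ← rotLin_apply, ← rotLin_apply, ← map_sub,
    LinearIsometryEquiv.norm_map]

end DiffusedSphere
end

/-! ### The theorem, for general diffeomorphisms and for rotated twists. -/

theorem mainTheorem6 :
    (∀ h₀ : DiffusedSphere.Diff,
      MeasurePreserving h₀ DiffusedSphere.area DiffusedSphere.area →
      ¬ Isometry h₀ →
      ∀ δ : ℝ, 0 < δ →
      ∃ m : Measure DiffusedSphere.PS2,
        DiffusedSphere.IsDiffusedStationary h₀ δ m ∧
        DiffusedSphere.HasSmoothDensity m ∧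
        (∀ m' : Measure DiffusedSphere.PS2,
          DiffusedSphere.IsDiffusedStationary h₀ δ m' → m' = m) ∧
        DiffusedSphere.HasRandomExponent (DiffusedSphere.uniformBall δ)
          (DiffusedSphere.coset h₀)
          (∫ v, Real.log (DiffusedSphere.stretch h₀ v) ∂m) ∧
        0 < ∫ v, Real.log (DiffusedSphere.stretch h₀ v) ∂m) ∧
    (∀ (g : DiffusedSphere.SO3) (ε : ℝ), ε ≠ 0 →
      ∀ δ : ℝ, 0 < δ →
      ∃ m : Measure DiffusedSphere.PS2,
        DiffusedSphere.IsDiffusedStationary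
          (DiffusedSphere.coset (DiffusedSphere.twist ε) g) δ m ∧
        DiffusedSphere.HasSmoothDensity m ∧
        (∀ m' : Measure DiffusedSphere.PS2,
          DiffusedSphere.IsDiffusedStationary
            (DiffusedSphere.coset (DiffusedSphere.twist ε) g) δ m' → m' = m) ∧
        DiffusedSphere.HasRandomExponent (DiffusedSphere.uniformBall δ)
          (DiffusedSphere.coset (DiffusedSphere.coset (DiffusedSphere.twist ε) g))
          (∫ v, Real.log (DiffusedSphere.stretch (DiffusedSphere.twist ε) v) ∂m) ∧
        0 < ∫ v, Real.log (DiffusedSphere.stretch (DiffusedSphere.twist ε) v) ∂m) := by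
  refine ⟨fun h₀ hp hiso δ hδ => ?_, fun g ε hε δ hδ => ?_⟩
  · exact DiffusedSphere.exists_unique_isDiffusedStationary hp hiso hδ
  · have h := DiffusedSphere.exists_unique_isDiffusedStationary
      (DiffusedSphere.measurePreserving_coset (DiffusedSphere.measurePreserving_twist ε) g)
      (fun hi => DiffusedSphere.not_isometry_twist hε (DiffusedSphere.isometry_of_coset hi)) hδ
    -- The fixed rotation `g` leaves the stretch unchanged, so the integrand for `g f_ε` is that of
    -- `f_ε`.
    simpa only [DiffusedSphere.stretch_coset] using h
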